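/- **Notation.** Let $\mathbb O=\mathbb H\oplus\mathbb H l$ be the octonion division algebra with product $(a,b)(c,d)=(ac-\bar d b,\;da+b\bar c)$, norm $n(a,b)=n(a)+n(b)$ and basis $(e_0,\dots,e_7)=(1,i,j,k,l,il,jl,kl)$. Let $p\mathbb O$ and $p\mathbb C$ be the symmetric composition algebras obtained from $\mathbb O$ and $\mathbb C$ (basis $e_0=1,\ e_1=i$, norm $|z|^2$) with product $x*y=\bar x\,\bar y$ and the same norm. For a symmetric composition algebra $(S,*)$ with polar form $q(x,y)=n(x+y)-n(x)-n(y)$, let $\mathfrak{tri}(S)$ be the Lie algebra of triples $(d_0,d_1,d_2)$ of $q$-skew endomorphisms of $S$ with $d_0(x*y)=d_1(x)*y+x*d_2(y)$, let $\vartheta(d_0,d_1,d_2)=(d_2,d_0,d_1)$, and let $$t_{x,y}=\Big(\sigma_{x,y},\ \tfrac12q(x,y)\,\mathrm{id}-r_xl_y,\ \tfrac12q(x,y)\,\mathrm{id}-l_xr_y\Big),\qquad \sigma_{x,y}(z)=q(x,z)y-q(y,z)x,\quad l_x(z)=x*z,\quad r_x(z)=z*x .$$ Let $(\varepsilon_0,\varepsilon_1,\varepsilon_2)=(1,-1,1)$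 and let $$\mathfrak g=\mathfrak g_{(1,-1,1)}(p\mathbb O,p\mathbb C)=\mathfrak{tri}(p\mathbb O)\oplus\mathfrak{tri}(p\mathbb C)\oplus\bigoplus_{i=0}^2\iota_i(p\mathbb O\otimes p\mathbb C)$$ be the real Lie algebra in which $\mathfrak{tri}(p\mathbb O)\oplus\mathfrak{tri}(p\mathbb C)$ is a subalgebra acting on $\iota_i(p\mathbb O\otimes p\mathbb C)$ through the $i$-th components, and, with indices modulo $3$ and primes denoting the objects of $p\mathbb C$, $$[\iota_i(x\otimes x'),\iota_{i+1}(y\otimes y')]=\varepsilon_{i+2}\,\iota_{i+2}((x*y)\otimes(x'*y')),$$ $$[\iota_i(x\otimes x'),\iota_i(y\otimes y')]=\varepsilon_{i+1}\varepsilon_{i+2}\big(q'(x',y')\,\vartheta^i(t_{x,y})+q(x,y)\,\vartheta'^i(t'_{x',y'})\big).$$ Put $\mathfrak t=\mathfrak{tri}(p\mathbb O)\oplus\mathfrak{tri}(p\mathbb C)\oplus\iota_1(p\mathbb O\otimes p\mathbb C)$ and $\mathfrak p=\iota_0(p\mathbb O\otimes p\mathbb C)\oplus\iota_2(p\mathbb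 O\otimes p\mathbb C)$, and $$h_1=\tfrac12t_{e_2,e_3},\quad h_2=\tfrac12t_{e_4,e_5},\quad h_3=\tfrac12t_{e_7,e_6},\quad h_4=\tfrac14(0,\sigma'_{e_0,e_1},-\sigma'_{e_0,e_1}),\quad h_5=\tfrac12\iota_0(e_0\otimes e_1),\quad h_6=\tfrac12\iota_0(e_1\otimes e_0).$$ Let $\mathfrak a=\langle h_5,h_6\rangle$, let $\mathfrak h$ be the subalgebra generated by $h_1,\dots,h_6$, and let $w_1,\dots,w_6$ denote the coordinates with respect to $h_1,\dots,h_6$. **Theorem.** 1. $\mathfrak g=\mathfrak t\oplus\mathfrak p$ is a Cartan decomposition (i.e. $\mathfrak t=\mathfrak g\cap\mathfrak u$, $\mathfrak p=\mathfrak g\cap \mathbf i\mathfrak u$ for a compact real form $\mathfrak u$ of $\mathfrak g^{\mathbb C}$). The Killing form is negative definite on $\mathfrak t$ and positive definite on $\mathfrak p$, $\dim\mathfrak t=46$, $\dim\mathfrak p=32$, and its signature is $-14$. The algebra $\mathfrak t$ is of type $D_5+Z$: it is the direct sum of its one-dimensional centre and $[\mathfrak t,\mathfrak t]$, and $[\mathfrak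 t,\mathfrak t]^{\mathbb C}$ is of type $D_5$. 2. $\mathfrak a$ is a two-dimensional maximal abelian subspace of $\mathfrak p$. The elements $h_1,\dots,h_6$ form a basis of $\mathfrak h$, which is a maximal abelian subalgebra of $\mathfrak g$, $\mathfrak h\cap\mathfrak t=\langle t_{e_2,e_3},t_{e_4,e_5},t_{e_6,e_7},(0,\sigma'_{e_0,e_1},-\sigma'_{e_0,e_1})\rangle$ and $\mathfrak h=\mathfrak a+(\mathfrak h\cap\mathfrak t)$. 3. $\mathfrak g^{\mathbb C}$ is simple with nondegenerate Killing form, $\mathfrak h^{\mathbb C}$ is a Cartan subalgebra, and the set of roots is $$\begin{aligned}\Delta=&\{\pm\mathbf i w_k\pm w_5,\ \pm\mathbf i w_k\pm w_6\mid k=1,2,3\}\cup\{\mathbf i(\pm w_k\pm w_m)\mid 1\le k<m\le3\}\cup\{\pm w_5\pm w_6\}\\&\cup\{\tfrac12(\mathbf i(s_1w_1+s_2w_2+s_3w_3+s_4w_4)+s_5w_5+s_6w_6)\mid s_j=\pm1,\ s_1s_2s_3s_4s_5s_6=-1\}.\end{aligned}$$ 4. The functionals $$\begin{aligned}\alpha_1&=\tfrac12(-\mathbf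 iw_1-\mathbf iw_2-\mathbf iw_3-\mathbf iw_4-w_5+w_6),&\alpha_2&=-\mathbf iw_1+w_5,&\alpha_3&=\mathbf i(w_2+w_3),\\ \alpha_4&=\mathbf i(w_1-w_2),&\alpha_5&=\mathbf i(w_2-w_3),&\alpha_6&=\tfrac12(-\mathbf iw_1-\mathbf iw_2+\mathbf iw_3+\mathbf iw_4-w_5+w_6)\end{aligned}$$ form a base of the root system $\Delta$, adapted to $\mathfrak a$: the roots vanishing on $\mathfrak a$ are exactly those which are integral combinations, with coefficients of the same sign, of the $\alpha_i$ vanishing on $\mathfrak a$. The Dynkin diagram is $E_6$ with edges $\alpha_1\alpha_3,\alpha_3\alpha_4,\alpha_4\alpha_5,\alpha_5\alpha_6,\alpha_2\alpha_4$. In the Satake diagram $\alpha_3,\alpha_4,\alpha_5$ are black (vanish on $\mathfrak a$), $\alpha_1,\alpha_2,\alpha_6$ are white, and the only arrow joins $\alpha_1$ and $\alpha_6$ (they are the only two distinct white nodes with the same restriction to $\mathfrak a$). 5. The set of restricted roots with respect to $\mathfrak a$ is $$\Sigma=\{\pm w_5,\ \pm w_6,\ \pm w_5\pm w_6,\ \tfrac12(\pm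 w_5\pm w_6)\},$$ a root system of type $BC_2$. With $\beta_1=\alpha_1+\alpha_2+\alpha_3+\alpha_4$ and $\beta_2=-\alpha_2$, whose restrictions to $\mathfrak a$ are $\bar\beta_1=\frac12(w_5+w_6)$ and $\bar\beta_2=-w_5$, one has $\Sigma=\pm\{\bar\beta_1,\bar\beta_2,\bar\beta_1+\bar\beta_2,2\bar\beta_1+\bar\beta_2,2\bar\beta_1,2\bar\beta_1+2\bar\beta_2\}$. The multiplicities are $8$ for the roots $\frac12(\pm w_5\pm w_6)$, $1$ for $\pm w_5\pm w_6$, and $6$ for $\pm w_5$ and $\pm w_6$. 6. The maximal root is $\alpha_1+2\alpha_2+2\alpha_3+3\alpha_4+2\alpha_5+\alpha_6=w_5+w_6$, and its restriction to $\mathfrak a$ has multiplicity $1$. -/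

import Mathlib

open scoped TensorProduct Quaternion ComplexConjugate

set_option linter.unusedSimpArgs false

noncomputable section

namespace RealForms

/-- A real symmetric composition algebra: a nondegenerate multiplicative quadratic form `norm` with
`n(x * y, z) = n(x, y * z)` for its polar form. -/
structure SymmetricCompositionAlgebra (S : Type*) [AddCommGroup S] [Module ℝ S] where
  mul : S →ₗ[ℝ] S →ₗ[ℝ] S
  norm : QuadraticForm ℝ S
  nondegenerate : ∀ x, (∀ y, norm.polarBilin x y = 0) → x = 0
  norm_mul : ∀ x y, norm (mul x y) = norm x * norm y
  assoc : ∀ x y z, norm.polarBilin (mul x y) z = norm.polarBilin x (mul y z)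

namespace SymmetricCompositionAlgebra

variable {S : Type*} [AddCommGroup S] [Module ℝ S] (A : SymmetricCompositionAlgebra S)

/-- The polar form of the norm. -/
def q : S →ₗ[ℝ] S →ₗ[ℝ] ℝ := A.norm.polarBilin

lemma q_apply (x y : S) : A.q x y = A.norm (x + y) - A.norm x - A.norm y := rfl

lemma q_assoc (x y z : S) : A.q (A.mul x y) z = A.q x (A.mul y z) := A.assoc x y z

lemma q_symm (x y : S) : A.q x y = A.q y x := by
  simp only [q_apply, add_comm x y]
  ring

lemma q_ext {x y : S} (h : ∀ z, A.q x z = A.q y z) : x = y := by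
  rw [← sub_eq_zero]
  apply A.nondegenerate
  intro z
  change A.q (x - y) z = 0
  rw [map_sub, LinearMap.sub_apply, h z, sub_self]

lemma q_mul_left (x y z : S) : A.q (A.mul x y) (A.mul x z) = A.norm x * A.q y z := by
  simp only [q_apply, ← map_add, A.norm_mul]
  ring

lemma q_mul_right (x y z : S) : A.q (A.mul y x) (A.mul z x) = A.q y z * A.norm x := by
  simp only [q_apply]
  rw [← LinearMap.add_apply, ← map_add, A.norm_mul, A.norm_mul, A.norm_mul]
  ring

lemma mul_mul_self (x y : S) : A.mul (A.mul x y) x = A.norm x • y := by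
  apply A.q_ext
  intro z
  rw [A.q_assoc, A.q_mul_left]; simp

lemma self_mul_mul (x y : S) : A.mul x (A.mul y x) = A.norm x • y := by
  apply A.q_ext
  intro z
  rw [q_symm, ← A.q_assoc, q_mul_right, q_symm]; simp [mul_comm]

lemma left_lin (x y z : S) :
    A.mul (A.mul x y) z + A.mul (A.mul z y) x = A.q x z • y := by
  have h := A.mul_mul_self (x + z) y
  simp only [map_add, LinearMap.add_apply] at h
  rw [A.mul_mul_self, A.mul_mul_self] at h
  rw [q_apply]
  linear_combination (norm := module) h

lemma right_lin (x y z : S) :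
    A.mul x (A.mul y z) + A.mul z (A.mul y x) = A.q x z • y := by
  have h := A.self_mul_mul (x + z) y
  simp only [map_add, LinearMap.add_apply] at h
  rw [A.self_mul_mul, A.self_mul_mul] at h
  rw [q_apply]
  linear_combination (norm := module) h

/-- The triality Lie algebra (as a space of triples of endomorphisms). -/
def tri : Submodule ℝ (Fin 3 → Module.End ℝ S) where
  carrier := {d | (∀ i x y, A.q (d i x) y + A.q x (d i y) = 0) ∧
    ∀ x y, d 0 (A.mul x y) = A.mul (d 1 x) y + A.mul x (d 2 y)}
  add_mem' := by
    rintro d e ⟨hd, hd'⟩ ⟨he, he'⟩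
    refine ⟨fun i x y => ?_, fun x y => ?_⟩
    · have h1 := hd i x y
      have h2 := he i x y
      simp only [Pi.add_apply, LinearMap.add_apply, map_add]
      linear_combination h1 + h2
    · simp only [Pi.add_apply, LinearMap.add_apply, map_add, hd', he']
      abel
  zero_mem' := by simp
  smul_mem' := by
    rintro c d ⟨hd, hd'⟩
    refine ⟨fun i x y => ?_, fun x y => ?_⟩
    · have h1 := hd i x y
      simp only [Pi.smul_apply, LinearMap.smul_apply, map_smul, smul_eq_mul]
      linear_combination c * h1
    · simp only [Pi.smul_apply, LinearMap.smul_apply, map_smul, hd', smul_add]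

lemma tri_skew (d : A.tri) (i : Fin 3) (x y : S) : A.q (d.1 i x) y = - A.q x (d.1 i y) := by
  have := d.2.1 i x y
  linarith

lemma tri_zero (d : A.tri) (x y : S) :
    d.1 0 (A.mul x y) = A.mul (d.1 1 x) y + A.mul x (d.1 2 y) := d.2.2 x y

lemma tri_two (d : A.tri) (x y : S) :
    d.1 2 (A.mul x y) = A.mul (d.1 0 x) y + A.mul x (d.1 1 y) := by
  apply A.q_ext
  intro z
  have h := congrArg (A.q x) (A.tri_zero d y z)
  have h0 := A.tri_skew d 0 x (A.mul y z)
  rw [A.tri_skew, A.q_assoc]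
  simp only [map_add, LinearMap.add_apply, A.q_assoc] at h h0 ⊢
  linear_combination h - h0

lemma tri_one (d : A.tri) (x y : S) :
    d.1 1 (A.mul x y) = A.mul (d.1 2 x) y + A.mul x (d.1 0 y) := by
  apply A.q_ext
  intro z
  have h := congrArg (A.q x) (A.tri_two d y z)
  have h0 := A.tri_skew d 2 x (A.mul y z)
  rw [A.tri_skew, A.q_assoc]
  simp only [map_add, LinearMap.add_apply, A.q_assoc] at h h0 ⊢
  linear_combination h - h0

/-- The triality automorphism `(d₀, d₁, d₂) ↦ (d₂, d₀, d₁)`. -/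
def theta : A.tri →ₗ[ℝ] A.tri where
  toFun d := ⟨![d.1 2, d.1 0, d.1 1], by
    refine ⟨fun i x y => ?_, fun x y => ?_⟩
    · fin_cases i
      · exact d.2.1 2 x y
      · exact d.2.1 0 x y
      · exact d.2.1 1 x y
    · exact A.tri_two d x y⟩
  map_add' d e := by
    ext i : 2
    fin_cases i <;> rfl
  map_smul' c d := by
    ext i : 2
    fin_cases i <;> rfl

/-- The commutator of the triality Lie algebra, taken componentwise. -/
def triLie (d e : A.tri) : A.tri :=
  ⟨fun i => d.1 i * e.1 i - e.1 i * d.1 i, by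
    refine ⟨fun i x y => ?_, fun x y => ?_⟩
    · simp only [LinearMap.sub_apply, Module.End.mul_apply, map_sub, A.tri_skew]
      ring
    · simp only [LinearMap.sub_apply, Module.End.mul_apply, map_sub, A.tri_zero, map_add]
      abel⟩

/-- The triple `t_{x,y}`. -/
def tFun (x y : S) : Fin 3 → Module.End ℝ S :=
  ![(A.q x).smulRight y - (A.q y).smulRight x,
    (2⁻¹ * A.q x y) • 1 - (A.mul.flip x) ∘ₗ (A.mul y),
    (2⁻¹ * A.q x y) • 1 - (A.mul x) ∘ₗ (A.mul.flip y)]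

lemma tFun_zero_apply (x y z : S) : A.tFun x y 0 z = A.q x z • y - A.q y z • x := by
  simp [tFun]

lemma tFun_one_apply (x y z : S) :
    A.tFun x y 1 z = (2⁻¹ * A.q x y) • z - A.mul (A.mul y z) x := by
  simp [tFun]

lemma tFun_two_apply (x y z : S) :
    A.tFun x y 2 z = (2⁻¹ * A.q x y) • z - A.mul x (A.mul z y) := by
  simp [tFun]

lemma q_skew_of_self {f : Module.End ℝ S} (h : ∀ x, A.q (f x) x = 0) (x y : S) :
    A.q (f x) y + A.q x (f y) = 0 := by
  have h1 := h (x + y)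
  simp only [map_add, LinearMap.add_apply, h] at h1
  rw [A.q_symm x]
  linarith

lemma tFun_mem (x y : S) : A.tFun x y ∈ A.tri := by
  refine ⟨fun i a b => ?_, fun a b => ?_⟩
  · have hself : ∀ c, A.q c c = 2 * A.norm c := by
      intro c
      rw [q_apply, ← two_smul ℝ c, QuadraticMap.map_smul]
      simp only [smul_eq_mul]
      ring
    refine A.q_skew_of_self (fun c => ?_) a b
    fin_cases i
    · change A.q (A.tFun x y 0 c) c = 0
      rw [tFun_zero_apply]
      simp only [map_sub, map_smul, LinearMap.sub_apply, LinearMap.smul_apply, smul_eq_mul]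
      ring
    · change A.q (A.tFun x y 1 c) c = 0
      rw [tFun_one_apply]
      simp only [map_sub, map_smul, LinearMap.sub_apply, LinearMap.smul_apply, smul_eq_mul]
      rw [A.q_assoc, A.q_mul_right, hself, A.q_symm x y]
      ring
    · change A.q (A.tFun x y 2 c) c = 0
      rw [tFun_two_apply]
      simp only [map_sub, map_smul, LinearMap.sub_apply, LinearMap.smul_apply, smul_eq_mul]
      rw [A.q_symm (A.mul x _) c, ← A.q_assoc, A.q_mul_left, hself, A.q_symm x y]
      ring
  · rw [tFun_zero_apply, tFun_one_apply, tFun_two_apply]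
    simp only [map_sub, map_smul, LinearMap.sub_apply, LinearMap.smul_apply]
    have h1 := A.left_lin (A.mul y a) x b
    have h2 := A.right_lin x b y
    have h3 := A.right_lin (A.mul b x) y a
    have h4 := congrArg (A.mul a) h2
    simp only [map_add, map_smul] at h4
    have e1 : A.q (A.mul y a) b = A.q y (A.mul a b) := A.q_assoc y a b
    have e2 : A.q (A.mul b x) a = A.q x (A.mul a b) := by
      rw [A.q_symm, ← A.q_assoc, A.q_symm]
    rw [e1] at h1
    rw [e2] at h3
    linear_combination (norm := module) h1 + h4 - h3

/-- `t_{x,y}` as an element of the triality Lie algebra, bilinear in `x` and `y`. -/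
def t : S →ₗ[ℝ] S →ₗ[ℝ] A.tri :=
  LinearMap.mk₂ ℝ (fun x y => ⟨A.tFun x y, A.tFun_mem x y⟩)
    (fun x x' y => by
      ext i z
      fin_cases i <;> simp [tFun, add_smul, mul_add] <;> module)
    (fun c x y => by
      ext i z
      fin_cases i <;> simp [tFun] <;> module)
    (fun x y y' => by
      ext i z
      fin_cases i <;> simp [tFun, add_smul, mul_add] <;> module)
    (fun c x y => by
      ext i z
      fin_cases i <;> simp [tFun] <;> module)

lemma t_zero_apply (x y z : S) : (A.t x y).1 0 z = A.q x z • y - A.q y z • x :=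
  A.tFun_zero_apply x y z

lemma t_one_apply (x y z : S) :
    (A.t x y).1 1 z = (2⁻¹ * A.q x y) • z - A.mul (A.mul y z) x := A.tFun_one_apply x y z

lemma t_two_apply (x y z : S) :
    (A.t x y).1 2 z = (2⁻¹ * A.q x y) • z - A.mul x (A.mul z y) := A.tFun_two_apply x y z

lemma tri_ext {d e : A.tri} (h0 : ∀ z, d.1 0 z = e.1 0 z) (h1 : ∀ z, d.1 1 z = e.1 1 z)
    (h2 : ∀ z, d.1 2 z = e.1 2 z) : d = e := by
  ext i z
  fin_cases i
  · exact h0 z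
  · exact h1 z
  · exact h2 z

@[simp] lemma theta_apply_zero (d : A.tri) : (A.theta d).1 0 = d.1 2 := rfl
@[simp] lemma theta_apply_one (d : A.tri) : (A.theta d).1 1 = d.1 0 := rfl
@[simp] lemma theta_apply_two (d : A.tri) : (A.theta d).1 2 = d.1 1 := rfl

@[simp] lemma triLie_apply (d e : A.tri) (i : Fin 3) (z : S) :
    (A.triLie d e).1 i z = d.1 i (e.1 i z) - e.1 i (d.1 i z) := rfl

lemma t_skew (x y : S) : A.t y x = - A.t x y := by
  apply A.tri_ext <;> intro z <;>
    simp only [Submodule.coe_neg, Pi.neg_apply, LinearMap.neg_apply, t_zero_apply, t_one_apply,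
      t_two_apply, A.q_symm y x]
  · abel
  · have := A.left_lin x z y
    linear_combination (norm := module) - this
  · have := A.right_lin x z y
    linear_combination (norm := module) - this

lemma triLie_t (d : A.tri) (x y : S) :
    A.triLie d (A.t x y) = A.t (d.1 0 x) y + A.t x (d.1 0 y) := by
  have h := A.tri_skew d 0 x y
  apply A.tri_ext <;> intro z <;>
    simp only [Submodule.coe_add, Pi.add_apply, LinearMap.add_apply, triLie_apply, t_zero_apply,
      t_one_apply, t_two_apply, map_sub, map_smul, A.tri_one, A.tri_two, A.tri_skew,
      map_add]
  · module
  · module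
  · module

lemma t_cyclic (x y z : S) :
    A.t (A.mul x y) z + A.theta (A.t (A.mul y z) x) + A.theta (A.theta (A.t (A.mul z x) y)) = 0 := by
  have e1 : A.q (A.mul y z) x = A.q (A.mul x y) z := by rw [q_symm, ← q_assoc]
  have e2 : A.q (A.mul z x) y = A.q (A.mul x y) z := by rw [q_assoc, q_symm]
  have key : ∀ x y z w, A.q (A.mul x y) w • z - A.q z w • A.mul x y +
      A.q (A.mul x y) z • w - A.mul (A.mul y z) (A.mul w x) - A.mul (A.mul y w) (A.mul z x) = 0 := by
    intro x y z w
    have h1 := A.left_lin y z (A.mul w x)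
    have h2 := A.left_lin y w (A.mul z x)
    have h3 := congrArg (fun s => A.mul s y) (A.left_lin z x w)
    have f1 : A.q y (A.mul w x) = A.q (A.mul x y) w := by
      rw [← q_assoc, q_symm, ← q_assoc]
    have f2 : A.q y (A.mul z x) = A.q (A.mul x y) z := by
      rw [← q_assoc, q_symm, ← q_assoc]
    rw [f1] at h1
    rw [f2] at h2
    simp only [map_add, LinearMap.add_apply, map_smul, LinearMap.smul_apply] at h3
    linear_combination (norm := module) -h1 -h2 +h3
  apply A.tri_ext <;> intro w <;>
    simp only [Submodule.coe_add, Pi.add_apply, LinearMap.add_apply, t_zero_apply,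
      t_one_apply, t_two_apply, theta_apply_zero, theta_apply_one, theta_apply_two, e1, e2,
      Submodule.coe_zero, Pi.zero_apply, LinearMap.zero_apply]
  · linear_combination (norm := module) key x y z w
  · have := key y z x w
    rw [e1] at this
    linear_combination (norm := module) this
  · have := key z x y w
    rw [e2] at this
    linear_combination (norm := module) this


end SymmetricCompositionAlgebra

section Magic

variable {S S' : Type*} [AddCommGroup S] [Module ℝ S] [AddCommGroup S'] [Module ℝ S']

/-- The underlying space `tri(S) ⊕ tri(S') ⊕ ι₀(S ⊗ S') ⊕ ι₁(S ⊗ S') ⊕ ι₂(S ⊗ S')`. -/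
@[ext] structure MagicAlgebra (ε : Fin 3 → ℝ) (A : SymmetricCompositionAlgebra S)
    (A' : SymmetricCompositionAlgebra S') where
  tri : A.tri
  tri' : A'.tri
  iota : Fin 3 → S ⊗[ℝ] S'

namespace MagicAlgebra

variable {ε : Fin 3 → ℝ} {A : SymmetricCompositionAlgebra S} {A' : SymmetricCompositionAlgebra S'}

/-- The underlying space as a product. -/
def equivProd (ε : Fin 3 → ℝ) (A : SymmetricCompositionAlgebra S)
    (A' : SymmetricCompositionAlgebra S') :
    MagicAlgebra ε A A' ≃ A.tri × A'.tri × (Fin 3 → S ⊗[ℝ] S') where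
  toFun X := (X.tri, X.tri', X.iota)
  invFun p := ⟨p.1, p.2.1, p.2.2⟩
  left_inv _ := rfl
  right_inv _ := rfl

instance : AddCommGroup (MagicAlgebra ε A A') := (equivProd ε A A').addCommGroup

instance : Module ℝ (MagicAlgebra ε A A') := (equivProd ε A A').module ℝ

@[simp] lemma zero_tri : (0 : MagicAlgebra ε A A').tri = 0 := rfl
@[simp] lemma zero_tri' : (0 : MagicAlgebra ε A A').tri' = 0 := rfl
@[simp] lemma zero_iota : (0 : MagicAlgebra ε A A').iota = 0 := rfl
@[simp] lemma add_tri (X Y : MagicAlgebra ε A A') : (X + Y).tri = X.tri + Y.tri := rfl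
@[simp] lemma add_tri' (X Y : MagicAlgebra ε A A') : (X + Y).tri' = X.tri' + Y.tri' := rfl
@[simp] lemma add_iota (X Y : MagicAlgebra ε A A') : (X + Y).iota = X.iota + Y.iota := rfl
@[simp] lemma smul_tri (c : ℝ) (X : MagicAlgebra ε A A') : (c • X).tri = c • X.tri := rfl
@[simp] lemma smul_tri' (c : ℝ) (X : MagicAlgebra ε A A') : (c • X).tri' = c • X.tri' := rfl
@[simp] lemma smul_iota (c : ℝ) (X : MagicAlgebra ε A A') : (c • X).iota = c • X.iota := rfl

/-- The action of `tri(S)` on `S ⊗ S'` through the `i`-th component. -/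
def actL (d : A.tri) (i : Fin 3) : S ⊗[ℝ] S' →ₗ[ℝ] S ⊗[ℝ] S' := (d.1 i).rTensor S'

/-- The action of `tri(S')` on `S ⊗ S'` through the `i`-th component. -/
def actR (d : A'.tri) (i : Fin 3) : S ⊗[ℝ] S' →ₗ[ℝ] S ⊗[ℝ] S' := (d.1 i).lTensor S

variable (A A')

/-- `(x ⊗ x', y ⊗ y') ↦ (x * y) ⊗ (x' ⋆ y')`. -/
def tmul : S ⊗[ℝ] S' →ₗ[ℝ] S ⊗[ℝ] S' →ₗ[ℝ] S ⊗[ℝ] S' := TensorProduct.map₂ A.mul A'.mul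

/-- `(x ⊗ x', y ⊗ y') ↦ q'(x', y') t_{x,y}`. -/
def tauL : S ⊗[ℝ] S' →ₗ[ℝ] S ⊗[ℝ] S' →ₗ[ℝ] A.tri :=
  (TensorProduct.map₂ A.t A'.q).compr₂ (TensorProduct.rid ℝ A.tri).toLinearMap

/-- `(x ⊗ x', y ⊗ y') ↦ q(x, y) t'_{x',y'}`. -/
def tauR : S ⊗[ℝ] S' →ₗ[ℝ] S ⊗[ℝ] S' →ₗ[ℝ] A'.tri :=
  (TensorProduct.map₂ A.q A'.t).compr₂ (TensorProduct.lid ℝ A'.tri).toLinearMap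

variable {A A'}

@[simp] lemma actL_tmul (d : A.tri) (i : Fin 3) (x : S) (x' : S') :
    actL d i (x ⊗ₜ[ℝ] x') = d.1 i x ⊗ₜ x' := rfl
@[simp] lemma actR_tmul (d : A'.tri) (i : Fin 3) (x : S) (x' : S') :
    actR d i (x ⊗ₜ[ℝ] x') = x ⊗ₜ d.1 i x' := rfl
@[simp] lemma tmul_tmul (x y : S) (x' y' : S') :
    tmul A A' (x ⊗ₜ x') (y ⊗ₜ y') = A.mul x y ⊗ₜ A'.mul x' y' := rfl
@[simp] lemma tauL_tmul (x y : S) (x' y' : S') :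
    tauL A A' (x ⊗ₜ x') (y ⊗ₜ y') = A'.q x' y' • A.t x y := by simp [tauL]
@[simp] lemma tauR_tmul (x y : S) (x' y' : S') :
    tauR A A' (x ⊗ₜ x') (y ⊗ₜ y') = A.q x y • A'.t x' y' := by simp [tauR]

/-- The bracket of the symmetric magic square construction. -/
instance : Bracket (MagicAlgebra ε A A') (MagicAlgebra ε A A') where
  bracket X Y :=
    { tri := A.triLie X.tri Y.tri +
        ∑ i : Fin 3, (ε (i + 1) * ε (i + 2)) • (A.theta ^ (i : ℕ)) (tauL A A' (X.iota i) (Y.iota i))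
      tri' := A'.triLie X.tri' Y.tri' +
        ∑ i : Fin 3, (ε (i + 1) * ε (i + 2)) • (A'.theta ^ (i : ℕ)) (tauR A A' (X.iota i) (Y.iota i))
      iota := fun k =>
        actL X.tri k (Y.iota k) + actR X.tri' k (Y.iota k)
          - actL Y.tri k (X.iota k) - actR Y.tri' k (X.iota k)
          + ε k • (tmul A A' (X.iota (k + 1)) (Y.iota (k + 2))
            - tmul A A' (Y.iota (k + 1)) (X.iota (k + 2))) }

lemma actL_add (d e : A.tri) (i : Fin 3) (u : S ⊗[ℝ] S') :
    actL (d + e) i u = actL d i u + actL e i u := by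
  simp [actL, LinearMap.rTensor_add]

lemma actL_smul (c : ℝ) (d : A.tri) (i : Fin 3) (u : S ⊗[ℝ] S') :
    actL (c • d) i u = c • actL d i u := by
  simp [actL, LinearMap.rTensor_smul]

lemma actR_add (d e : A'.tri) (i : Fin 3) (u : S ⊗[ℝ] S') :
    actR (d + e) i u = actR d i u + actR e i u := by
  simp [actR, LinearMap.lTensor_add]

lemma actR_smul (c : ℝ) (d : A'.tri) (i : Fin 3) (u : S ⊗[ℝ] S') :
    actR (c • d) i u = c • actR d i u := by
  simp [actR, LinearMap.lTensor_smul]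

lemma ind₁ {p : S ⊗[ℝ] S' → Prop} (h : ∀ x x', p (x ⊗ₜ x'))
    (ha : ∀ u v, p u → p v → p (u + v)) (u : S ⊗[ℝ] S') : p u :=
  u.induction_on (by simpa using h 0 0) h ha

lemma actL_triLie (d e : A.tri) (i : Fin 3) (u : S ⊗[ℝ] S') :
    actL (A.triLie d e) i u = actL d i (actL e i u) - actL e i (actL d i u) := by
  induction u using ind₁ with
  | h x x' => simp [TensorProduct.sub_tmul]
  | ha u v hu hv => simp only [map_add, hu, hv]; abel

lemma actR_triLie (d e : A'.tri) (i : Fin 3) (u : S ⊗[ℝ] S') :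
    actR (A'.triLie d e) i u = actR d i (actR e i u) - actR e i (actR d i u) := by
  induction u using ind₁ with
  | h x x' => simp [TensorProduct.tmul_sub]
  | ha u v hu hv => simp only [map_add, hu, hv]; abel

lemma actL_actR (d : A.tri) (e : A'.tri) (i : Fin 3) (u : S ⊗[ℝ] S') :
    actL d i (actR e i u) = actR e i (actL d i u) := by
  induction u using ind₁ with
  | h x x' => simp
  | ha u v hu hv => simp only [map_add, hu, hv]

lemma actL_mul (d : A.tri) (k : Fin 3) (u v : S ⊗[ℝ] S') :
    actL d k (tmul A A' u v) =
      tmul A A' (actL d (k + 1) u) v + tmul A A' u (actL d (k + 2) v) := by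
  induction u using ind₁ with
  | ha u u' hu hv => simp only [map_add, LinearMap.add_apply, hu, hv]; abel
  | h x x' =>
    induction v using ind₁ with
    | ha u u' hu hv => simp only [map_add, hu, hv]; abel
    | h y y' =>
      fin_cases k
      · simp [A.tri_zero, TensorProduct.add_tmul]
      · simp [A.tri_one, TensorProduct.add_tmul]
      · simp [A.tri_two, TensorProduct.add_tmul]

lemma actR_mul (d : A'.tri) (k : Fin 3) (u v : S ⊗[ℝ] S') :
    actR d k (tmul A A' u v) =
      tmul A A' (actR d (k + 1) u) v + tmul A A' u (actR d (k + 2) v) := by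
  induction u using ind₁ with
  | ha u u' hu hv => simp only [map_add, LinearMap.add_apply, hu, hv]; abel
  | h x x' =>
    induction v using ind₁ with
    | ha u u' hu hv => simp only [map_add, hu, hv]; abel
    | h y y' =>
      fin_cases k
      · simp [A'.tri_zero, TensorProduct.tmul_add]
      · simp [A'.tri_one, TensorProduct.tmul_add]
      · simp [A'.tri_two, TensorProduct.tmul_add]

lemma tauL_skew (u v : S ⊗[ℝ] S') : tauL A A' v u = - tauL A A' u v := by
  induction u using ind₁ with
  | ha u u' hu hv => simp only [map_add, LinearMap.add_apply, hu, hv]; abel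
  | h x x' =>
    induction v using ind₁ with
    | ha u u' hu hv => simp only [map_add, LinearMap.add_apply, hu, hv]; abel
    | h y y' => simp [A.t_skew x y, A'.q_symm y' x']

lemma tauR_skew (u v : S ⊗[ℝ] S') : tauR A A' v u = - tauR A A' u v := by
  induction u using ind₁ with
  | ha u u' hu hv => simp only [map_add, LinearMap.add_apply, hu, hv]; abel
  | h x x' =>
    induction v using ind₁ with
    | ha u u' hu hv => simp only [map_add, LinearMap.add_apply, hu, hv]; abel
    | h y y' => simp [A'.t_skew x' y', A.q_symm y x]

lemma tauL_self (u : S ⊗[ℝ] S') : tauL A A' u u = 0 := by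
  have h := tauL_skew (A := A) (A' := A') u u
  have h2 : (2 : ℝ) • tauL A A' u u = 0 := by
    linear_combination (norm := module) h
  simpa using h2

lemma tauR_self (u : S ⊗[ℝ] S') : tauR A A' u u = 0 := by
  have h := tauR_skew (A := A) (A' := A') u u
  have h2 : (2 : ℝ) • tauR A A' u u = 0 := by
    linear_combination (norm := module) h
  simpa using h2

lemma triLie_add_right (B : SymmetricCompositionAlgebra S) (d e f : B.tri) :
    B.triLie d (e + f) = B.triLie d e + B.triLie d f := by
  apply B.tri_ext <;> intro z <;> simp <;> abel

lemma triLie_smul_right (B : SymmetricCompositionAlgebra S) (c : ℝ) (d e : B.tri) :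
    B.triLie d (c • e) = c • B.triLie d e := by
  apply B.tri_ext <;> intro z <;> simp [smul_sub]

lemma triLie_skew (B : SymmetricCompositionAlgebra S) (d e : B.tri) :
    B.triLie e d = - B.triLie d e := by
  apply B.tri_ext <;> intro z <;> simp

lemma triLie_theta (B : SymmetricCompositionAlgebra S) (d e : B.tri) :
    B.triLie (B.theta d) (B.theta e) = B.theta (B.triLie d e) := by
  apply B.tri_ext <;> intro z <;> rfl

lemma theta_theta_theta (B : SymmetricCompositionAlgebra S) (d : B.tri) :
    B.theta (B.theta (B.theta d)) = d := by
  apply B.tri_ext <;> intro z <;> rfl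

lemma triLie_tauL_zero (d : A.tri) (u v : S ⊗[ℝ] S') :
    A.triLie d (tauL A A' u v) = tauL A A' (actL d 0 u) v + tauL A A' u (actL d 0 v) := by
  induction u using ind₁ with
  | ha u u' hu hv => simp only [map_add, LinearMap.add_apply, triLie_add_right, hu, hv]; abel
  | h x x' =>
    induction v using ind₁ with
    | ha u u' hu hv => simp only [map_add, triLie_add_right, hu, hv]; abel
    | h y y' => simp [triLie_smul_right, A.triLie_t]

lemma triLie_tauR_zero (d : A'.tri) (u v : S ⊗[ℝ] S') :
    A'.triLie d (tauR A A' u v) = tauR A A' (actR d 0 u) v + tauR A A' u (actR d 0 v) := by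
  induction u using ind₁ with
  | ha u u' hu hv => simp only [map_add, LinearMap.add_apply, triLie_add_right, hu, hv]; abel
  | h x x' =>
    induction v using ind₁ with
    | ha u u' hu hv => simp only [map_add, triLie_add_right, hu, hv]; abel
    | h y y' => simp [triLie_smul_right, A'.triLie_t]

lemma triLie_tauL_one (d : A.tri) (u v : S ⊗[ℝ] S') :
    A.triLie d (A.theta (tauL A A' u v)) =
      A.theta (tauL A A' (actL d 1 u) v) + A.theta (tauL A A' u (actL d 1 v)) := by
  have h := triLie_tauL_zero (A' := A') (A.theta (A.theta d)) u v
  have h2 := congrArg A.theta h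
  rw [← triLie_theta, theta_theta_theta, map_add] at h2
  exact h2

lemma triLie_tauL_two (d : A.tri) (u v : S ⊗[ℝ] S') :
    A.triLie d (A.theta (A.theta (tauL A A' u v))) =
      A.theta (A.theta (tauL A A' (actL d 2 u) v)) +
        A.theta (A.theta (tauL A A' u (actL d 2 v))) := by
  have h := triLie_tauL_one (A' := A') (A.theta (A.theta d)) u v
  have h2 := congrArg A.theta h
  rw [← triLie_theta, theta_theta_theta, map_add] at h2
  exact h2

lemma triLie_tauR_one (d : A'.tri) (u v : S ⊗[ℝ] S') :
    A'.triLie d (A'.theta (tauR A A' u v)) =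
      A'.theta (tauR A A' (actR d 1 u) v) + A'.theta (tauR A A' u (actR d 1 v)) := by
  have h := triLie_tauR_zero (A := A) (A'.theta (A'.theta d)) u v
  have h2 := congrArg A'.theta h
  rw [← triLie_theta, theta_theta_theta, map_add] at h2
  exact h2

lemma triLie_tauR_two (d : A'.tri) (u v : S ⊗[ℝ] S') :
    A'.triLie d (A'.theta (A'.theta (tauR A A' u v))) =
      A'.theta (A'.theta (tauR A A' (actR d 2 u) v)) +
        A'.theta (A'.theta (tauR A A' u (actR d 2 v))) := by
  have h := triLie_tauR_one (A := A) (A'.theta (A'.theta d)) u v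
  have h2 := congrArg A'.theta h
  rw [← triLie_theta, theta_theta_theta, map_add] at h2
  exact h2

lemma tauL_actR (d : A'.tri) (i : Fin 3) (u v : S ⊗[ℝ] S') :
    tauL A A' (actR d i u) v + tauL A A' u (actR d i v) = 0 := by
  induction u using ind₁ with
  | ha u u' hu hv =>
    simp only [map_add, LinearMap.add_apply]; linear_combination (norm := module) hu + hv
  | h x x' =>
    induction v using ind₁ with
    | ha u u' hu hv => simp only [map_add]; linear_combination (norm := module) hu + hv
    | h y y' => simp only [actR_tmul, tauL_tmul, A'.tri_skew]; module

lemma tauR_actL (d : A.tri) (i : Fin 3) (u v : S ⊗[ℝ] S') :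
    tauR A A' (actL d i u) v + tauR A A' u (actL d i v) = 0 := by
  induction u using ind₁ with
  | ha u u' hu hv =>
    simp only [map_add, LinearMap.add_apply]; linear_combination (norm := module) hu + hv
  | h x x' =>
    induction v using ind₁ with
    | ha u u' hu hv => simp only [map_add]; linear_combination (norm := module) hu + hv
    | h y y' => simp only [actL_tmul, tauR_tmul, A.tri_skew]; module

lemma tauL_cyclic (u v w : S ⊗[ℝ] S') :
    tauL A A' (tmul A A' u v) w + A.theta (tauL A A' (tmul A A' v w) u) +
      A.theta (A.theta (tauL A A' (tmul A A' w u) v)) = 0 := by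
  induction u using ind₁ with
  | ha u u' hu hv =>
    simp only [map_add, LinearMap.add_apply]; linear_combination (norm := module) hu + hv
  | h x x' =>
    induction v using ind₁ with
    | ha u u' hu hv =>
      simp only [map_add, LinearMap.add_apply]; linear_combination (norm := module) hu + hv
    | h y y' =>
      induction w using ind₁ with
      | ha u u' hu hv =>
        simp only [map_add, LinearMap.add_apply]; linear_combination (norm := module) hu + hv
      | h z z' =>
        have e1 : A'.q (A'.mul y' z') x' = A'.q (A'.mul x' y') z' := by
          rw [A'.q_symm, ← A'.q_assoc]
        have e2 : A'.q (A'.mul z' x') y' = A'.q (A'.mul x' y') z' := by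
          rw [A'.q_assoc, A'.q_symm]
        simp only [tmul_tmul, tauL_tmul, e1, e2, map_smul, ← smul_add, A.t_cyclic, smul_zero]

lemma tauR_cyclic (u v w : S ⊗[ℝ] S') :
    tauR A A' (tmul A A' u v) w + A'.theta (tauR A A' (tmul A A' v w) u) +
      A'.theta (A'.theta (tauR A A' (tmul A A' w u) v)) = 0 := by
  induction u using ind₁ with
  | ha u u' hu hv =>
    simp only [map_add, LinearMap.add_apply]; linear_combination (norm := module) hu + hv
  | h x x' =>
    induction v using ind₁ with
    | ha u u' hu hv =>
      simp only [map_add, LinearMap.add_apply]; linear_combination (norm := module) hu + hv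
    | h y y' =>
      induction w using ind₁ with
      | ha u u' hu hv =>
        simp only [map_add, LinearMap.add_apply]; linear_combination (norm := module) hu + hv
      | h z z' =>
        have e1 : A.q (A.mul y z) x = A.q (A.mul x y) z := by
          rw [A.q_symm, ← A.q_assoc]
        have e2 : A.q (A.mul z x) y = A.q (A.mul x y) z := by
          rw [A.q_assoc, A.q_symm]
        simp only [tmul_tmul, tauR_tmul, e1, e2, map_smul, ← smul_add, A'.t_cyclic, smul_zero]

/-- `(q'(x', y') t_{x,y} + q(x, y) t'_{x',y'})` acting on the `i`-th copy. -/
def tau (u v : S ⊗[ℝ] S') (i : Fin 3) (w : S ⊗[ℝ] S') : S ⊗[ℝ] S' :=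
  actL (tauL A A' u v) i w + actR (tauR A A' u v) i w

lemma tau_tmul (x y z : S) (x' y' z' : S') (i : Fin 3) :
    tau (A := A) (A' := A') (x ⊗ₜ x') (y ⊗ₜ y') i (z ⊗ₜ z') =
      A'.q x' y' • ((A.t x y).1 i z ⊗ₜ z') + A.q x y • (z ⊗ₜ (A'.t x' y').1 i z') := by
  unfold tau
  rw [tauL_tmul, tauR_tmul, actL_smul, actR_smul, actL_tmul, actR_tmul]

lemma tau_add_left (u u' v w : S ⊗[ℝ] S') (i : Fin 3) :
    tau (A := A) (A' := A') (u + u') v i w =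
      tau (A := A) (A' := A') u v i w + tau (A := A) (A' := A') u' v i w := by
  simp only [tau, map_add, LinearMap.add_apply, actL_add, actR_add]; abel

lemma tau_add_mid (u v v' w : S ⊗[ℝ] S') (i : Fin 3) :
    tau (A := A) (A' := A') u (v + v') i w =
      tau (A := A) (A' := A') u v i w + tau (A := A) (A' := A') u v' i w := by
  simp only [tau, map_add, LinearMap.add_apply, actL_add, actR_add]; abel

lemma tau_add_right (u v w w' : S ⊗[ℝ] S') (i : Fin 3) :
    tau (A := A) (A' := A') u v i (w + w') =
      tau (A := A) (A' := A') u v i w + tau (A := A) (A' := A') u v i w' := by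
  simp only [tau, map_add]; abel

lemma tau_zero (u v w : S ⊗[ℝ] S') :
    tau (A := A) (A' := A') u v 0 w + tau (A := A) (A' := A') v w 0 u +
      tau (A := A) (A' := A') w u 0 v = 0 := by
  induction u using ind₁ with
  | ha u u' hu hv =>
    simp only [tau_add_left, tau_add_mid, tau_add_right]
    linear_combination (norm := module) hu + hv
  | h x x' =>
    induction v using ind₁ with
    | ha u u' hu hv =>
      simp only [tau_add_left, tau_add_mid, tau_add_right]
      linear_combination (norm := module) hu + hv
    | h y y' =>
      induction w using ind₁ with
      | ha u u' hu hv =>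
        simp only [tau_add_left, tau_add_mid, tau_add_right]
        linear_combination (norm := module) hu + hv
      | h z z' =>
        simp only [tau_tmul, A.t_zero_apply, A'.t_zero_apply, TensorProduct.sub_tmul,
          TensorProduct.tmul_sub, ← TensorProduct.smul_tmul', TensorProduct.tmul_smul, A.q_symm y x,
          A.q_symm z x, A.q_symm z y, A'.q_symm y' x', A'.q_symm z' x', A'.q_symm z' y']
        module

lemma tau_one (u v w : S ⊗[ℝ] S') :
    tau (A := A) (A' := A') u v 1 w =
      tmul A A' (tmul A A' u w) v - tmul A A' (tmul A A' v w) u := by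
  induction u using ind₁ with
  | ha u u' hu hv =>
    simp only [tau_add_left, tau_add_mid, tau_add_right, map_add, LinearMap.add_apply]
    linear_combination (norm := module) hu + hv
  | h x x' =>
    induction v using ind₁ with
    | ha u u' hu hv =>
      simp only [tau_add_left, tau_add_mid, tau_add_right, map_add, LinearMap.add_apply]
      linear_combination (norm := module) hu + hv
    | h y y' =>
      induction w using ind₁ with
      | ha u u' hu hv =>
        simp only [tau_add_left, tau_add_mid, tau_add_right, map_add, LinearMap.add_apply]
        linear_combination (norm := module) hu + hv
      | h z z' =>
        simp only [tau_tmul, A.t_one_apply, A'.t_one_apply, tmul_tmul]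
        rw [eq_sub_of_add_eq (A.left_lin x z y), eq_sub_of_add_eq (A'.left_lin x' z' y')]
        simp only [TensorProduct.sub_tmul, TensorProduct.tmul_sub, ← TensorProduct.smul_tmul',
          TensorProduct.tmul_smul]
        module

lemma tau_two (u v w : S ⊗[ℝ] S') :
    tau (A := A) (A' := A') u v 2 w =
      tmul A A' v (tmul A A' w u) - tmul A A' u (tmul A A' w v) := by
  induction u using ind₁ with
  | ha u u' hu hv =>
    simp only [tau_add_left, tau_add_mid, tau_add_right, map_add, LinearMap.add_apply]
    linear_combination (norm := module) hu + hv
  | h x x' =>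
    induction v using ind₁ with
    | ha u u' hu hv =>
      simp only [tau_add_left, tau_add_mid, tau_add_right, map_add, LinearMap.add_apply]
      linear_combination (norm := module) hu + hv
    | h y y' =>
      induction w using ind₁ with
      | ha u u' hu hv =>
        simp only [tau_add_left, tau_add_mid, tau_add_right, map_add, LinearMap.add_apply]
        linear_combination (norm := module) hu + hv
      | h z z' =>
        simp only [tau_tmul, A.t_two_apply, A'.t_two_apply, tmul_tmul]
        rw [eq_sub_of_add_eq (A.right_lin y z x), eq_sub_of_add_eq (A'.right_lin y' z' x'),
          A.q_symm y x, A'.q_symm y' x']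
        simp only [TensorProduct.sub_tmul, TensorProduct.tmul_sub, ← TensorProduct.smul_tmul',
          TensorProduct.tmul_smul]
        module

@[simp] lemma lie_tri (X Y : MagicAlgebra ε A A') : ⁅X, Y⁆.tri = A.triLie X.tri Y.tri +
    ((ε 1 * ε 2) • tauL A A' (X.iota 0) (Y.iota 0) +
     (ε 2 * ε 0) • A.theta (tauL A A' (X.iota 1) (Y.iota 1)) +
     (ε 0 * ε 1) • A.theta (A.theta (tauL A A' (X.iota 2) (Y.iota 2)))) := by
  change A.triLie X.tri Y.tri + ∑ i : Fin 3, _ = _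
  rw [Fin.sum_univ_three]
  rfl

@[simp] lemma lie_tri' (X Y : MagicAlgebra ε A A') : ⁅X, Y⁆.tri' = A'.triLie X.tri' Y.tri' +
    ((ε 1 * ε 2) • tauR A A' (X.iota 0) (Y.iota 0) +
     (ε 2 * ε 0) • A'.theta (tauR A A' (X.iota 1) (Y.iota 1)) +
     (ε 0 * ε 1) • A'.theta (A'.theta (tauR A A' (X.iota 2) (Y.iota 2)))) := by
  change A'.triLie X.tri' Y.tri' + ∑ i : Fin 3, _ = _
  rw [Fin.sum_univ_three]
  rfl

lemma lie_iota (X Y : MagicAlgebra ε A A') (k : Fin 3) : ⁅X, Y⁆.iota k =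
    actL X.tri k (Y.iota k) + actR X.tri' k (Y.iota k)
      - actL Y.tri k (X.iota k) - actR Y.tri' k (X.iota k)
      + ε k • (tmul A A' (X.iota (k + 1)) (Y.iota (k + 2))
        - tmul A A' (Y.iota (k + 1)) (X.iota (k + 2))) := rfl

lemma f1 : (1 + 1 : Fin 3) = 2 := rfl
lemma f2 : (1 + 2 : Fin 3) = 0 := rfl
lemma f3 : (2 + 1 : Fin 3) = 0 := rfl
lemma f4 : (2 + 2 : Fin 3) = 1 := rfl

lemma actL_theta_zero (d : A.tri) : actL (S' := S') (A.theta d) 0 = actL d 2 := rfl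
lemma actL_theta_one (d : A.tri) : actL (S' := S') (A.theta d) 1 = actL d 0 := rfl
lemma actL_theta_two (d : A.tri) : actL (S' := S') (A.theta d) 2 = actL d 1 := rfl
lemma actR_theta_zero (d : A'.tri) : actR (S := S) (A'.theta d) 0 = actR d 2 := rfl
lemma actR_theta_one (d : A'.tri) : actR (S := S) (A'.theta d) 1 = actR d 0 := rfl
lemma actR_theta_two (d : A'.tri) : actR (S := S) (A'.theta d) 2 = actR d 1 := rfl

lemma lie_tri_r (X Y : MagicAlgebra ε A A') : ⁅X, Y⁆.tri = A.triLie X.tri Y.tri -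
    ((ε 1 * ε 2) • tauL A A' (Y.iota 0) (X.iota 0) +
     (ε 2 * ε 0) • A.theta (tauL A A' (Y.iota 1) (X.iota 1)) +
     (ε 0 * ε 1) • A.theta (A.theta (tauL A A' (Y.iota 2) (X.iota 2)))) := by
  rw [lie_tri, tauL_skew (X.iota 0), tauL_skew (X.iota 1), tauL_skew (X.iota 2)]
  simp only [map_neg]
  module

lemma lie_tri'_r (X Y : MagicAlgebra ε A A') : ⁅X, Y⁆.tri' = A'.triLie X.tri' Y.tri' -
    ((ε 1 * ε 2) • tauR A A' (Y.iota 0) (X.iota 0) +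
     (ε 2 * ε 0) • A'.theta (tauR A A' (Y.iota 1) (X.iota 1)) +
     (ε 0 * ε 1) • A'.theta (A'.theta (tauR A A' (Y.iota 2) (X.iota 2)))) := by
  rw [lie_tri', tauR_skew (X.iota 0), tauR_skew (X.iota 1), tauR_skew (X.iota 2)]
  simp only [map_neg]
  module

lemma triLie_jacobi (B : SymmetricCompositionAlgebra S) (d e f : B.tri) :
    B.triLie d (B.triLie e f) + B.triLie e (B.triLie f d) + B.triLie f (B.triLie d e) = 0 := by
  apply B.tri_ext <;> intro z <;> simp <;> abel

lemma magic_ext {X Y : MagicAlgebra ε A A'} (h : X.tri = Y.tri) (h' : X.tri' = Y.tri')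
    (h0 : X.iota 0 = Y.iota 0) (h1 : X.iota 1 = Y.iota 1) (h2 : X.iota 2 = Y.iota 2) : X = Y := by
  refine MagicAlgebra.ext h h' (funext fun i => ?_)
  fin_cases i
  · exact h0
  · exact h1
  · exact h2

lemma triLie_add_left (B : SymmetricCompositionAlgebra S) (d e f : B.tri) :
    B.triLie (d + e) f = B.triLie d f + B.triLie e f := by
  apply B.tri_ext <;> intro z <;> simp <;> abel

set_option maxHeartbeats 1000000 in
lemma jacobi_tri (X Y Z : MagicAlgebra ε A A') :
    ⁅X, ⁅Y, Z⁆⁆.tri + ⁅Y, ⁅Z, X⁆⁆.tri + ⁅Z, ⁅X, Y⁆⁆.tri = 0 := by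
  rw [lie_tri_r X ⁅Y, Z⁆, lie_tri_r Y ⁅Z, X⁆, lie_tri_r Z ⁅X, Y⁆]
  simp only [lie_tri, lie_iota, triLie_add_right, triLie_smul_right, triLie_tauL_zero,
    triLie_tauL_one, triLie_tauL_two, map_add, map_sub, map_smul, LinearMap.add_apply,
    LinearMap.sub_apply, LinearMap.smul_apply, zero_add, f1, f2, f3, f4]
  obtain ⟨d, d', u⟩ := X
  obtain ⟨e, e', v⟩ := Y
  obtain ⟨f, f', w⟩ := Z
  dsimp only
  have s := fun (d : A.tri) (i : Fin 3) (u v : S ⊗[ℝ] S') =>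
    tauL_skew (A := A) (A' := A') (actL d i v) u
  have r := fun (d : A'.tri) (i : Fin 3) (u v : S ⊗[ℝ] S') => 
    (congrArg (fun z => z + tauL A A' (actR d i u) v) (tauL_skew (A := A) (A' := A') (actR d i v) u)).symm.trans
    ((add_comm _ _).trans (tauL_actR (A := A) (A' := A') d i u v))
  rw [s d 0 (v 0) (w 0), s d 1 (v 1) (w 1), s d 2 (v 2) (w 2),
    s e 0 (w 0) (u 0), s e 1 (w 1) (u 1), s e 2 (w 2) (u 2),
    s f 0 (u 0) (v 0), s f 1 (u 1) (v 1), s f 2 (u 2) (v 2)]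
  simp only [map_neg]
  have t1 := congrArg A.theta (r d' 1 (v 1) (w 1))
  have t2 := congrArg A.theta (r e' 1 (w 1) (u 1))
  have t3 := congrArg A.theta (r f' 1 (u 1) (v 1))
  have t4 := congrArg (fun z => A.theta (A.theta z)) (r d' 2 (v 2) (w 2))
  have t5 := congrArg (fun z => A.theta (A.theta z)) (r e' 2 (w 2) (u 2))
  have t6 := congrArg (fun z => A.theta (A.theta z)) (r f' 2 (u 2) (v 2))
  simp only [map_add, map_zero, map_neg] at t1 t2 t3 t4 t5 t6
  linear_combination (norm := module) triLie_jacobi A d e f 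
    - (ε 1 * ε 2) • r d' 0 (v 0) (w 0)
    - (ε 1 * ε 2) • r e' 0 (w 0) (u 0)
    - (ε 1 * ε 2) • r f' 0 (u 0) (v 0)
    - (ε 2 * ε 0) • t1 - (ε 2 * ε 0) • t2 - (ε 2 * ε 0) • t3
    - (ε 0 * ε 1) • t4 - (ε 0 * ε 1) • t5 - (ε 0 * ε 1) • t6
    - (ε 0 * ε 1 * ε 2) • tauL_cyclic (A := A) (A' := A') (u 1) (v 2) (w 0)
    - (ε 0 * ε 1 * ε 2) • tauL_cyclic (A := A) (A' := A') (v 1) (w 2) (u 0)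
    - (ε 0 * ε 1 * ε 2) • tauL_cyclic (A := A) (A' := A') (w 1) (u 2) (v 0)
    + (ε 0 * ε 1 * ε 2) • tauL_cyclic (A := A) (A' := A') (v 1) (u 2) (w 0)
    + (ε 0 * ε 1 * ε 2) • tauL_cyclic (A := A) (A' := A') (w 1) (v 2) (u 0)
    + (ε 0 * ε 1 * ε 2) • tauL_cyclic (A := A) (A' := A') (u 1) (w 2) (v 0)

set_option maxHeartbeats 1000000 in
lemma jacobi_tri' (X Y Z : MagicAlgebra ε A A') :
    ⁅X, ⁅Y, Z⁆⁆.tri' + ⁅Y, ⁅Z, X⁆⁆.tri' + ⁅Z, ⁅X, Y⁆⁆.tri' = 0 := by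
  rw [lie_tri'_r X ⁅Y, Z⁆, lie_tri'_r Y ⁅Z, X⁆, lie_tri'_r Z ⁅X, Y⁆]
  simp only [lie_tri', lie_iota, triLie_add_right, triLie_smul_right, triLie_tauR_zero,
    triLie_tauR_one, triLie_tauR_two, map_add, map_sub, map_smul, LinearMap.add_apply,
    LinearMap.sub_apply, LinearMap.smul_apply, zero_add, f1, f2, f3, f4]
  obtain ⟨d, d', u⟩ := X
  obtain ⟨e, e', v⟩ := Y
  obtain ⟨f, f', w⟩ := Z
  dsimp only
  have s := fun (d : A'.tri) (i : Fin 3) (u v : S ⊗[ℝ] S') =>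
    tauR_skew (A := A) (A' := A') (actR d i v) u
  have r := fun (d : A.tri) (i : Fin 3) (u v : S ⊗[ℝ] S') => 
    (congrArg (fun z => z + tauR A A' (actL d i u) v) (tauR_skew (A := A) (A' := A') (actL d i v) u)).symm.trans
    ((add_comm _ _).trans (tauR_actL (A := A) (A' := A') d i u v))
  rw [s d' 0 (v 0) (w 0), s d' 1 (v 1) (w 1), s d' 2 (v 2) (w 2),
    s e' 0 (w 0) (u 0), s e' 1 (w 1) (u 1), s e' 2 (w 2) (u 2),
    s f' 0 (u 0) (v 0), s f' 1 (u 1) (v 1), s f' 2 (u 2) (v 2)]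
  simp only [map_neg]
  have t1 := congrArg A'.theta (r d 1 (v 1) (w 1))
  have t2 := congrArg A'.theta (r e 1 (w 1) (u 1))
  have t3 := congrArg A'.theta (r f 1 (u 1) (v 1))
  have t4 := congrArg (fun z => A'.theta (A'.theta z)) (r d 2 (v 2) (w 2))
  have t5 := congrArg (fun z => A'.theta (A'.theta z)) (r e 2 (w 2) (u 2))
  have t6 := congrArg (fun z => A'.theta (A'.theta z)) (r f 2 (u 2) (v 2))
  simp only [map_add, map_zero, map_neg] at t1 t2 t3 t4 t5 t6
  linear_combination (norm := module) triLie_jacobi A' d' e' f' 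
    - (ε 1 * ε 2) • r d 0 (v 0) (w 0)
    - (ε 1 * ε 2) • r e 0 (w 0) (u 0)
    - (ε 1 * ε 2) • r f 0 (u 0) (v 0)
    - (ε 2 * ε 0) • t1 - (ε 2 * ε 0) • t2 - (ε 2 * ε 0) • t3
    - (ε 0 * ε 1) • t4 - (ε 0 * ε 1) • t5 - (ε 0 * ε 1) • t6
    - (ε 0 * ε 1 * ε 2) • tauR_cyclic (A := A) (A' := A') (u 1) (v 2) (w 0)
    - (ε 0 * ε 1 * ε 2) • tauR_cyclic (A := A) (A' := A') (v 1) (w 2) (u 0)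
    - (ε 0 * ε 1 * ε 2) • tauR_cyclic (A := A) (A' := A') (w 1) (u 2) (v 0)
    + (ε 0 * ε 1 * ε 2) • tauR_cyclic (A := A) (A' := A') (v 1) (u 2) (w 0)
    + (ε 0 * ε 1 * ε 2) • tauR_cyclic (A := A) (A' := A') (w 1) (v 2) (u 0)
    + (ε 0 * ε 1 * ε 2) • tauR_cyclic (A := A) (A' := A') (u 1) (w 2) (v 0)

set_option maxHeartbeats 1000000 in
lemma jacobi_iota_zero (X Y Z : MagicAlgebra ε A A') :
    ⁅X, ⁅Y, Z⁆⁆.iota 0 + ⁅Y, ⁅Z, X⁆⁆.iota 0 + ⁅Z, ⁅X, Y⁆⁆.iota 0 = 0 := by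
  obtain ⟨d, d', u⟩ := X
  obtain ⟨e, e', v⟩ := Y
  obtain ⟨f, f', w⟩ := Z
  have z0 := tau_zero (A := A) (A' := A')
  have z1 := tau_one (A := A) (A' := A')
  have z2 := tau_two (A := A) (A' := A')
  unfold tau at z0 z1 z2
  simp only [lie_tri, lie_tri', lie_iota, actL_add, actL_smul, actR_add, actR_smul, map_add, map_sub,
    map_smul, LinearMap.add_apply, LinearMap.sub_apply, LinearMap.smul_apply, zero_add, f1, f2, f3, f4,
    actL_triLie, actR_triLie, actL_mul, actR_mul, actL_theta_zero, actL_theta_one, actL_theta_two,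
    actR_theta_zero, actR_theta_one, actR_theta_two, actL_actR]
  linear_combination (norm := module) -(ε 1 * ε 2) • z0 (v 0) (w 0) (u 0)
    - (ε 2 * ε 0) • (z2 (v 1) (w 1) (u 0) + z2 (w 1) (u 1) (v 0) + z2 (u 1) (v 1) (w 0))
    - (ε 0 * ε 1) • (z1 (v 2) (w 2) (u 0) + z1 (w 2) (u 2) (v 0) + z1 (u 2) (v 2) (w 0))

set_option maxHeartbeats 1000000 in
lemma jacobi_iota_one (X Y Z : MagicAlgebra ε A A') :
    ⁅X, ⁅Y, Z⁆⁆.iota 1 + ⁅Y, ⁅Z, X⁆⁆.iota 1 + ⁅Z, ⁅X, Y⁆⁆.iota 1 = 0 := by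
  obtain ⟨d, d', u⟩ := X
  obtain ⟨e, e', v⟩ := Y
  obtain ⟨f, f', w⟩ := Z
  have z0 := tau_zero (A := A) (A' := A')
  have z1 := tau_one (A := A) (A' := A')
  have z2 := tau_two (A := A) (A' := A')
  unfold tau at z0 z1 z2
  simp only [lie_tri, lie_tri', lie_iota, actL_add, actL_smul, actR_add, actR_smul, map_add, map_sub,
    map_smul, LinearMap.add_apply, LinearMap.sub_apply, LinearMap.smul_apply, zero_add, f1, f2, f3, f4,
    actL_triLie, actR_triLie, actL_mul, actR_mul, actL_theta_zero, actL_theta_one, actL_theta_two,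
    actR_theta_zero, actR_theta_one, actR_theta_two, actL_actR]
  linear_combination (norm := module) -(ε 2 * ε 0) • z0 (v 1) (w 1) (u 1)
    - (ε 0 * ε 1) • (z2 (v 2) (w 2) (u 1) + z2 (w 2) (u 2) (v 1) + z2 (u 2) (v 2) (w 1))
    - (ε 1 * ε 2) • (z1 (v 0) (w 0) (u 1) + z1 (w 0) (u 0) (v 1) + z1 (u 0) (v 0) (w 1))

set_option maxHeartbeats 1000000 in
lemma jacobi_iota_two (X Y Z : MagicAlgebra ε A A') :
    ⁅X, ⁅Y, Z⁆⁆.iota 2 + ⁅Y, ⁅Z, X⁆⁆.iota 2 + ⁅Z, ⁅X, Y⁆⁆.iota 2 = 0 := by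
  obtain ⟨d, d', u⟩ := X
  obtain ⟨e, e', v⟩ := Y
  obtain ⟨f, f', w⟩ := Z
  have z0 := tau_zero (A := A) (A' := A')
  have z1 := tau_one (A := A) (A' := A')
  have z2 := tau_two (A := A) (A' := A')
  unfold tau at z0 z1 z2
  simp only [lie_tri, lie_tri', lie_iota, actL_add, actL_smul, actR_add, actR_smul, map_add, map_sub,
    map_smul, LinearMap.add_apply, LinearMap.sub_apply, LinearMap.smul_apply, zero_add, f1, f2, f3, f4,
    actL_triLie, actR_triLie, actL_mul, actR_mul, actL_theta_zero, actL_theta_one, actL_theta_two,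
    actR_theta_zero, actR_theta_one, actR_theta_two, actL_actR]
  linear_combination (norm := module) -(ε 0 * ε 1) • z0 (v 2) (w 2) (u 2)
    - (ε 1 * ε 2) • (z2 (v 0) (w 0) (u 2) + z2 (w 0) (u 0) (v 2) + z2 (u 0) (v 0) (w 2))
    - (ε 2 * ε 0) • (z1 (v 1) (w 1) (u 2) + z1 (w 1) (u 1) (v 2) + z1 (u 1) (v 1) (w 2))

lemma lie_self' (X : MagicAlgebra ε A A') : ⁅X, X⁆ = 0 := by
  have hA : ∀ (B : SymmetricCompositionAlgebra S) (d : B.tri), B.triLie d d = 0 := by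
    intro B d
    apply B.tri_ext <;> intro z <;> simp
  have hA' : ∀ (B : SymmetricCompositionAlgebra S') (d : B.tri), B.triLie d d = 0 := by
    intro B d
    apply B.tri_ext <;> intro z <;> simp
  refine MagicAlgebra.ext ?_ ?_ (funext fun k => ?_)
  · simp [tauL_self, hA]
  · simp [tauR_self, hA']
  · simp [lie_iota]

lemma add_lie' (X Y Z : MagicAlgebra ε A A') : ⁅X + Y, Z⁆ = ⁅X, Z⁆ + ⁅Y, Z⁆ := by
  refine MagicAlgebra.ext ?_ ?_ (funext fun k => ?_)
  · simp only [lie_tri, add_tri, add_iota, Pi.add_apply, map_add, LinearMap.add_apply,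
      triLie_add_left]
    module
  · simp only [lie_tri', add_tri', add_iota, Pi.add_apply, map_add, LinearMap.add_apply,
      triLie_add_left]
    module
  · simp only [lie_iota, add_tri, add_tri', add_iota, Pi.add_apply, map_add, LinearMap.add_apply,
      actL_add, actR_add]
    module

lemma lie_add' (X Y Z : MagicAlgebra ε A A') : ⁅X, Y + Z⁆ = ⁅X, Y⁆ + ⁅X, Z⁆ := by
  refine MagicAlgebra.ext ?_ ?_ (funext fun k => ?_)
  · simp only [lie_tri, add_tri, add_iota, Pi.add_apply, map_add, LinearMap.add_apply,
      triLie_add_right]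
    module
  · simp only [lie_tri', add_tri', add_iota, Pi.add_apply, map_add, LinearMap.add_apply,
      triLie_add_right]
    module
  · simp only [lie_iota, add_tri, add_tri', add_iota, Pi.add_apply, map_add, LinearMap.add_apply,
      actL_add, actR_add]
    module

lemma lie_skew' (X Y : MagicAlgebra ε A A') : ⁅Y, X⁆ = - ⁅X, Y⁆ := by
  have h := lie_self' (X + Y)
  rw [add_lie', lie_add', lie_add', lie_self', lie_self', zero_add, add_zero] at h
  exact (neg_eq_of_add_eq_zero_right h).symm

lemma lie_neg' (X Y : MagicAlgebra ε A A') : ⁅X, -Y⁆ = - ⁅X, Y⁆ := by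
  have h0 : ⁅X, (0 : MagicAlgebra ε A A')⁆ = 0 := by
    have := lie_add' X (0 : MagicAlgebra ε A A') 0
    simpa using this
  have h := lie_add' X Y (-Y)
  rw [add_neg_cancel, h0] at h
  exact (neg_eq_of_add_eq_zero_right h.symm).symm

lemma jacobi' (X Y Z : MagicAlgebra ε A A') :
    ⁅X, ⁅Y, Z⁆⁆ + ⁅Y, ⁅Z, X⁆⁆ + ⁅Z, ⁅X, Y⁆⁆ = 0 :=
  magic_ext (jacobi_tri X Y Z) (jacobi_tri' X Y Z) (jacobi_iota_zero X Y Z)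
    (jacobi_iota_one X Y Z) (jacobi_iota_two X Y Z)

instance : LieRing (MagicAlgebra ε A A') where
  add_lie := add_lie'
  lie_add := lie_add'
  lie_self := lie_self'
  leibniz_lie X Y Z := by
    have h := jacobi' X Y Z
    rw [lie_skew' Z ⁅X, Y⁆, lie_skew' Z X, lie_neg'] 
    rw [add_assoc] at h
    rw [eq_neg_of_add_eq_zero_left h, neg_add, add_comm]

instance : LieAlgebra ℝ (MagicAlgebra ε A A') where
  lie_smul c X Y := by
    refine MagicAlgebra.ext ?_ ?_ (funext fun k => ?_)
    · simp only [lie_tri, smul_tri, smul_iota, Pi.smul_apply, map_smul, triLie_smul_right]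
      module
    · simp only [lie_tri', smul_tri', smul_iota, Pi.smul_apply, map_smul, triLie_smul_right]
      module
    · simp only [lie_iota, smul_tri, smul_tri', smul_iota, Pi.smul_apply, map_smul,
        LinearMap.smul_apply, actL_smul, actR_smul]
      module

/-- The underlying space as a product, linearly. -/
def linearEquivProd (ε : Fin 3 → ℝ) (A : SymmetricCompositionAlgebra S)
    (A' : SymmetricCompositionAlgebra S') :
    MagicAlgebra ε A A' ≃ₗ[ℝ] A.tri × A'.tri × (Fin 3 → S ⊗[ℝ] S') where
  __ := equivProd ε A A'
  map_add' _ _ := rfl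
  map_smul' _ _ := rfl

instance [Module.Finite ℝ S] [Module.Finite ℝ S'] : Module.Finite ℝ (MagicAlgebra ε A A') :=
  Module.Finite.equiv (linearEquivProd ε A A').symm

end MagicAlgebra
end Magic

section Examples

/-- The octonion division algebra `CD(ℍ, -1) = ℍ ⊕ ℍl` as a vector space. Its product is `octMul`;
the componentwise product of the type `ℍ × ℍ` is never used. -/
abbrev Octonion : Type := ℍ[ℝ] × ℍ[ℝ]

/-- The Cayley-Dickson product `(a, b)(c, d) = (ac - d̄b, da + bc̄)`. -/
def octMul (x y : Octonion) : Octonion :=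
  (x.1 * y.1 - star y.2 * x.2, y.2 * x.1 + x.2 * star y.1)

/-- The standard involution of the octonions. -/
def octConj (x : Octonion) : Octonion := (star x.1, -x.2)

/-- The bilinear form whose value at `(x, x)` is the norm of the octonion `x`. -/
def octForm : Octonion →ₗ[ℝ] Octonion →ₗ[ℝ] ℝ :=
  LinearMap.mk₂ ℝ (fun x y => inner ℝ x.1 y.1 + inner ℝ x.2 y.2)
    (fun x x' y => by simp only [Prod.fst_add, Prod.snd_add, inner_add_left]; ring)
    (fun c x y => by simp only [Prod.smul_fst, Prod.smul_snd, real_inner_smul_left, smul_eq_mul]; ring)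
    (fun x y y' => by simp only [Prod.fst_add, Prod.snd_add, inner_add_right]; ring)
    (fun c x y => by
      simp only [Prod.smul_fst, Prod.smul_snd, real_inner_smul_right, smul_eq_mul]; ring)

/-- The norm of the octonions, `n(a, b) = n(a) + n(b)`. -/
def octNorm : QuadraticForm ℝ Octonion := LinearMap.BilinMap.toQuadraticMap octForm

lemma octForm_apply (x y : Octonion) : octForm x y =
    x.1.re * y.1.re + x.1.imI * y.1.imI + x.1.imJ * y.1.imJ + x.1.imK * y.1.imK +
    (x.2.re * y.2.re + x.2.imI * y.2.imI + x.2.imJ * y.2.imJ + x.2.imK * y.2.imK) := by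
  simp [octForm, Quaternion.inner_def]

lemma octNorm_apply (x : Octonion) : octNorm x = octForm x x := rfl

lemma octNorm_polar (x y : Octonion) : octNorm.polarBilin x y = 2 * octForm x y := by
  simp only [QuadraticMap.polarBilin_apply_apply, QuadraticMap.polar, octNorm_apply, octForm_apply,
    Prod.fst_add, Prod.snd_add, Quaternion.re_add, Quaternion.imI_add, Quaternion.imJ_add,
    Quaternion.imK_add]
  ring

/-- The product `x * y = x̄ȳ` of the para-octonion algebra, as a bilinear map. -/
def paraOctMul : Octonion →ₗ[ℝ] Octonion →ₗ[ℝ] Octonion :=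
  LinearMap.mk₂ ℝ (fun x y => octMul (octConj x) (octConj y))
    (fun x x' y => by
      refine Prod.ext ?_ ?_ <;>
        simp only [octMul, octConj, Prod.fst_add, Prod.snd_add, star_add, add_mul, mul_add,
          neg_add] <;> abel)
    (fun c x y => by
      refine Prod.ext ?_ ?_ <;>
        simp only [octMul, octConj, Prod.smul_fst, Prod.smul_snd, Quaternion.star_smul,
          smul_mul_assoc, mul_smul_comm, ← smul_neg, smul_sub, smul_add])
    (fun x y y' => by
      refine Prod.ext ?_ ?_ <;>
        simp only [octMul, octConj, Prod.fst_add, Prod.snd_add, star_add, add_mul, mul_add,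
          neg_add] <;> abel)
    (fun c x y => by
      refine Prod.ext ?_ ?_ <;>
        simp only [octMul, octConj, Prod.smul_fst, Prod.smul_snd, Quaternion.star_smul,
          smul_mul_assoc, mul_smul_comm, ← smul_neg, smul_sub, smul_add])

/-- The para-octonion algebra `p𝕆`. -/
def pO : SymmetricCompositionAlgebra Octonion where
  mul := paraOctMul
  norm := octNorm
  nondegenerate x h := by
    have h1 := h x
    rw [octNorm_polar, octForm_apply] at h1
    ext <;> simp <;> nlinarith [mul_self_nonneg x.1.re, mul_self_nonneg x.1.imI]
  norm_mul x y := by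
    simp only [octNorm_apply, octForm_apply, paraOctMul, LinearMap.mk₂_apply, octMul, octConj]
    simp
    ring
  assoc x y z := by
    simp only [octNorm_polar, octForm_apply, paraOctMul, LinearMap.mk₂_apply, octMul, octConj]
    simp
    ring

/-- The bilinear form whose value at `(z, z)` is `|z|²`. -/
def complexForm : ℂ →ₗ[ℝ] ℂ →ₗ[ℝ] ℝ :=
  LinearMap.mk₂ ℝ (fun z w => z.re * w.re + z.im * w.im)
    (fun x x' y => by simp; ring) (fun c x y => by simp; ring)
    (fun x y y' => by simp; ring) (fun c x y => by simp; ring)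

/-- The norm `|z|²` of the algebra of complex numbers. -/
def complexNorm : QuadraticForm ℝ ℂ := LinearMap.BilinMap.toQuadraticMap complexForm

lemma complexNorm_apply (z : ℂ) : complexNorm z = z.re * z.re + z.im * z.im := rfl

lemma complexNorm_polar (z w : ℂ) :
    complexNorm.polarBilin z w = 2 * (z.re * w.re + z.im * w.im) := by
  simp only [QuadraticMap.polarBilin_apply_apply, QuadraticMap.polar, complexNorm_apply,
    Complex.add_re, Complex.add_im]
  ring

/-- The product `z * w = z̄w̄` of the paracomplex algebra, as a bilinear map. -/
def paraComplexMul : ℂ →ₗ[ℝ] ℂ →ₗ[ℝ] ℂ :=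
  LinearMap.mk₂ ℝ (fun z w => conj z * conj w)
    (fun x x' y => by simp; ring) (fun c x y => by simp [mul_assoc])
    (fun x y y' => by simp; ring) (fun c x y => by simp [mul_left_comm])

/-- The paracomplex algebra `pℂ`. -/
def pC : SymmetricCompositionAlgebra ℂ where
  mul := paraComplexMul
  norm := complexNorm
  nondegenerate x h := by
    have h1 := h x
    rw [complexNorm_polar] at h1
    apply Complex.ext <;> simp <;> nlinarith
  norm_mul x y := by
    simp only [complexNorm_apply, paraComplexMul, LinearMap.mk₂_apply]
    simp
    ring
  assoc x y z := by
    simp only [complexNorm_polar, paraComplexMul, LinearMap.mk₂_apply]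
    simp
    ring

/-- The basis `1, i, j, k, l, il, jl, kl` of the octonions. -/
def octBasis : Fin 8 → Octonion :=
  ![(1, 0), (⟨0, 1, 0, 0⟩, 0), (⟨0, 0, 1, 0⟩, 0), (⟨0, 0, 0, 1⟩, 0),
    (0, 1), (0, ⟨0, 1, 0, 0⟩), (0, ⟨0, 0, 1, 0⟩), (0, ⟨0, 0, 0, 1⟩)]

/-- The basis `1, i` of the complex numbers. -/
def complexBasis : Fin 2 → ℂ := ![1, Complex.I]

end Examples

/-! ### Real semisimple Lie algebras, Cartan decompositions and Satake diagrams -/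

section Satake

open Module LieAlgebra LieAlgebra.IsKilling

/-- A subspace is abelian if all brackets of its elements vanish. -/
def IsAbelianSubspace {g : Type*} [LieRing g] [LieAlgebra ℝ g] (b : Submodule ℝ g) : Prop :=
  ∀ x ∈ b, ∀ y ∈ b, ⁅x, y⁆ = 0

/-- `a` is maximal among the abelian subspaces of `V`. -/
def IsMaximalAbelianIn {g : Type*} [LieRing g] [LieAlgebra ℝ g] (a V : Submodule ℝ g) : Prop :=
  Maximal (fun b : Submodule ℝ g => b ≤ V ∧ IsAbelianSubspace b) a

/-- The real subspace `𝐢u` of a complex vector space. -/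
def iSubspace {L : Type*} [AddCommGroup L] [Module ℝ L] [Module ℂ L] [SMulCommClass ℂ ℝ L]
    (u : Submodule ℝ L) : Submodule ℝ L :=
  u.map (DistribSMul.toLinearMap ℝ L Complex.I)

/-- `u` is a compact real form of the complexification of `g`: a real Lie subalgebra with
`g^ℂ = u ⊕ 𝐢u` whose Killing form is negative definite. -/
def IsCompactRealForm {g : Type*} [LieRing g] [LieAlgebra ℝ g]
    (u : LieSubalgebra ℝ (ℂ ⊗[ℝ] g)) : Prop :=
  IsCompl u.toSubmodule (iSubspace u.toSubmodule) ∧ ∀ x : u, x ≠ 0 → killingForm ℝ u x x < 0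

/-- `g = t ⊕ p` is a Cartan decomposition: there is a compact real form `u` of `g^ℂ` with
`t = g ∩ u` and `p = g ∩ 𝐢u`. -/
def IsCartanDecomposition {g : Type*} [LieRing g] [LieAlgebra ℝ g]
    (t : LieSubalgebra ℝ g) (p : Submodule ℝ g) : Prop :=
  IsCompl t.toSubmodule p ∧
  ∃ u : LieSubalgebra ℝ (ℂ ⊗[ℝ] g), IsCompactRealForm u ∧
    (∀ x : g, x ∈ t ↔ (1 : ℂ) ⊗ₜ[ℝ] x ∈ u) ∧
    (∀ x : g, x ∈ p ↔ (1 : ℂ) ⊗ₜ[ℝ] x ∈ iSubspace u.toSubmodule)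

/-- The signature of the Killing form. -/
def killingSignature (g : Type*) [LieRing g] [LieAlgebra ℝ g] : ℤ :=
  (sigPos (LinearMap.BilinMap.toQuadraticMap (killingForm ℝ g)) : ℤ) -
    sigNeg (LinearMap.BilinMap.toQuadraticMap (killingForm ℝ g))

/-- The complexification of a real Lie subalgebra. -/
def complexify {g : Type*} [LieRing g] [LieAlgebra ℝ g] (h : LieSubalgebra ℝ g) :
    LieSubalgebra ℂ (ℂ ⊗[ℝ] g) where
  __ := h.toSubmodule.baseChange ℂ
  lie_mem' := by
    intro x y hx hy
    simp only [AddSubsemigroup.mem_carrier, AddSubmonoid.mem_toSubsemigroup,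
      Submodule.mem_toAddSubmonoid] at hx hy ⊢
    rw [Submodule.baseChange_eq_span] at hx hy
    refine Submodule.span_induction₂
      (p := fun x y _ _ => LieAlgebra.ad ℂ (ℂ ⊗[ℝ] g) x y ∈ h.toSubmodule.baseChange ℂ)
      ?_ (fun _ _ => by rw [map_zero]; exact zero_mem _)
      (fun _ _ => by rw [map_zero]; exact zero_mem _)
      (fun _ _ _ _ _ _ h1 h2 => by rw [map_add]; exact add_mem h1 h2)
      (fun _ _ _ _ _ _ h1 h2 => by rw [map_add]; exact add_mem h1 h2)
      (fun _ _ _ _ _ h1 => by rw [map_smul]; exact Submodule.smul_mem _ _ h1)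
      (fun _ _ _ _ _ h1 => by rw [map_smul]; exact Submodule.smul_mem _ _ h1) hx hy
    rintro - - ⟨x, hx, rfl⟩ ⟨y, hy, rfl⟩
    simpa using Submodule.tmul_mem_baseChange_of_mem (1 : ℂ) (h.lie_mem hx hy)

lemma one_tmul_mem_complexify {g : Type*} [LieRing g] [LieAlgebra ℝ g] {h : LieSubalgebra ℝ g}
    {x : g} (hx : x ∈ h) : (1 : ℂ) ⊗ₜ[ℝ] x ∈ complexify h :=
  Submodule.tmul_mem_baseChange_of_mem (p := h.toSubmodule) (1 : ℂ) hx

/-- The restriction `ᾱ` of a functional `α` on `h^ℂ` to a subspace `a` of `h`. -/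
def restrictToReal {g : Type*} [LieRing g] [LieAlgebra ℝ g] {h : LieSubalgebra ℝ g}
    {a : Submodule ℝ g} (ha : a ≤ h.toSubmodule) (α : Dual ℂ (complexify h)) : a →ₗ[ℝ] ℂ where
  toFun x := α ⟨(1 : ℂ) ⊗ₜ[ℝ] (x : g), one_tmul_mem_complexify (ha x.2)⟩
  map_add' x y := by
    rw [← map_add]
    congr 1
    exact Subtype.ext (TensorProduct.tmul_add _ _ _)
  map_smul' c x := by
    have : (⟨(1 : ℂ) ⊗ₜ[ℝ] ((c • x : a) : g), one_tmul_mem_complexify (ha (c • x).2)⟩ :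
        complexify h) = (c : ℂ) • ⟨(1 : ℂ) ⊗ₜ[ℝ] (x : g), one_tmul_mem_complexify (ha x.2)⟩ := by
      refine Subtype.ext ?_
      change (1 : ℂ) ⊗ₜ[ℝ] (c • (x : g)) = (c : ℂ) • ((1 : ℂ) ⊗ₜ[ℝ] (x : g))
      rw [← TensorProduct.smul_tmul, TensorProduct.smul_tmul', smul_eq_mul, mul_one,
        Complex.real_smul, mul_one]
    rw [this, map_smul]
    simp

/-- The simultaneous eigenspace `g_λ = {x | [h, x] = λ(h) x for all h ∈ a}`. -/
def restrictedRootSpace {g : Type*} [LieRing g] [LieAlgebra ℝ g] (a : Submodule ℝ g)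
    (l : Dual ℝ a) : Submodule ℝ g where
  carrier := {x | ∀ h : a, ⁅(h : g), x⁆ = l h • x}
  add_mem' := by
    intro x y hx hy h
    rw [lie_add, hx h, hy h, smul_add]
  zero_mem' := by simp
  smul_mem' := by
    intro c x hx h
    rw [lie_smul, hx h, smul_comm]

/-- The restricted roots: nonzero functionals `λ` on `a` with `g_λ ≠ 0`. -/
def restrictedRoots {g : Type*} [LieRing g] [LieAlgebra ℝ g] (a : Submodule ℝ g) :
    Set (Dual ℝ a) :=
  {l | l ≠ 0 ∧ restrictedRootSpace a l ≠ ⊥}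

/-- The multiplicity `m_λ = dim g_λ`. -/
def multiplicity {g : Type*} [LieRing g] [LieAlgebra ℝ g] (a : Submodule ℝ g)
    (l : Dual ℝ a) : ℕ :=
  finrank ℝ (restrictedRootSpace a l)

/-- `R` is a (nonreduced) root system of type `BC_n` in `V`: in a suitable basis `f` it consists of
`±f i`, `±2 f i` and `±f i ± f j` with `i ≠ j`. -/
def IsTypeBC {V : Type*} [AddCommGroup V] [Module ℝ V] (n : ℕ) (R : Set V) : Prop :=
  ∃ f : Basis (Fin n) ℝ V, R =
    {v | ∃ i, v = f i ∨ v = -f i ∨ v = (2 : ℝ) • f i ∨ v = -((2 : ℝ) • f i)} ∪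
    {v | ∃ i j, i ≠ j ∧ (v = f i + f j ∨ v = f i - f j ∨ v = -f i - f j)}

/-- A Satake diagram with nodes `ι`: a Dynkin diagram (given by its Cartan matrix), a set of black
nodes, and arrows joining white nodes. -/
structure SatakeDiagram (ι : Type*) where
  cartan : Matrix ι ι ℤ
  black : Set ι
  arrow : ι → ι → Prop

/-- The Satake diagram EIII: the Dynkin diagram `E₆` with edges `α₁α₃`, `α₃α₄`, `α₄α₅`, `α₅α₆`,
`α₂α₄` (the node `α_{i+1}` is `i : Fin 6`), in which `α₃, α₄, α₅` are black and `α₁, α₆` are joined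
by an arrow. -/
def satakeEIII : SatakeDiagram (Fin 6) where
  cartan := CartanMatrix.E₆
  black := {2, 3, 4}
  arrow i j := (i = 0 ∧ j = 5) ∨ (i = 5 ∧ j = 0)

/-- The family `α` is a base of the root system of `(g^ℂ, h^ℂ)` adapted to `a` (the compact roots,
i.e. those vanishing on `a`, are the roots which are integral combinations with coefficients of the
same sign of the compact members of the family), and `D` is the Satake diagram defined by it:
the Dynkin diagram of the base, black nodes for the compact simple roots, and arrows between
distinct noncompact simple roots with the same restriction to `a`. -/
def IsSatakeDiagram {g : Type*} [LieRing g] [LieAlgebra ℝ g] [Module.Finite ℝ g]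
    [IsKilling ℂ (ℂ ⊗[ℝ] g)] {h : LieSubalgebra ℝ g} [(complexify h).IsCartanSubalgebra]
    {a : Submodule ℝ g} (ha : a ≤ h.toSubmodule) {ι : Type*} (α : ι → Dual ℂ (complexify h))
    (D : SatakeDiagram ι) : Prop :=
  ∃ (b : (rootSystem (complexify h)).Base) (e : ι ≃ b.support),
    (∀ i, (rootSystem (complexify h)).root (e i) = α i) ∧
    (∀ r : (complexify h).root,
      restrictToReal ha ((rootSystem (complexify h)).root r) = 0 ↔
        ((rootSystem (complexify h)).root r ∈
            AddSubmonoid.closure {f | ∃ i, f = α i ∧ restrictToReal ha f = 0} ∨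
          -(rootSystem (complexify h)).root r ∈
            AddSubmonoid.closure {f | ∃ i, f = α i ∧ restrictToReal ha f = 0})) ∧
    (∀ i j, b.cartanMatrix (e i) (e j) = D.cartan i j) ∧
    (∀ i, i ∈ D.black ↔ restrictToReal ha (α i) = 0) ∧
    (∀ i j, D.arrow i j ↔ i ≠ j ∧ restrictToReal ha (α i) ≠ 0 ∧ restrictToReal ha (α j) ≠ 0 ∧
      restrictToReal ha (α i) = restrictToReal ha (α j))

end Satake

/-! ### The algebra `g_{(1,-1,1)}(p𝕆, pℂ)` -/

section E614

open Module

/-- The real Lie algebra `g_{(1,-1,1)}(p𝕆, pℂ)`. -/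
abbrev G614 : Type := MagicAlgebra ![1, -1, 1] pO pC

/-- The element of `g` given by an element of `tri(p𝕆)`. -/
def ofTri (d : pO.tri) : G614 := ⟨d, 0, 0⟩

/-- The element of `g` given by an element of `tri(pℂ)`. -/
def ofTri' (d : pC.tri) : G614 := ⟨0, d, 0⟩

/-- The element `ι_i(u)` of `g`. -/
def ofIota (i : Fin 3) (u : Octonion ⊗[ℝ] ℂ) : G614 := ⟨0, 0, Pi.single i u⟩

/-- `t = tri(p𝕆) ⊕ tri(pℂ) ⊕ ι₁(p𝕆 ⊗ pℂ)`. -/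
def tSub : LieSubalgebra ℝ G614 where
  carrier := {X | X.iota 0 = 0 ∧ X.iota 2 = 0}
  add_mem' := by
    rintro X Y ⟨h1, h2⟩ ⟨h3, h4⟩
    simp [h1, h2, h3, h4]
  zero_mem' := by simp
  smul_mem' := by
    rintro c X ⟨h1, h2⟩
    simp [h1, h2]
  lie_mem' := by
    rintro X Y ⟨h1, h2⟩ ⟨h3, h4⟩
    simp [MagicAlgebra.lie_iota, MagicAlgebra.f1, MagicAlgebra.f2, MagicAlgebra.f3,
      MagicAlgebra.f4, h1, h2, h3, h4]

/-- `p = ι₀(p𝕆 ⊗ pℂ) ⊕ ι₂(p𝕆 ⊗ pℂ)`. -/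
def pSub : Submodule ℝ G614 where
  carrier := {X | X.tri = 0 ∧ X.tri' = 0 ∧ X.iota 1 = 0}
  add_mem' := by
    rintro X Y ⟨h1, h2, h3⟩ ⟨h4, h5, h6⟩
    simp [h1, h2, h3, h4, h5, h6]
  zero_mem' := by simp
  smul_mem' := by
    rintro c X ⟨h1, h2, h3⟩
    simp [h1, h2, h3]

/-- `t_{e_i, e_j} ∈ tri(p𝕆)`, as an element of `g`. -/
def tE (i j : Fin 8) : G614 := ofTri (pO.t (octBasis i) (octBasis j))

/-- `ι_k(e_i ⊗ e_j) ∈ g`. -/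
def iotaE (k : Fin 3) (i : Fin 8) (j : Fin 2) : G614 :=
  ofIota k (octBasis i ⊗ₜ complexBasis j)

/-- The endomorphism `σ'_{e₀, e₁}` of `pℂ`. -/
def sigmaC : Module.End ℝ ℂ :=
  (pC.q (complexBasis 0)).smulRight (complexBasis 1)
    - (pC.q (complexBasis 1)).smulRight (complexBasis 0)

lemma sigmaC_apply (z : ℂ) : sigmaC z = 2 * Complex.I * z := by
  have h : ∀ x y, pC.q x y = 2 * (x.re * y.re + x.im * y.im) := complexNorm_polar
  apply Complex.ext <;>
    simp [sigmaC, h, complexBasis]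

/-- The element `(0, σ'_{e₀,e₁}, -σ'_{e₀,e₁})` of `tri(pℂ)`. -/
def zC : pC.tri := ⟨![0, sigmaC, -sigmaC], by
  have h : ∀ x y, pC.q x y = 2 * (x.re * y.re + x.im * y.im) := complexNorm_polar
  have hm : ∀ x y, pC.mul x y = conj x * conj y := fun _ _ => rfl
  refine ⟨fun i x y => ?_, fun x y => ?_⟩
  · fin_cases i
    · simp
    · simp [sigmaC_apply, h]; ring
    · simp [sigmaC_apply, h]; ring
  · simp [sigmaC_apply, hm]; ring⟩

/-- `a = ⟨ι₀(e₀ ⊗ e₁), ι₀(e₁ ⊗ e₀)⟩`. -/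
def aSub : Submodule ℝ G614 := Submodule.span ℝ {iotaE 0 0 1, iotaE 0 1 0}

/-- The basis `h₁, …, h₆` of the Cartan subalgebra `h` (`h_{j+1}` is `hGen j`). -/
def hGen : Fin 6 → G614 :=
  ![(1 / 2 : ℝ) • tE 2 3, (1 / 2 : ℝ) • tE 4 5, (1 / 2 : ℝ) • tE 7 6, (1 / 4 : ℝ) • ofTri' zC,
    (1 / 2 : ℝ) • iotaE 0 0 1, (1 / 2 : ℝ) • iotaE 0 1 0]

/-- The Cartan subalgebra `h`. -/
def hSub : LieSubalgebra ℝ G614 := LieSubalgebra.lieSpan ℝ G614 (Set.range hGen)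

lemma aSub_le_hSub : aSub ≤ hSub.toSubmodule := by
  refine Submodule.span_le.2 ?_
  rintro x (rfl | rfl)
  · have h : hGen 4 ∈ hSub := LieSubalgebra.subset_lieSpan ⟨4, rfl⟩
    have h2 := hSub.smul_mem (2 : ℝ) h
    have e : (2 : ℝ) • hGen 4 = iotaE 0 0 1 := by
      change (2 : ℝ) • ((1 / 2 : ℝ) • iotaE 0 0 1) = _
      rw [smul_smul]; norm_num
    rw [e] at h2
    exact h2
  · have h : hGen 5 ∈ hSub := LieSubalgebra.subset_lieSpan ⟨5, rfl⟩
    have h2 := hSub.smul_mem (2 : ℝ) h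
    have e : (2 : ℝ) • hGen 5 = iotaE 0 1 0 := by
      change (2 : ℝ) • ((1 / 2 : ℝ) • iotaE 0 1 0) = _
      rw [smul_smul]; norm_num
    rw [e] at h2
    exact h2

/-- The signs `±1`. -/
def signs : Set ℂ := {1, -1}

/-- The roots in terms of the coordinate functionals `w₁, …, w₆` (`w_{j+1}` is `w j`). -/
def rootList {V : Type*} [AddCommGroup V] [Module ℂ V] (w : Fin 6 → V) : Set V :=
  {f | ∃ k ∈ ({0, 1, 2} : Set (Fin 6)), ∃ m ∈ ({4, 5} : Set (Fin 6)), ∃ s ∈ signs, ∃ t ∈ signs,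
    f = (s * Complex.I) • w k + t • w m} ∪
  {f | ∃ k ∈ ({0, 1, 2} : Set (Fin 6)), ∃ m ∈ ({0, 1, 2} : Set (Fin 6)), k < m ∧
    ∃ s ∈ signs, ∃ t ∈ signs, f = (s * Complex.I) • w k + (t * Complex.I) • w m} ∪
  {f | ∃ s ∈ signs, ∃ t ∈ signs, f = s • w 4 + t • w 5} ∪
  {f | ∃ s : Fin 6 → ℂ, (∀ j, s j ∈ signs) ∧ ∏ j, s j = -1 ∧
    f = (1 / 2 : ℂ) • (Complex.I • (s 0 • w 0 + s 1 • w 1 + s 2 • w 2 + s 3 • w 3)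
      + s 4 • w 4 + s 5 • w 5)}

/-- The simple roots `α₁, …, α₆` (`α_{j+1}` is `simpleRoots w j`). -/
def simpleRoots {V : Type*} [AddCommGroup V] [Module ℂ V] (w : Fin 6 → V) : Fin 6 → V :=
  ![(1 / 2 : ℂ) • (-(Complex.I • w 0) - Complex.I • w 1 - Complex.I • w 2 - Complex.I • w 3
      - w 4 + w 5),
    -(Complex.I • w 0) + w 4,
    Complex.I • (w 1 + w 2),
    Complex.I • (w 0 - w 1),
    Complex.I • (w 1 - w 2),
    (1 / 2 : ℂ) • (-(Complex.I • w 0) - Complex.I • w 1 + Complex.I • w 2 + Complex.I • w 3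
      - w 4 + w 5)]

/-- `α₁ + 2α₂ + 2α₃ + 3α₄ + 2α₅ + α₆`. -/
def maximalRoot {V : Type*} [AddCommGroup V] [Module ℂ V] (w : Fin 6 → V) : V :=
  simpleRoots w 0 + 2 • simpleRoots w 1 + 2 • simpleRoots w 2 + 3 • simpleRoots w 3
    + 2 • simpleRoots w 4 + simpleRoots w 5

end E614

end RealForms

end

/-! Two explicit ingredients carry the theorem: an invariant form with an involution, and six root
vectors. Neither the Killing form nor all 72 root spaces are ever computed.

Cartan decomposition. On each triality algebra a multiple of the sum of the three trace forms is
invariant, negative definite, stable under `theta`, and dual to `t_{x,y}` in the sense of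
`TrialityForm.t_left` (`pOForm`, `pCForm`). For `p𝕆` this rests on local triality: an element of
`tri(p𝕆)` is determined by its zeroth component (`pO_tri_eq_zero`), so the `t_{x,y}` span, and the
three trace forms coincide (`IsOrthonormalBasis.traceForm_eq`). Subtracting the tensor forms with
weights `ε_{i+1} ε_{i+2}` gives an invariant form `B` on the whole algebra (`form_lie`). The sign
change `flip` on `ι₀` and `ι₂` is an automorphism, and for `ε = (1, -1, 1)` the form `B(x, flip y)`
is negative definite. For the inner product `-B(x, flip y)`, `ad x` is skew if `x ∈ t` and symmetric
if `x ∈ p`; the centre being zero (`G614_center`), `tr (ad x)²` is negative, respectively positive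
(`trace_mul_self_of_adjoint`). This yields the signs of the Killing form, the signature, the compact
real form and the nondegeneracy over `ℂ`. It also makes each `ad h_j` semisimple, so that the
computation of the centralizer of `h` (`mem_hSub_of_lie_hGen`) shows that `h^ℂ` is a Cartan
subalgebra.

Roots. Eigenvectors are exhibited for the six simple roots only (`lie_rootVec`). Invariance of `B`
together with its diagonal values on `h` determines the coroots of the simple roots (`fnc_coroot`),
hence the simple reflections in integral coordinates; applying them repeatedly produces 36 positive
roots and their negatives. Since `78 = 6 + 72` and root spaces are one-dimensional, there are no
others (`range_root`). The explicit list, the base, the Cartan matrix and the Satake diagram are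
then finite checks on integer vectors. Simplicity is irreducibility of the root system: an invariant
subspace contains a simple root because the Cartan matrix is invertible, then all of them because
the diagram is connected.

Restricted roots. The complexification of a restricted root space is a joint eigenspace of `ad h₅`
and `ad h₆`, diagonalised by a basis of root vectors; for a nonzero functional the multiplicity is
the number of roots restricting to it (`multiplicity_of_ne_zero`).

The algebra `t`. It acts on `𝕆 ⊕ ℂ` by skew endomorphisms, surjectively onto `so(10)`, with a
central line as kernel (`exists_tMat_eq`, `exists_smul_tCenter`). As `so(10)` is perfect and the
Killing form of `g` is definite on `t`, the derived algebra is a complement of the centre isomorphic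
to `so(10)`. -/

open scoped TensorProduct Quaternion ComplexConjugate

set_option linter.unusedSimpArgs false

noncomputable section

namespace RealForms

/-! ### The sign of the trace of a square. -/

section TraceSign

open LinearMap (BilinForm)

variable {V : Type*} [AddCommGroup V] [Module ℝ V] [FiniteDimensional ℝ V]

/-- An endomorphism with `G(Sx, y) = c G(x, Sy)` for a positive definite form `G` has a square whose
trace has the sign of `c`. -/
lemma trace_mul_self_of_adjoint (G : BilinForm ℝ V) (hG : ∀ x y, G x y = G y x)
    (hpos : ∀ x, x ≠ 0 → 0 < G x x) (S : Module.End ℝ V) (c : ℝ)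
    (hS : ∀ x y, G (S x) y = c * G x (S y)) (h0 : S ≠ 0) :
    ∃ r : ℝ, 0 < r ∧ LinearMap.trace ℝ V (S * S) = c * r := by
  obtain ⟨v, hv⟩ := BilinForm.exists_orthogonal_basis (B := G) ⟨hG⟩
  have hvv : ∀ i, 0 < G (v i) (v i) := fun i => hpos _ (v.ne_zero i)
  have hrepr : ∀ x i, v.repr x i = G x (v i) / G (v i) (v i) := by
    intro x i
    rw [eq_div_iff (hvv i).ne']
    conv_rhs => rw [← v.sum_repr x]
    simp only [map_sum, map_smul, LinearMap.sum_apply, LinearMap.smul_apply, smul_eq_mul]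
    rw [Finset.sum_eq_single i]
    · intro j _ hj
      rw [show G (v j) (v i) = 0 from hv hj, mul_zero]
    · simp
  -- The witness is the squared Hilbert–Schmidt norm of `S` for `G`, written in an orthogonal basis.
  refine ⟨∑ i, G (S (v i)) (S (v i)) / G (v i) (v i), ?_, ?_⟩
  · have hnn : ∀ i ∈ Finset.univ, 0 ≤ G (S (v i)) (S (v i)) / G (v i) (v i) := by
      intro i _
      rcases eq_or_ne (S (v i)) 0 with h | h
      · simp [h]
      · exact (div_pos (hpos _ h) (hvv i)).le
    obtain ⟨i, hi⟩ : ∃ i, S (v i) ≠ 0 := by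
      by_contra! h
      exact h0 (v.ext fun i => by simpa using h i)
    exact Finset.sum_pos' hnn ⟨i, Finset.mem_univ _, div_pos (hpos _ hi) (hvv i)⟩
  · rw [LinearMap.trace_eq_matrix_trace ℝ v, Matrix.trace, Finset.mul_sum]
    refine Finset.sum_congr rfl fun i _ => ?_
    rw [Matrix.diag_apply, LinearMap.toMatrix_apply, hrepr, Module.End.mul_apply, hS]
    ring

end TraceSign

/-! ### Real and imaginary parts in a complexified space. -/

section Complexification

variable {V : Type*} [AddCommGroup V] [Module ℝ V]

lemma exists_re_add_im (z : ℂ ⊗[ℝ] V) :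
    ∃ x y : V, z = (1 : ℂ) ⊗ₜ[ℝ] x + Complex.I ⊗ₜ[ℝ] y := by
  induction z using TensorProduct.induction_on with
  | zero => exact ⟨0, 0, by simp⟩
  | tmul c v =>
    refine ⟨c.re • v, c.im • v, ?_⟩
    rw [← TensorProduct.smul_tmul, ← TensorProduct.smul_tmul, ← TensorProduct.add_tmul]
    congr 1
    apply Complex.ext <;> simp
  | add z w hz hw =>
    obtain ⟨x, y, rfl⟩ := hz
    obtain ⟨x', y', rfl⟩ := hw
    exact ⟨x + x', y + y', by simp only [TensorProduct.tmul_add]; abel⟩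

/-- The imaginary part and the real part, as real linear maps on the complexification. -/
def reIm : ℂ ⊗[ℝ] V →ₗ[ℝ] V × V :=
  ((TensorProduct.lid ℝ V).toLinearMap ∘ₗ Complex.reLm.rTensor V).prod
    ((TensorProduct.lid ℝ V).toLinearMap ∘ₗ Complex.imLm.rTensor V)

@[simp] lemma reIm_re_add_im (x y : V) :
    reIm ((1 : ℂ) ⊗ₜ[ℝ] x + Complex.I ⊗ₜ[ℝ] y) = (x, y) := by
  simp [reIm]

lemma re_add_im_inj {x y x' y' : V} :
    (1 : ℂ) ⊗ₜ[ℝ] x + Complex.I ⊗ₜ[ℝ] y = (1 : ℂ) ⊗ₜ[ℝ] x' + Complex.I ⊗ₜ[ℝ] y' ↔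
      x = x' ∧ y = y' := by
  refine ⟨fun h => ?_, fun h => by rw [h.1, h.2]⟩
  have := congrArg reIm h
  simpa using this

lemma re_add_im_eq_zero {x y : V} :
    (1 : ℂ) ⊗ₜ[ℝ] x + Complex.I ⊗ₜ[ℝ] y = 0 ↔ x = 0 ∧ y = 0 := by
  have := re_add_im_inj (x := x) (y := y) (x' := 0) (y' := 0)
  simpa using this

lemma one_tmul_inj {x y : V} : (1 : ℂ) ⊗ₜ[ℝ] x = (1 : ℂ) ⊗ₜ[ℝ] y ↔ x = y := by
  have := re_add_im_inj (x := x) (y := 0) (x' := y) (y' := 0)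
  simpa using this

lemma smul_re_add_im (c : ℂ) (x y : V) :
    c • ((1 : ℂ) ⊗ₜ[ℝ] x + Complex.I ⊗ₜ[ℝ] y) =
      (1 : ℂ) ⊗ₜ[ℝ] (c.re • x - c.im • y) + Complex.I ⊗ₜ[ℝ] (c.im • x + c.re • y) := by
  have h : ∀ (d : ℂ) (v : V), d ⊗ₜ[ℝ] v = (1 : ℂ) ⊗ₜ[ℝ] (d.re • v) + Complex.I ⊗ₜ[ℝ] (d.im • v) := by
    intro d v
    rw [← TensorProduct.smul_tmul, ← TensorProduct.smul_tmul, ← TensorProduct.add_tmul]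
    congr 1
    apply Complex.ext <;> simp
  rw [smul_add, TensorProduct.smul_tmul', TensorProduct.smul_tmul', h, h (c • Complex.I)]
  simp only [smul_eq_mul, mul_one, Complex.mul_re, Complex.mul_im, Complex.I_re, Complex.I_im,
    mul_zero, zero_sub, add_zero, zero_add, TensorProduct.tmul_add, TensorProduct.tmul_sub,
    neg_smul, TensorProduct.tmul_neg]
  abel

end Complexification

/-! ### Consequences of a Cartan involution with an invariant form. -/

section Cartan

section Brackets

variable {g : Type*} [LieRing g] [LieAlgebra ℝ g]

lemma complex_lie_add (x y z : ℂ ⊗[ℝ] g) : ⁅x, y + z⁆ = ⁅x, y⁆ + ⁅x, z⁆ := lie_add x y z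

lemma complex_lie_smul (c : ℂ) (x y : ℂ ⊗[ℝ] g) : ⁅x, c • y⁆ = c • ⁅x, y⁆ := lie_smul c x y

lemma complex_lie_zero (x : ℂ ⊗[ℝ] g) : ⁅x, (0 : ℂ ⊗[ℝ] g)⁆ = 0 := lie_zero x

end Brackets

variable (g : Type*) [LieRing g] [LieAlgebra ℝ g]

/-- A Cartan involution, together with an invariant form whose twist by it is negative definite. -/
structure CartanInvolution where
  form : LinearMap.BilinForm ℝ g
  theta : g →ₗ[ℝ] g
  form_symm : ∀ x y, form x y = form y x
  form_lie : ∀ x y z, form ⁅x, y⁆ z = form x ⁅y, z⁆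
  theta_lie : ∀ x y, theta ⁅x, y⁆ = ⁅theta x, theta y⁆
  theta_theta : ∀ x, theta (theta x) = x
  form_theta : ∀ x y, form (theta x) (theta y) = form x y
  neg : ∀ x, x ≠ 0 → form x (theta x) < 0

variable {g}

namespace CartanInvolution

variable (T : CartanInvolution g)

/-- The positive definite form `-B(x, θ y)`. -/
def inner : LinearMap.BilinForm ℝ g := -(T.form.compl₂ T.theta)

lemma inner_apply (x y : g) : T.inner x y = -T.form x (T.theta y) := rfl

lemma inner_symm (x y : g) : T.inner x y = T.inner y x := by
  rw [inner_apply, inner_apply, ← T.form_theta, T.theta_theta, T.form_symm]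

lemma inner_pos (x : g) (hx : x ≠ 0) : 0 < T.inner x x := by
  rw [inner_apply]
  linarith [T.neg x hx]

/-- Invariance of the form moves `x` across with a sign, and `θ` contributes `-c`. So elements of
`t` (`c = -1`) act by skew, and elements of `p` (`c = 1`) by symmetric endomorphisms. -/
lemma inner_lie {x : g} {c : ℝ} (hcc : c * c = 1) (hx : T.theta x = -c • x) (y z : g) :
    T.inner ⁅x, y⁆ z = c * T.inner y ⁅x, z⁆ := by
  rw [inner_apply, inner_apply, ← lie_skew, map_neg, LinearMap.neg_apply, T.form_lie, T.theta_lie,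
    hx, smul_lie, map_smul, smul_eq_mul]
  linear_combination (-T.form y ⁅x, T.theta z⁆) * hcc

/-- Elements of `t` and `p` act semisimply. -/
lemma lie_eq_zero_of_lie_lie_eq_zero {x : g} {c : ℝ} (hcc : c * c = 1) (hx : T.theta x = -c • x) {y : g}
    (h : ⁅x, ⁅x, y⁆⁆ = 0) : ⁅x, y⁆ = 0 := by
  by_contra hne
  have h1 := T.inner_pos _ hne
  rw [T.inner_lie hcc hx, h, map_zero, mul_zero] at h1
  exact lt_irrefl _ h1

/-- The value is the trace of `(ad x)²`, and `ad x` is nonzero because the centre is trivial;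
`trace_mul_self_of_adjoint` then gives the sign. -/
lemma killingForm_self [FiniteDimensional ℝ g] (hc : ∀ x : g, (∀ y : g, ⁅x, y⁆ = 0) → x = 0)
    {x : g} {c : ℝ} (hcc : c * c = 1) (hx : T.theta x = -c • x) (h0 : x ≠ 0) :
    ∃ r : ℝ, 0 < r ∧ killingForm ℝ g x x = c * r := by
  have h := trace_mul_self_of_adjoint T.inner T.inner_symm T.inner_pos (LieAlgebra.ad ℝ g x) c
    (fun y z => T.inner_lie hcc hx y z) (fun h => h0 (hc x fun y => by
      rw [← LieAlgebra.ad_apply ℝ g x y, h, LinearMap.zero_apply]))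
  exact h

/-- With `x = a + b` split into eigenvectors of `θ`, symmetry cancels the mixed terms and leaves
`κ(a, a) - κ(b, b)`, where both summands have the right sign and at least one is nonzero. -/
lemma killingForm_theta_neg [FiniteDimensional ℝ g]
    (hc : ∀ x : g, (∀ y : g, ⁅x, y⁆ = 0) → x = 0) {x : g} (h0 : x ≠ 0) :
    killingForm ℝ g x (T.theta x) < 0 := by
  set a : g := (1 / 2 : ℝ) • (x + T.theta x) with ha
  set b : g := (1 / 2 : ℝ) • (x - T.theta x) with hb
  have hx : x = a + b := by rw [ha, hb]; module
  have hθ : T.theta x = a - b := by rw [ha, hb]; module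
  have hta : T.theta a = -(-1 : ℝ) • a := by
    rw [ha, map_smul, map_add, T.theta_theta]; module
  have htb : T.theta b = -(1 : ℝ) • b := by
    rw [hb, map_smul, map_sub, T.theta_theta]; module
  have e : killingForm ℝ g x (T.theta x) = killingForm ℝ g a a - killingForm ℝ g b b := by
    rw [hθ, hx]
    simp only [map_add, map_sub, LinearMap.add_apply]
    rw [LieModule.traceForm_comm ℝ g g b a]
    ring
  have h1 : killingForm ℝ g a a ≤ 0 := by
    rcases eq_or_ne a 0 with h | h
    · simp [h]
    · obtain ⟨r, hr, h⟩ := T.killingForm_self hc (by norm_num) hta h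
      linarith
  have h2 : 0 ≤ killingForm ℝ g b b := by
    rcases eq_or_ne b 0 with h | h
    · simp [h]
    · obtain ⟨r, hr, h⟩ := T.killingForm_self hc (by norm_num) htb h
      linarith
  rw [e]
  rcases eq_or_ne a 0 with h | h
  · have hb0 : b ≠ 0 := by rintro h'; exact h0 (by rw [hx, h, h', add_zero])
    obtain ⟨r, hr, h⟩ := T.killingForm_self hc (by norm_num) htb hb0
    linarith
  · obtain ⟨r, hr, h⟩ := T.killingForm_self hc (by norm_num) hta h
    linarith

/-- If `x + iy` is in the radical, then pairing with real elements puts `x` and `y` separately in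
the radical of the real Killing form; pairing with `θ x` and `θ y` excludes nonzero ones. -/
lemma isKilling_complexification (T : CartanInvolution g) [FiniteDimensional ℝ g]
    (hc : ∀ x : g, (∀ y : g, ⁅x, y⁆ = 0) → x = 0) : LieAlgebra.IsKilling ℂ (ℂ ⊗[ℝ] g) := by
  refine ⟨(LieSubmodule.eq_bot_iff _).2 fun z hz => ?_⟩
  rw [LieIdeal.mem_killingCompl] at hz
  obtain ⟨x, y, rfl⟩ := exists_re_add_im z
  have key : ∀ a, killingForm ℝ g a x = 0 ∧ killingForm ℝ g a y = 0 := by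
    intro a
    have h := hz ((1 : ℂ) ⊗ₜ a) (LieSubmodule.mem_top _)
    rw [killingForm, LieModule.traceForm_baseChange, map_add, LinearMap.BilinForm.baseChange_tmul,
      LinearMap.BilinForm.baseChange_tmul] at h
    have h1 := congrArg Complex.re h
    have h2 := congrArg Complex.im h
    simp at h1 h2
    exact ⟨h1, h2⟩
  rw [re_add_im_eq_zero]
  constructor
  · by_contra h
    have := T.killingForm_theta_neg hc h
    rw [LieModule.traceForm_comm] at this
    exact absurd (key (T.theta x)).1 this.ne
  · by_contra h
    have := T.killingForm_theta_neg hc h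
    rw [LieModule.traceForm_comm] at this
    exact absurd (key (T.theta y)).2 this.ne

/-- The antilinear extension of the Cartan involution. -/
def conjTheta : ℂ ⊗[ℝ] g →ₗ[ℝ] ℂ ⊗[ℝ] g :=
  TensorProduct.map Complex.conjAe.toLinearMap T.theta

@[simp] lemma conjTheta_re_add_im (x y : g) :
    T.conjTheta ((1 : ℂ) ⊗ₜ[ℝ] x + Complex.I ⊗ₜ[ℝ] y) =
      (1 : ℂ) ⊗ₜ[ℝ] T.theta x + Complex.I ⊗ₜ[ℝ] (-T.theta y) := by
  simp [conjTheta, TensorProduct.tmul_neg, TensorProduct.neg_tmul]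

lemma conjTheta_one (x : g) : T.conjTheta ((1 : ℂ) ⊗ₜ[ℝ] x) = (1 : ℂ) ⊗ₜ[ℝ] T.theta x := by
  simpa using T.conjTheta_re_add_im x 0

lemma conjTheta_conjTheta (z : ℂ ⊗[ℝ] g) : T.conjTheta (T.conjTheta z) = z := by
  obtain ⟨x, y, rfl⟩ := exists_re_add_im z
  simp [T.theta_theta]

lemma conjTheta_smul_I (z : ℂ ⊗[ℝ] g) :
    T.conjTheta (Complex.I • z) = -(Complex.I • T.conjTheta z) := by
  obtain ⟨x, y, rfl⟩ := exists_re_add_im z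
  rw [smul_re_add_im, conjTheta_re_add_im, conjTheta_re_add_im, smul_re_add_im]
  simp [TensorProduct.tmul_neg, add_comm]

lemma conjTheta_lie (z w : ℂ ⊗[ℝ] g) :
    T.conjTheta ⁅z, w⁆ = ⁅T.conjTheta z, T.conjTheta w⁆ := by
  induction z using TensorProduct.induction_on with
  | zero => simp
  | add z z' h h' => simp only [add_lie, map_add, h, h']
  | tmul c x =>
    induction w using TensorProduct.induction_on with
    | zero => simp [complex_lie_zero]
    | add z z' h h' => simp only [complex_lie_add, map_add, h, h']
    | tmul d y => simp [conjTheta, T.theta_lie]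

/-- The compact real form attached to a Cartan involution. -/
def compactForm : LieSubalgebra ℝ (ℂ ⊗[ℝ] g) where
  carrier := {z | T.conjTheta z = z}
  add_mem' := by
    intro z w (hz : _ = _) (hw : _ = _)
    change _ = _
    rw [map_add, hz, hw]
  zero_mem' := map_zero _
  smul_mem' := by
    intro c z (hz : _ = _)
    change _ = _
    rw [map_smul, hz]
  lie_mem' := by
    intro z w (hz : _ = _) (hw : _ = _)
    change _ = _
    rw [conjTheta_lie, hz, hw]

lemma mem_compactForm {z : ℂ ⊗[ℝ] g} : z ∈ T.compactForm ↔ T.conjTheta z = z := Iff.rfl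

lemma mem_iSubspace_compactForm {z : ℂ ⊗[ℝ] g} :
    z ∈ iSubspace T.compactForm.toSubmodule ↔ T.conjTheta z = -z := by
  constructor
  · rintro ⟨w, hw, rfl⟩
    change T.conjTheta (Complex.I • w) = -(Complex.I • w)
    rw [conjTheta_smul_I, T.mem_compactForm.1 hw]
  · intro h
    refine ⟨-(Complex.I • z), ?_, ?_⟩
    · change T.conjTheta _ = _
      rw [map_neg, conjTheta_smul_I, h]
      simp
    · change Complex.I • -(Complex.I • z) = z
      rw [smul_neg, smul_smul, Complex.I_mul_I, neg_one_smul, neg_neg]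

/-- The positive definite form `-Re B` on the compact form. -/
def compactInner : LinearMap.BilinForm ℝ T.compactForm :=
  LinearMap.mk₂ ℝ (fun z w => -(T.form.baseChange ℂ (z : ℂ ⊗[ℝ] g) w).re)
    (fun x y z => by simp; ring)
    (fun c x y => by
      rw [show ((c • x : T.compactForm) : ℂ ⊗[ℝ] g) = (c : ℂ) • (x : ℂ ⊗[ℝ] g) from
        (Complex.coe_smul c _).symm, map_smul]
      simp)
    (fun x y z => by simp; ring)
    (fun c x y => by
      rw [show ((c • y : T.compactForm) : ℂ ⊗[ℝ] g) = (c : ℂ) • (y : ℂ ⊗[ℝ] g) from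
        (Complex.coe_smul c _).symm, map_smul]
      simp)

lemma baseChange_form_lie (x y z : ℂ ⊗[ℝ] g) :
    T.form.baseChange ℂ ⁅x, y⁆ z = T.form.baseChange ℂ x ⁅y, z⁆ := by
  induction x using TensorProduct.induction_on with
  | zero => simp
  | add x x' h h' => simp only [add_lie, map_add, LinearMap.add_apply, h, h']
  | tmul a x =>
    induction y using TensorProduct.induction_on with
    | zero => simp [complex_lie_zero]
    | add x x' h h' =>
      simp only [add_lie, complex_lie_add, map_add, LinearMap.add_apply, h, h']
    | tmul b y =>
      induction z using TensorProduct.induction_on with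
      | zero => simp [complex_lie_zero]
      | add x x' h h' => simp only [complex_lie_add, map_add, h, h']
      | tmul c z =>
        simp only [LieAlgebra.ExtendScalars.bracket_tmul, LinearMap.BilinForm.baseChange_tmul,
          T.form_lie, mul_assoc]

lemma baseChange_form_symm (x y : ℂ ⊗[ℝ] g) :
    T.form.baseChange ℂ x y = T.form.baseChange ℂ y x := by
  induction x using TensorProduct.induction_on with
  | zero => simp
  | add x x' h h' => simp only [map_add, LinearMap.add_apply, h, h']
  | tmul a x =>
    induction y using TensorProduct.induction_on with
    | zero => simp
    | add x x' h h' => simp only [map_add, LinearMap.add_apply, h, h']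
    | tmul b y =>
      simp only [LinearMap.BilinForm.baseChange_tmul, T.form_symm x y, mul_comm a b]

lemma compactInner_apply (z w : T.compactForm) :
    T.compactInner z w = -(T.form.baseChange ℂ (z : ℂ ⊗[ℝ] g) w).re := rfl

/-- A fixed vector `x + iy` of the antilinear involution has `θ x = x` and `θ y = -y`, so `-Re B`
equals `-B(x, θ x) - B(y, θ y)`. -/
lemma compactInner_pos (z : T.compactForm) (hz : z ≠ 0) : 0 < T.compactInner z z := by
  obtain ⟨z, hmem⟩ := z
  obtain ⟨x, y, rfl⟩ := exists_re_add_im z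
  have h := T.mem_compactForm.1 hmem
  rw [conjTheta_re_add_im, re_add_im_inj] at h
  obtain ⟨hx, hy⟩ := h
  have e : T.compactInner ⟨_, hmem⟩ ⟨_, hmem⟩ = -T.form x (T.theta x) - T.form y (T.theta y) := by
    rw [compactInner_apply]
    have hy' : T.theta y = -y := by rw [← hy, neg_neg, hy]
    simp only [map_add, LinearMap.add_apply, LinearMap.BilinForm.baseChange_tmul, hx, hy', map_neg]
    simp
    ring
  rw [e]
  have hne : x ≠ 0 ∨ y ≠ 0 := by
    by_contra! h
    apply hz
    apply Subtype.ext
    simp [h.1, h.2]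
  have hle : ∀ v, T.form v (T.theta v) ≤ 0 := by
    intro v
    rcases eq_or_ne v 0 with h | h
    · simp [h]
    · exact (T.neg v h).le
  rcases hne with h | h
  · linarith [T.neg x h, hle y]
  · linarith [T.neg y h, hle x]

lemma isCompl_of_involution {V : Type*} [AddCommGroup V] [Module ℝ V] (τ : V →ₗ[ℝ] V)
    (hτ : ∀ x, τ (τ x) = x) {P N : Submodule ℝ V} (hP : ∀ x, x ∈ P ↔ τ x = x)
    (hN : ∀ x, x ∈ N ↔ τ x = -x) : IsCompl P N := by
  refine IsCompl.of_eq ?_ ?_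
  · refine (Submodule.eq_bot_iff _).2 fun x hx => ?_
    have h1 := (hP x).1 hx.1
    have h2 := (hN x).1 hx.2
    rw [h1] at h2
    have h3 : (2 : ℝ) • x = 0 := by
      rw [two_smul]; nth_rewrite 2 [h2]; exact add_neg_cancel x
    simpa using h3
  · refine (Submodule.eq_top_iff').2 fun x => ?_
    have e : x = (1 / 2 : ℝ) • (x + τ x) + (1 / 2 : ℝ) • (x - τ x) := by module
    rw [e]
    refine Submodule.add_mem_sup ?_ ?_
    · rw [hP, map_smul, map_add, hτ, add_comm]
    · rw [hN, map_smul, map_sub, hτ]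
      module

/-- The compact form is the fixed space of the antilinear extension of `θ`. Its adjoint action is
skew for `-Re B`, so the trace lemma with `c = -1` makes its own Killing form negative definite;
faithfulness comes from the trivial centre of `g`, since `u` spans `g^ℂ`. -/
lemma isCartanDecomposition [FiniteDimensional ℝ g]
    (hc : ∀ x : g, (∀ y : g, ⁅x, y⁆ = 0) → x = 0) (t : LieSubalgebra ℝ g) (p : Submodule ℝ g)
    (ht : ∀ x, x ∈ t ↔ T.theta x = x) (hp : ∀ x, x ∈ p ↔ T.theta x = -x) :
    IsCartanDecomposition t p := by
  refine ⟨isCompl_of_involution T.theta T.theta_theta ht hp, T.compactForm, ⟨?_, ?_⟩, ?_, ?_⟩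
  · exact isCompl_of_involution T.conjTheta T.conjTheta_conjTheta (fun _ => Iff.rfl)
      (fun _ => T.mem_iSubspace_compactForm)
  · intro z hz
    obtain ⟨r, hr, h⟩ := trace_mul_self_of_adjoint T.compactInner
      (fun x y => by rw [compactInner_apply, compactInner_apply, baseChange_form_symm])
      T.compactInner_pos (LieAlgebra.ad ℝ T.compactForm z) (-1)
      (fun x y => by
        rw [compactInner_apply, compactInner_apply, LieAlgebra.ad_apply, LieAlgebra.ad_apply,
          LieSubalgebra.coe_bracket, LieSubalgebra.coe_bracket, ← lie_skew, map_neg,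
          LinearMap.neg_apply, baseChange_form_lie]
        simp)
      (fun h => by
        have h1 : ∀ w ∈ T.compactForm, ⁅(z : ℂ ⊗[ℝ] g), w⁆ = 0 := by
          intro w hw
          have := LinearMap.congr_fun h ⟨w, hw⟩
          simpa using congrArg Subtype.val this
        have h2 : ∀ a : g, ⁅(z : ℂ ⊗[ℝ] g), (1 : ℂ) ⊗ₜ[ℝ] a⁆ = 0 := by
          intro a
          -- A real vector is a complex combination of two elements of `u`: its `θ`-fixed part, and
          -- `𝐢` times its anti-fixed part.
          have e : (1 : ℂ) ⊗ₜ[ℝ] a = (1 : ℂ) ⊗ₜ[ℝ] ((1 / 2 : ℝ) • (a + T.theta a)) +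
              (-Complex.I) • (Complex.I ⊗ₜ[ℝ] ((1 / 2 : ℝ) • (a - T.theta a))) := by
            rw [TensorProduct.smul_tmul', smul_eq_mul, neg_mul, Complex.I_mul_I, neg_neg,
              ← TensorProduct.tmul_add]
            congr 1
            module
          rw [e, complex_lie_add, complex_lie_smul, h1 _ _, h1 _ _, smul_zero, add_zero]
          · rw [mem_compactForm]
            have := T.conjTheta_re_add_im 0 ((1 / 2 : ℝ) • (a - T.theta a))
            rw [TensorProduct.tmul_zero, zero_add, map_zero, TensorProduct.tmul_zero,
              zero_add] at this
            rw [this, map_smul, map_sub, T.theta_theta]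
            congr 1
            module
          · rw [mem_compactForm, conjTheta_one, map_smul, map_add, T.theta_theta, add_comm]
        obtain ⟨x, y, hxy⟩ := exists_re_add_im (z : ℂ ⊗[ℝ] g)
        have h3 : ∀ a : g, ⁅x, a⁆ = 0 ∧ ⁅y, a⁆ = 0 := by
          intro a
          have := h2 a
          rw [hxy, add_lie, LieAlgebra.ExtendScalars.bracket_tmul,
            LieAlgebra.ExtendScalars.bracket_tmul, mul_one, mul_one, re_add_im_eq_zero] at this
          exact this
        apply hz
        apply Subtype.ext
        rw [hxy, hc x fun a => (h3 a).1, hc y fun a => (h3 a).2]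
        simp)
    rw [killingForm_apply_apply]
    rw [Module.End.mul_eq_comp] at h
    linarith
  · intro x
    rw [mem_compactForm, conjTheta_one, one_tmul_inj, ht]
  · intro x
    rw [mem_iSubspace_compactForm, conjTheta_one, ← TensorProduct.tmul_neg, one_tmul_inj, hp]

end CartanInvolution

/-- Definite subspaces bound the two indices from below by `dim p` and `dim t`; semidefiniteness on
the complementary subspace bounds them from above by the same numbers. -/
lemma killingSignature_eq [FiniteDimensional ℝ g] {t p : Submodule ℝ g} (htp : IsCompl t p)
    (ht : ∀ x ∈ t, x ≠ 0 → killingForm ℝ g x x < 0)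
    (hp : ∀ x ∈ p, x ≠ 0 → 0 < killingForm ℝ g x x) :
    killingSignature g = (Module.finrank ℝ p : ℤ) - Module.finrank ℝ t := by
  set Q := LinearMap.BilinMap.toQuadraticMap (killingForm ℝ g) with hQ
  have hq : ∀ x, Q x = killingForm ℝ g x x := fun _ => rfl
  have hd := Submodule.finrank_add_eq_of_isCompl htp
  have h1 : Module.finrank ℝ p ≤ sigPos Q := by
    refine le_sigPos_of_posDef Q fun x hx => ?_
    exact hp x x.2 (by simpa using hx)
  have h2 : Module.finrank ℝ t ≤ sigNeg Q := by
    refine le_sigNeg_of_negDef Q fun x hx => ?_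
    have := ht x x.2 (by simpa using hx)
    change 0 < -(Q x)
    rw [hq]
    linarith
  have h3 := QuadraticForm.sigPos_add_finrank_le_of_nonpos (Q := Q) (V := t) (fun x hx => by
    rcases eq_or_ne x 0 with rfl | h
    · simp
    · exact (ht x hx h).le)
  have h4 := QuadraticForm.sigPos_add_finrank_le_of_nonpos (Q := -Q) (V := p) (fun x hx => by
    rcases eq_or_ne x 0 with rfl | h
    · simp
    · have := hp x hx h
      change -(Q x) ≤ 0
      rw [hq]
      linarith)
  rw [sigPos_neg] at h4
  rw [killingSignature, ← hQ]
  omega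

end Cartan

end RealForms
end

/-! ### The invariant form and the Cartan involution of the magic square algebra. -/

noncomputable section

namespace RealForms

/-- A negative definite invariant form on the triality Lie algebra, compatible with `t_{x,y}`. -/
structure TrialityForm {S : Type*} [AddCommGroup S] [Module ℝ S]
    (A : SymmetricCompositionAlgebra S) where
  form : LinearMap.BilinForm ℝ A.tri
  symm : ∀ d e, form d e = form e d
  lie : ∀ d e f, form (A.triLie d e) f = form d (A.triLie e f)
  theta : ∀ d e, form (A.theta d) (A.theta e) = form d e
  t_left : ∀ x y e, form (A.t x y) e = A.q x (e.1 0 y)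
  neg : ∀ d, d ≠ 0 → form d d < 0

namespace MagicAlgebra

variable {S S' : Type*} [AddCommGroup S] [Module ℝ S] [AddCommGroup S'] [Module ℝ S']
variable {ε : Fin 3 → ℝ} {A : SymmetricCompositionAlgebra S} {A' : SymmetricCompositionAlgebra S'}

variable (A A') in
/-- The tensor product of the polar forms. -/
def tensorForm : S ⊗[ℝ] S' →ₗ[ℝ] S ⊗[ℝ] S' →ₗ[ℝ] ℝ :=
  (TensorProduct.map₂ A.q A'.q).compr₂ (TensorProduct.lid ℝ ℝ).toLinearMap

@[simp] lemma tensorForm_tmul (x y : S) (x' y' : S') :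
    tensorForm A A' (x ⊗ₜ x') (y ⊗ₜ y') = A.q x y * A'.q x' y' := by simp [tensorForm]

lemma tensorForm_symm (u v : S ⊗[ℝ] S') : tensorForm A A' u v = tensorForm A A' v u := by
  induction u using ind₁ with
  | ha u u' hu hv => simp only [map_add, LinearMap.add_apply, hu, hv]
  | h x x' =>
    induction v using ind₁ with
    | ha u u' hu hv => simp only [map_add, LinearMap.add_apply, hu, hv]
    | h y y' => rw [tensorForm_tmul, tensorForm_tmul, A.q_symm x y, A'.q_symm x' y']

lemma tensorForm_actL (d : A.tri) (i : Fin 3) (u v : S ⊗[ℝ] S') :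
    tensorForm A A' (actL d i u) v = -tensorForm A A' u (actL d i v) := by
  induction u using ind₁ with
  | ha u u' hu hv => simp only [map_add, LinearMap.add_apply, hu, hv]; ring
  | h x x' =>
    induction v using ind₁ with
    | ha u u' hu hv => simp only [map_add, LinearMap.add_apply, hu, hv]; ring
    | h y y' => simp [A.tri_skew]

lemma tensorForm_actR (d : A'.tri) (i : Fin 3) (u v : S ⊗[ℝ] S') :
    tensorForm A A' (actR d i u) v = -tensorForm A A' u (actR d i v) := by
  induction u using ind₁ with
  | ha u u' hu hv => simp only [map_add, LinearMap.add_apply, hu, hv]; ring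
  | h x x' =>
    induction v using ind₁ with
    | ha u u' hu hv => simp only [map_add, LinearMap.add_apply, hu, hv]; ring
    | h y y' => simp [A'.tri_skew]

lemma tensorForm_mul (u v w : S ⊗[ℝ] S') :
    tensorForm A A' u (tmul A A' v w) = tensorForm A A' (tmul A A' u v) w := by
  induction u using ind₁ with
  | ha u u' hu hv => simp only [map_add, LinearMap.add_apply, hu, hv]
  | h x x' =>
    induction v using ind₁ with
    | ha u u' hu hv => simp only [map_add, LinearMap.add_apply, hu, hv]
    | h y y' =>
      induction w using ind₁ with
      | ha u u' hu hv => simp only [map_add, LinearMap.add_apply, hu, hv]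
      | h z z' => simp [A.q_assoc, A'.q_assoc]

lemma tensorForm_mul' (u v w : S ⊗[ℝ] S') :
    tensorForm A A' u (tmul A A' w v) = tensorForm A A' (tmul A A' v u) w := by
  rw [tensorForm_symm, ← tensorForm_mul, tensorForm_symm]

variable (b : TrialityForm A) (b' : TrialityForm A')

/-- The normalisation `t_left` extended to tensors: the bracket of two elements of `ι₀` is dual to
the action of the triality algebra on `ι₀`. This duality is what makes the total form invariant. -/
lemma form_tauL (u v : S ⊗[ℝ] S') (e : A.tri) :
    b.form (tauL A A' u v) e = tensorForm A A' u (actL e 0 v) := by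
  induction u using ind₁ with
  | ha u u' hu hv => simp only [map_add, LinearMap.add_apply, hu, hv]
  | h x x' =>
    induction v using ind₁ with
    | ha u u' hu hv => simp only [map_add, LinearMap.add_apply, hu, hv]
    | h y y' => simp [b.t_left, mul_comm]

lemma form_tauR (u v : S ⊗[ℝ] S') (e : A'.tri) :
    b'.form (tauR A A' u v) e = tensorForm A A' u (actR e 0 v) := by
  induction u using ind₁ with
  | ha u u' hu hv => simp only [map_add, LinearMap.add_apply, hu, hv]
  | h x x' =>
    induction v using ind₁ with
    | ha u u' hu hv => simp only [map_add, LinearMap.add_apply, hu, hv]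
    | h y y' => simp [b'.t_left, mul_comm]

/-- Writing `e = θ³ e` and using `θ`-invariance shifts the index: the zeroth component of `θ² e` is
the first component of `e`. -/
lemma form_theta_tauL (u v : S ⊗[ℝ] S') (e : A.tri) :
    b.form (A.theta (tauL A A' u v)) e = tensorForm A A' u (actL e 1 v) := by
  rw [← theta_theta_theta A e, b.theta, form_tauL]
  rfl

lemma form_theta_tauR (u v : S ⊗[ℝ] S') (e : A'.tri) :
    b'.form (A'.theta (tauR A A' u v)) e = tensorForm A A' u (actR e 1 v) := by
  rw [← theta_theta_theta A' e, b'.theta, form_tauR]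
  rfl

lemma form_theta_theta_tauL (u v : S ⊗[ℝ] S') (e : A.tri) :
    b.form (A.theta (A.theta (tauL A A' u v))) e = tensorForm A A' u (actL e 2 v) := by
  rw [← theta_theta_theta A e, b.theta, b.theta, form_tauL]
  rfl

lemma form_theta_theta_tauR (u v : S ⊗[ℝ] S') (e : A'.tri) :
    b'.form (A'.theta (A'.theta (tauR A A' u v))) e = tensorForm A A' u (actR e 2 v) := by
  rw [← theta_theta_theta A' e, b'.theta, b'.theta, form_tauR]
  rfl

variable (ε) in
/-- The invariant form of the magic square algebra. -/
def form : LinearMap.BilinForm ℝ (MagicAlgebra ε A A') :=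
  LinearMap.mk₂ ℝ (fun X Y => b.form X.tri Y.tri + b'.form X.tri' Y.tri'
      - (ε 1 * ε 2) * tensorForm A A' (X.iota 0) (Y.iota 0)
      - (ε 2 * ε 0) * tensorForm A A' (X.iota 1) (Y.iota 1)
      - (ε 0 * ε 1) * tensorForm A A' (X.iota 2) (Y.iota 2))
    (fun X X' Y => by simp; ring) (fun c X Y => by simp; ring)
    (fun X Y Y' => by simp; ring) (fun c X Y => by simp; ring)

lemma form_apply (X Y : MagicAlgebra ε A A') :
    form ε b b' X Y = b.form X.tri Y.tri + b'.form X.tri' Y.tri'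
      - (ε 1 * ε 2) * tensorForm A A' (X.iota 0) (Y.iota 0)
      - (ε 2 * ε 0) * tensorForm A A' (X.iota 1) (Y.iota 1)
      - (ε 0 * ε 1) * tensorForm A A' (X.iota 2) (Y.iota 2) := rfl

lemma form_symm (X Y : MagicAlgebra ε A A') : form ε b b' X Y = form ε b b' Y X := by
  simp only [form_apply, b.symm X.tri, b'.symm X.tri', tensorForm_symm (X.iota _)]

-- The actions are skew and the norms associative, so all terms can be brought to a common shape.
-- The weight `ε_{i+1} ε_{i+2}` of `ι_i` times the factor `ε_i` in the bracket is the same for every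
-- `i`, so the products cancel; only invariance on the two triality algebras is left.
set_option maxHeartbeats 1000000 in
lemma form_lie (X Y Z : MagicAlgebra ε A A') :
    form ε b b' ⁅X, Y⁆ Z = form ε b b' X ⁅Y, Z⁆ := by
  rw [form_apply, form_apply, b.symm X.tri, b'.symm X.tri']
  obtain ⟨d, d', u⟩ := X
  obtain ⟨e, e', v⟩ := Y
  obtain ⟨f, f', w⟩ := Z
  have hb := b.lie d e f
  have hb' := b'.lie d' e' f'
  rw [b.symm d] at hb
  rw [b'.symm d'] at hb'
  simp only [lie_tri, lie_tri', lie_iota, map_add, map_sub, map_smul, LinearMap.add_apply,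
    LinearMap.sub_apply, LinearMap.smul_apply, smul_eq_mul, form_tauL, form_tauR, form_theta_tauL,
    form_theta_tauR, form_theta_theta_tauL, form_theta_theta_tauR, zero_add, f1, f2, f3, f4,
    tensorForm_actL, tensorForm_actR]
  simp only [tensorForm_mul (u 0) (v 1) (w 2), tensorForm_mul (u 1) (v 2) (w 0),
    tensorForm_mul (u 2) (v 0) (w 1), tensorForm_mul' (u 0) (v 2) (w 1),
    tensorForm_mul' (u 1) (v 0) (w 2), tensorForm_mul' (u 2) (v 1) (w 0)]
  linear_combination hb + hb'

/-- The involution changing the sign of `ι₀` and `ι₂`. -/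
def flip : MagicAlgebra ε A A' →ₗ[ℝ] MagicAlgebra ε A A' where
  toFun X := ⟨X.tri, X.tri', ![-X.iota 0, X.iota 1, -X.iota 2]⟩
  map_add' _ _ := magic_ext rfl rfl (neg_add _ _) rfl (neg_add _ _)
  map_smul' c X := magic_ext rfl rfl (smul_neg c (X.iota 0)).symm rfl (smul_neg c (X.iota 2)).symm

@[simp] lemma flip_tri (X : MagicAlgebra ε A A') : (flip X).tri = X.tri := rfl
@[simp] lemma flip_tri' (X : MagicAlgebra ε A A') : (flip X).tri' = X.tri' := rfl
@[simp] lemma flip_iota_zero (X : MagicAlgebra ε A A') : (flip X).iota 0 = -X.iota 0 := rfl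
@[simp] lemma flip_iota_one (X : MagicAlgebra ε A A') : (flip X).iota 1 = X.iota 1 := rfl
@[simp] lemma flip_iota_two (X : MagicAlgebra ε A A') : (flip X).iota 2 = -X.iota 2 := rfl

lemma flip_flip (X : MagicAlgebra ε A A') : flip (flip X) = X :=
  magic_ext rfl rfl (neg_neg _) rfl (neg_neg _)

/-- The triality part and the three copies `ι₀, ι₁, ι₂` form a grading by `ℤ/2 × ℤ/2`, and `flip` is
one of its characters. -/
lemma flip_lie (X Y : MagicAlgebra ε A A') : flip ⁅X, Y⁆ = ⁅flip X, flip Y⁆ := by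
  refine magic_ext ?_ ?_ ?_ ?_ ?_
  · simp [lie_tri]
  · simp [lie_tri']
  · simp [lie_iota, f1, f2, f3, f4]
    module
  · simp [lie_iota, f1, f2, f3, f4]
  · simp [lie_iota, f1, f2, f3, f4]
    module

lemma form_flip (X Y : MagicAlgebra ε A A') :
    form ε b b' (flip X) (flip Y) = form ε b b' X Y := by
  simp [form_apply]

/-- The Cartan involution of `g_{(1,-1,1)}`. -/
def cartanInvolution (hpos : ∀ u, u ≠ 0 → 0 < tensorForm A A' u u) :
    CartanInvolution (MagicAlgebra ![1, -1, 1] A A') where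
  form := form _ b b'
  theta := flip
  form_symm := form_symm b b'
  form_lie := form_lie b b'
  theta_lie := flip_lie
  theta_theta := flip_flip
  form_theta := form_flip b b'
  neg X hX := by
    have hn : ∀ u, 0 ≤ tensorForm A A' u u := by
      intro u
      rcases eq_or_ne u 0 with rfl | h
      · simp
      · exact (hpos u h).le
    have hd : b.form X.tri X.tri ≤ 0 := by
      rcases eq_or_ne X.tri 0 with h | h
      · simp [h]
      · exact (b.neg _ h).le
    have hd' : b'.form X.tri' X.tri' ≤ 0 := by
      rcases eq_or_ne X.tri' 0 with h | h
      · simp [h]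
      · exact (b'.neg _ h).le
    -- The weights of `ι₀, ι₁, ι₂` are `-1, 1, -1`; the signs of `flip` compensate exactly the
    -- negative ones.
    have e : form ![1, -1, 1] b b' X (flip X) = b.form X.tri X.tri + b'.form X.tri' X.tri'
        - tensorForm A A' (X.iota 0) (X.iota 0) - tensorForm A A' (X.iota 1) (X.iota 1)
        - tensorForm A A' (X.iota 2) (X.iota 2) := by
      rw [form_apply]
      simp
    rw [e]
    have h0 := hn (X.iota 0)
    have h1 := hn (X.iota 1)
    have h2 := hn (X.iota 2)
    by_contra! hcon
    apply hX
    refine magic_ext ?_ ?_ ?_ ?_ ?_ <;> by_contra h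
    · linarith [b.neg _ h]
    · linarith [b'.neg _ h]
    · linarith [hpos _ h]
    · linarith [hpos _ h]
    · linarith [hpos _ h]

end MagicAlgebra

end RealForms
end

/-! ### Orthonormal bases and trace forms on triality algebras. -/

noncomputable section

namespace RealForms

namespace SymmetricCompositionAlgebra

variable {S ι : Type*} [AddCommGroup S] [Module ℝ S] [Fintype ι] [DecidableEq ι]
  (A : SymmetricCompositionAlgebra S)

/-- A basis which is orthogonal for the polar form and consists of elements of norm `1`. -/
def IsOrthonormalBasis (e : Module.Basis ι ℝ S) : Prop :=
  ∀ i j, A.q (e i) (e j) = if i = j then 2 else 0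

variable {A} {e : Module.Basis ι ℝ S} (he : A.IsOrthonormalBasis e)
include he

lemma IsOrthonormalBasis.q_right (i : ι) (x : S) : A.q (e i) x = 2 * e.repr x i := by
  conv_lhs => rw [← e.sum_repr x]
  simp only [map_sum, map_smul, he i, smul_eq_mul]
  simp [mul_comm]

lemma IsOrthonormalBasis.sum_q_smul (x : S) : ∑ i, A.q (e i) x • e i = (2 : ℝ) • x := by
  conv_rhs => rw [← e.sum_repr x]
  simp only [he.q_right, Finset.smul_sum, smul_smul]

lemma IsOrthonormalBasis.trace_eq (f : Module.End ℝ S) :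
    LinearMap.trace ℝ S f = ∑ i, 2⁻¹ * A.q (e i) (f (e i)) := by
  rw [LinearMap.trace_eq_matrix_trace ℝ e, Matrix.trace]
  refine Finset.sum_congr rfl fun i _ => ?_
  rw [Matrix.diag_apply, LinearMap.toMatrix_apply, he.q_right]
  ring

lemma IsOrthonormalBasis.q_self (x : S) : A.q x x = ∑ i, 2 * (e.repr x i) ^ 2 := by
  conv_lhs => enter [1]; rw [← e.sum_repr x]
  simp only [map_sum, map_smul, LinearMap.sum_apply, LinearMap.smul_apply, he.q_right, smul_eq_mul]
  exact Finset.sum_congr rfl fun i _ => by ring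

lemma IsOrthonormalBasis.q_nonneg (x : S) : 0 ≤ A.q x x := by
  rw [he.q_self]
  positivity

lemma IsOrthonormalBasis.q_pos {x : S} (hx : x ≠ 0) : 0 < A.q x x := by
  refine lt_of_le_of_ne (he.q_nonneg x) fun h => hx ?_
  rw [he.q_self, eq_comm, Finset.sum_eq_zero_iff_of_nonneg fun _ _ => by positivity] at h
  refine e.repr.injective (Finsupp.ext fun i => ?_)
  simpa using h i (Finset.mem_univ i)

lemma IsOrthonormalBasis.trace_sq_nonpos (d : A.tri) (i : Fin 3) :
    LinearMap.trace ℝ S (d.1 i * d.1 i) ≤ 0 := by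
  rw [he.trace_eq]
  refine Finset.sum_nonpos fun a _ => ?_
  have := A.tri_skew d i (e a) (d.1 i (e a))
  have h2 := he.q_nonneg (d.1 i (e a))
  rw [Module.End.mul_apply]
  linarith

lemma IsOrthonormalBasis.trace_sq_neg (d : A.tri) (i : Fin 3) (hd : d.1 i ≠ 0) :
    LinearMap.trace ℝ S (d.1 i * d.1 i) < 0 := by
  refine lt_of_le_of_ne (he.trace_sq_nonpos d i) fun h => hd ?_
  rw [he.trace_eq, Finset.sum_eq_zero_iff_of_nonpos] at h
  · refine e.ext fun a => ?_
    by_contra hx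
    have := A.tri_skew d i (e a) (d.1 i (e a))
    have h2 := he.q_pos hx
    have h3 := h a (Finset.mem_univ a)
    rw [Module.End.mul_apply] at h3
    linarith
  · intro a _
    have := A.tri_skew d i (e a) (d.1 i (e a))
    have h2 := he.q_nonneg (d.1 i (e a))
    rw [Module.End.mul_apply]
    linarith

omit he

variable (A) in
/-- The trace form of the `i`-th component. -/
def traceForm (i : Fin 3) : LinearMap.BilinForm ℝ A.tri :=
  LinearMap.mk₂ ℝ (fun d e => LinearMap.trace ℝ S (d.1 i * e.1 i))
    (fun d d' e => by simp [add_mul]) (fun c d e => by simp)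
    (fun d e e' => by simp [mul_add]) (fun c d e => by simp)

lemma traceForm_apply (i : Fin 3) (d f : A.tri) :
    A.traceForm i d f = LinearMap.trace ℝ S (d.1 i * f.1 i) := rfl

lemma traceForm_symm (i : Fin 3) (d f : A.tri) : A.traceForm i d f = A.traceForm i f d := by
  rw [traceForm_apply, traceForm_apply, LinearMap.trace_mul_comm]

lemma traceForm_lie (i : Fin 3) (d f g : A.tri) :
    A.traceForm i (A.triLie d f) g = A.traceForm i d (A.triLie f g) := by
  have h : LinearMap.trace ℝ S (f.1 i * d.1 i * g.1 i) =
      LinearMap.trace ℝ S (d.1 i * (g.1 i * f.1 i)) := by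
    rw [mul_assoc, LinearMap.trace_mul_comm, mul_assoc]
  simp only [traceForm_apply, triLie, sub_mul, mul_sub, map_sub, h]
  rw [mul_assoc]

/-- `σ_{x,y} ∘ d₀` is a difference of two maps of rank one, whose traces agree up to sign by
skewness. -/
lemma traceForm_zero_t [Module.Finite ℝ S] (x y : S) (d : A.tri) :
    A.traceForm 0 (A.t x y) d = 2 * A.q x (d.1 0 y) := by
  have h : (A.t x y).1 0 * d.1 0 =
      (A.q x ∘ₗ d.1 0).smulRight y - (A.q y ∘ₗ d.1 0).smulRight x := by
    ext z
    simp [t_zero_apply]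
  rw [traceForm_apply, h, map_sub, LinearMap.trace_smulRight, LinearMap.trace_smulRight,
    LinearMap.comp_apply, LinearMap.comp_apply, A.q_symm y, A.tri_skew]
  ring

include he

/-- The triality form given by a multiple of the sum of the three trace forms. -/
def IsOrthonormalBasis.trialityForm (c : ℝ) (hc : 0 < c)
    (h : ∀ x y (d : A.tri), c * (A.traceForm 0 (A.t x y) d + A.traceForm 1 (A.t x y) d +
      A.traceForm 2 (A.t x y) d) = A.q x (d.1 0 y)) : TrialityForm A where
  form := c • (A.traceForm 0 + A.traceForm 1 + A.traceForm 2)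
  symm d f := by
    simp only [LinearMap.smul_apply, LinearMap.add_apply, A.traceForm_symm _ d]
  lie d f g := by
    simp only [LinearMap.smul_apply, LinearMap.add_apply, A.traceForm_lie]
  theta d f := by
    simp only [LinearMap.smul_apply, LinearMap.add_apply, traceForm_apply, theta_apply_zero,
      theta_apply_one, theta_apply_two, smul_eq_mul]
    ring
  t_left x y d := by
    simpa only [LinearMap.smul_apply, LinearMap.add_apply, smul_eq_mul] using h x y d
  neg d hd := by
    have h0 := he.trace_sq_nonpos d 0
    have h1 := he.trace_sq_nonpos d 1
    have h2 := he.trace_sq_nonpos d 2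
    simp only [LinearMap.smul_apply, LinearMap.add_apply, traceForm_apply, smul_eq_mul]
    refine mul_neg_of_pos_of_neg hc ?_
    by_contra! hcon
    refine hd (A.tri_ext (fun z => ?_) (fun z => ?_) fun z => ?_)
    · by_contra hz
      linarith [he.trace_sq_neg d 0 fun h => hz (by rw [h]; rfl)]
    · by_contra hz
      linarith [he.trace_sq_neg d 1 fun h => hz (by rw [h]; rfl)]
    · by_contra hz
      linarith [he.trace_sq_neg d 2 fun h => hz (by rw [h]; rfl)]

/-- Both parts of `σ` contribute `2 d₀ z`: the first by expanding `z`, the second by skewness and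
expanding `d₀ z`, with basis vectors of `q`-square `2`. -/
lemma IsOrthonormalBasis.sum_t_zero (d : A.tri) (z : S) :
    (∑ a, A.t (e a) (d.1 0 (e a))).1 0 z = (4 : ℝ) • d.1 0 z := by
  have h1 := congrArg (d.1 0) (he.sum_q_smul z)
  have h2 := he.sum_q_smul (d.1 0 z)
  simp only [map_sum, map_smul] at h1
  simp only [Submodule.coe_sum, Finset.sum_apply, LinearMap.sum_apply, t_zero_apply, A.tri_skew,
    Finset.sum_sub_distrib, h1, neg_smul, Finset.sum_neg_distrib, h2]
  module

/-- If elements are determined by their zeroth component, the triality algebra is spanned by the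
`t_{x,y}`; identities need only be tested on these. -/
lemma IsOrthonormalBasis.tri_eq (hu : ∀ d : A.tri, d.1 0 = 0 → d = 0) (d : A.tri) :
    d = (4⁻¹ : ℝ) • ∑ a, A.t (e a) (d.1 0 (e a)) := by
  rw [← sub_eq_zero]
  refine hu _ (LinearMap.ext fun z => ?_)
  have := he.sum_t_zero d z
  simp only [Submodule.coe_sub, Pi.sub_apply, LinearMap.sub_apply, Submodule.coe_smul,
    Pi.smul_apply, LinearMap.smul_apply, this, smul_smul]
  simp

omit [Fintype ι] in
lemma IsOrthonormalBasis.triLie_t_t {a b c : ι} (hab : a ≠ b) (hca : c ≠ a) (hcb : c ≠ b) :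
    A.triLie (A.t (e a) (e c)) (A.t (e c) (e b)) = (-2 : ℝ) • A.t (e a) (e b) := by
  rw [A.triLie_t]
  simp [t_zero_apply, he a c, he c c, he a b, he c b, hab, hca.symm, hca, hcb]
  module

omit [Fintype ι] in
lemma IsOrthonormalBasis.triLie_t_t_eq_zero {a b c d : ι} (hca : c ≠ a) (hcb : c ≠ b) (hda : d ≠ a)
    (hdb : d ≠ b) : A.triLie (A.t (e a) (e b)) (A.t (e c) (e d)) = 0 := by
  rw [A.triLie_t]
  simp [t_zero_apply, he a c, he b c, he a d, he b d, hca.symm, hcb.symm, hda.symm, hdb.symm]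

/-- An invariant form on the triality algebra which vanishes on all pairs `(t_{a,b}, t_{a,b})`
vanishes on all pairs `(t_{a,b}, t_{c,d})`. -/
lemma IsOrthonormalBasis.form_t_t_eq_zero (hcard : 4 < Fintype.card ι)
    (F : LinearMap.BilinForm ℝ A.tri)
    (hF : ∀ d f g, F (A.triLie d f) g = F d (A.triLie f g))
    (h0 : ∀ a b, a ≠ b → F (A.t (e a) (e b)) (A.t (e a) (e b)) = 0) (a b c d : ι) :
    F (A.t (e a) (e b)) (A.t (e c) (e d)) = 0 := by
  have hself : ∀ a, A.t (e a) (e a) = 0 := fun a => by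
    have h := A.t_skew (e a) (e a)
    have h2 : (2 : ℝ) • A.t (e a) (e a) = 0 := by linear_combination (norm := module) h
    simpa using h2
  rcases eq_or_ne a b with rfl | hab
  · simp [hself]
  rcases eq_or_ne c d with rfl | hcd
  · simp [hself]
  have key : ∀ c d, c ≠ d → d ≠ a → d ≠ b → F (A.t (e a) (e b)) (A.t (e c) (e d)) = 0 := by
    intro c d hcd hda hdb
    -- A fifth index exists by `hcard`. Then `t_{f,d}` commutes with `t_{a,b}`, while `t_{c,d}` is a
    -- multiple of the bracket of `t_{f,d}` and `t_{c,f}`; invariance moves `t_{f,d}` over to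
    -- `t_{a,b}`.
    obtain ⟨f, hf⟩ : ∃ f, f ∉ ({a, b, c, d} : Finset ι) := by
      by_contra! h
      have h1 : (Finset.univ : Finset ι) ⊆ {a, b, c, d} := fun f _ => h f
      have h2 := (Finset.card_le_card h1).trans Finset.card_le_four
      rw [Finset.card_univ] at h2
      omega
    simp only [Finset.mem_insert, Finset.mem_singleton, not_or] at hf
    have h1 := he.triLie_t_t hcd hf.2.2.1 hf.2.2.2
    have h2 : A.triLie (A.t (e c) (e f)) (A.t (e f) (e d)) =
        -A.triLie (A.t (e f) (e d)) (A.t (e c) (e f)) := MagicAlgebra.triLie_skew A _ _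
    have h3 := hF (A.t (e a) (e b)) (A.t (e f) (e d)) (A.t (e c) (e f))
    rw [he.triLie_t_t_eq_zero hf.1 hf.2.1 hda hdb, map_zero, LinearMap.zero_apply] at h3
    have h4 : F (A.t (e a) (e b)) ((-2 : ℝ) • A.t (e c) (e d)) = 0 := by
      rw [← h1, h2, map_neg, ← h3, neg_zero]
    simpa using h4
  by_cases hd : d = a ∨ d = b
  · by_cases hc : c = a ∨ c = b
    · rcases hd with rfl | rfl <;> rcases hc with rfl | rfl
      · exact absurd rfl hcd
      · rw [A.t_skew (e d) (e c), map_neg, h0 _ _ hab, neg_zero]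
      · exact h0 _ _ hab
      · exact absurd rfl hcd
    · push Not at hc
      rw [A.t_skew (e d) (e c), map_neg, key d c hcd.symm hc.1 hc.2, neg_zero]
  · push Not at hd
    exact key c d hcd hd.1 hd.2

lemma IsOrthonormalBasis.form_eq_zero (hcard : 4 < Fintype.card ι)
    (hu : ∀ d : A.tri, d.1 0 = 0 → d = 0) (F : LinearMap.BilinForm ℝ A.tri)
    (hF : ∀ d f g, F (A.triLie d f) g = F d (A.triLie f g))
    (h0 : ∀ a b, a ≠ b → F (A.t (e a) (e b)) (A.t (e a) (e b)) = 0) (d f : A.tri) :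
    F d f = 0 := by
  have key : ∀ x y z w, F (A.t x y) (A.t z w) = 0 := by
    intro x y z w
    rw [← e.sum_repr x, ← e.sum_repr y, ← e.sum_repr z, ← e.sum_repr w]
    simp only [map_sum, map_smul, LinearMap.sum_apply, LinearMap.smul_apply,
      he.form_t_t_eq_zero hcard F hF h0, smul_zero, Finset.sum_const_zero]
  rw [he.tri_eq hu d, he.tri_eq hu f]
  simp [key]

lemma IsOrthonormalBasis.trace_one : LinearMap.trace ℝ S 1 = Fintype.card ι := by
  rw [he.trace_eq]
  simp [he _ _]

omit [Fintype ι] in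
lemma IsOrthonormalBasis.norm_eq (a : ι) : A.norm (e a) = 1 := by
  have h : A.q (e a) (e a) = 2 * A.norm (e a) := by
    rw [q_apply, ← two_smul ℝ (e a), QuadraticMap.map_smul]
    simp only [smul_eq_mul]
    ring
  rw [he a a, if_pos rfl] at h
  linarith

-- For orthogonal vectors `t_{a,b}` has first component `-r_a l_b`. The linearised identity
-- `left_lin`, applied to `(e_b * z) * e_a`, has a second summand that collapses to `z`, which makes
-- the square `-1`.
omit [Fintype ι] in
lemma IsOrthonormalBasis.t_one_sq {a b : ι} (hab : a ≠ b) :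
    (A.t (e a) (e b)).1 1 * (A.t (e a) (e b)).1 1 = (-1 : ℝ) • 1 := by
  refine LinearMap.ext fun z => ?_
  have h := A.left_lin (e b) (A.mul (A.mul (e b) z) (e a)) (e a)
  rw [he b a, if_neg hab.symm, zero_smul, A.self_mul_mul, he.norm_eq, one_smul,
    A.mul_mul_self, he.norm_eq, one_smul] at h
  simp only [Module.End.mul_apply, t_one_apply, he a b, hab, if_false, map_sub, map_smul, mul_zero,
    zero_smul, zero_sub, map_neg, neg_neg, LinearMap.neg_apply, LinearMap.smul_apply,
    Module.End.one_apply]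
  linear_combination (norm := module) h

omit [Fintype ι] in
lemma IsOrthonormalBasis.t_two_sq {a b : ι} (hab : a ≠ b) :
    (A.t (e a) (e b)).1 2 * (A.t (e a) (e b)).1 2 = (-1 : ℝ) • 1 := by
  refine LinearMap.ext fun z => ?_
  have h := A.right_lin (e a) (A.mul (e a) (A.mul z (e b))) (e b)
  rw [he a b, if_neg hab, zero_smul, A.mul_mul_self, he.norm_eq, one_smul,
    A.self_mul_mul, he.norm_eq, one_smul] at h
  simp only [Module.End.mul_apply, t_two_apply, he a b, hab, if_false, map_sub, map_smul, mul_zero,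
    zero_smul, zero_sub, map_neg, neg_neg, LinearMap.neg_apply, LinearMap.smul_apply,
    Module.End.one_apply]
  linear_combination (norm := module) h

/-- The zeroth component squares to `-4` on a plane and to `0` on its complement, the other two to
`-1` on the whole space. The traces agree precisely because the dimension is eight. -/
lemma IsOrthonormalBasis.traceForm_t_t {a b : ι} (hab : a ≠ b) (hcard : Fintype.card ι = 8)
    (i : Fin 3) : A.traceForm i (A.t (e a) (e b)) (A.t (e a) (e b)) = -8 := by
  have := Module.Finite.of_basis e
  have h1 := he.trace_one
  rw [hcard] at h1
  fin_cases i
  · change A.traceForm 0 _ _ = _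
    rw [traceForm_zero_t, t_zero_apply, he a b, he b b, if_neg hab]
    simp [he a a]
    norm_num
  · change A.traceForm 1 _ _ = _
    rw [traceForm_apply, he.t_one_sq hab, map_smul, h1]
    norm_num
  · change A.traceForm 2 _ _ = _
    rw [traceForm_apply, he.t_two_sq hab, map_smul, h1]
    norm_num

/-- The difference of two trace forms is invariant and vanishes on every pair `(t_{a,b}, t_{a,b})`,
hence identically. -/
lemma IsOrthonormalBasis.traceForm_eq (hcard : Fintype.card ι = 8)
    (hu : ∀ d : A.tri, d.1 0 = 0 → d = 0) (i j : Fin 3) (d f : A.tri) :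
    A.traceForm i d f = A.traceForm j d f := by
  rw [← sub_eq_zero]
  refine he.form_eq_zero (by omega) hu (A.traceForm i - A.traceForm j) (fun d f g => ?_)
    (fun a b hab => ?_) d f
  · simp only [LinearMap.sub_apply, A.traceForm_lie]
  · simp only [LinearMap.sub_apply, he.traceForm_t_t hab hcard, sub_self]

/-- The triality form of an eight-dimensional algebra. -/
def IsOrthonormalBasis.trialityFormOfCard (hcard : Fintype.card ι = 8)
    (hu : ∀ d : A.tri, d.1 0 = 0 → d = 0) : TrialityForm A :=
  -- The three trace forms are equal and each takes the value `2 q(x, d₀ y)`; hence the factor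
  -- `1/6`.
  he.trialityForm 6⁻¹ (by norm_num) fun x y d => by
    have := Module.Finite.of_basis e
    rw [he.traceForm_eq hcard hu 1 0, he.traceForm_eq hcard hu 2 0, A.traceForm_zero_t]
    ring

omit he

include he in
/-- Every skew endomorphism is the zeroth component of an element of the triality algebra. -/
lemma IsOrthonormalBasis.exists_tri (f : Module.End ℝ S) (hf : ∀ x y, A.q (f x) y = -A.q x (f y)) :
    ∃ d : A.tri, d.1 0 = f := by
  refine ⟨(4⁻¹ : ℝ) • ∑ a, A.t (e a) (f (e a)), LinearMap.ext fun z => ?_⟩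
  have h1 := congrArg f (he.sum_q_smul z)
  have h2 := he.sum_q_smul (f z)
  simp only [map_sum, map_smul] at h1
  simp only [Submodule.coe_sum, Submodule.coe_smul, Pi.smul_apply, LinearMap.smul_apply,
    Finset.sum_apply, LinearMap.sum_apply, t_zero_apply, hf,
    Finset.sum_sub_distrib, h1, neg_smul, Finset.sum_neg_distrib, h2]
  module

omit [DecidableEq ι] in
/-- Skewness can be checked on a basis. -/
lemma skew_of_basis (e : Module.Basis ι ℝ S) (f : Module.End ℝ S)
    (hf : ∀ i j, A.q (f (e i)) (e j) = -A.q (e i) (f (e j))) (x y : S) :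
    A.q (f x) y = -A.q x (f y) := by
  rw [← e.sum_repr x, ← e.sum_repr y]
  simp only [map_sum, map_smul, LinearMap.sum_apply, LinearMap.smul_apply, hf, smul_neg,
    Finset.sum_neg_distrib]

end SymmetricCompositionAlgebra

open SymmetricCompositionAlgebra

/-! ### The algebra `p𝕆` -/

/-- The coordinates of an octonion. -/
def octCoord (x : Octonion) : Fin 8 → ℝ :=
  ![x.1.re, x.1.imI, x.1.imJ, x.1.imK, x.2.re, x.2.imI, x.2.imJ, x.2.imK]

/-- The octonions as a coordinate space. -/
def octEquiv : Octonion ≃ₗ[ℝ] (Fin 8 → ℝ) where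
  toFun := octCoord
  invFun v := (⟨v 0, v 1, v 2, v 3⟩, ⟨v 4, v 5, v 6, v 7⟩)
  map_add' x y := by ext i; fin_cases i <;> simp [octCoord]
  map_smul' c x := by ext i; fin_cases i <;> simp [octCoord]
  left_inv x := rfl
  right_inv v := by ext i; fin_cases i <;> rfl

/-- The standard basis of the octonions. -/
def octB : Module.Basis (Fin 8) ℝ Octonion := Module.Basis.ofEquivFun octEquiv

@[simp] lemma octB_apply (i : Fin 8) : octB i = octBasis i := by
  refine octEquiv.injective ?_
  rw [octB, Module.Basis.coe_ofEquivFun, LinearEquiv.apply_symm_apply]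
  ext j
  change _ = octCoord _ j
  fin_cases i <;> fin_cases j <;> simp [octCoord, octBasis]

lemma pO_q (x y : Octonion) : pO.q x y = 2 * octForm x y := octNorm_polar x y

lemma pO_q_basis (i j : Fin 8) : pO.q (octBasis i) (octBasis j) = if i = j then 2 else 0 := by
  rw [pO_q, octForm_apply]
  fin_cases i <;> fin_cases j <;> simp [octBasis]

lemma octB_orthonormal : pO.IsOrthonormalBasis octB := fun i j => by
  rw [octB_apply, octB_apply, pO_q_basis]

lemma pO_mul (x y : Octonion) : pO.mul x y = octMul (octConj x) (octConj y) := rfl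

set_option maxHeartbeats 1000000 in
lemma pO_mul_eq (x y : Octonion) : pO.mul x y =
      (⟨x.1.re * y.1.re - x.1.imI * y.1.imI - x.1.imJ * y.1.imJ - x.1.imK * y.1.imK -
          x.2.re * y.2.re - x.2.imI * y.2.imI - x.2.imJ * y.2.imJ - x.2.imK * y.2.imK,
        x.1.imJ * y.1.imK + x.2.re * y.2.imI + x.2.imK * y.2.imJ - x.1.re * y.1.imI -
          x.1.imI * y.1.re - x.1.imK * y.1.imJ - x.2.imI * y.2.re - x.2.imJ * y.2.imK,
        x.1.imK * y.1.imI + x.2.re * y.2.imJ + x.2.imI * y.2.imK - x.1.re * y.1.imJ -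
          x.1.imI * y.1.imK - x.1.imJ * y.1.re - x.2.imJ * y.2.re - x.2.imK * y.2.imI,
        x.1.imI * y.1.imJ + x.2.re * y.2.imK + x.2.imJ * y.2.imI - x.1.re * y.1.imK -
          x.1.imJ * y.1.imI - x.1.imK * y.1.re - x.2.imI * y.2.imJ - x.2.imK * y.2.re⟩,
       ⟨x.2.imI * y.1.imI + x.2.imJ * y.1.imJ + x.2.imK * y.1.imK - x.1.re * y.2.re -
          x.1.imI * y.2.imI - x.1.imJ * y.2.imJ - x.1.imK * y.2.imK - x.2.re * y.1.re,
        x.1.imI * y.2.re + x.1.imK * y.2.imJ + x.2.imK * y.1.imJ - x.1.re * y.2.imI -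
          x.1.imJ * y.2.imK - x.2.re * y.1.imI - x.2.imI * y.1.re - x.2.imJ * y.1.imK,
        x.1.imI * y.2.imK + x.1.imJ * y.2.re + x.2.imI * y.1.imK - x.1.re * y.2.imJ -
          x.1.imK * y.2.imI - x.2.re * y.1.imJ - x.2.imJ * y.1.re - x.2.imK * y.1.imI,
        x.1.imJ * y.2.imI + x.1.imK * y.2.re + x.2.imJ * y.1.imI - x.1.re * y.2.imK -
          x.1.imI * y.2.imJ - x.2.re * y.1.imK - x.2.imI * y.1.imJ - x.2.imK * y.1.re⟩) := by
  rw [pO_mul]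
  refine Prod.ext (Quaternion.ext _ _ ?_ ?_ ?_ ?_) (Quaternion.ext _ _ ?_ ?_ ?_ ?_) <;>
    simp [octMul, octConj] <;> ring

lemma pO_mul_mk (a0 a1 a2 a3 a4 a5 a6 a7 b0 b1 b2 b3 b4 b5 b6 b7 : ℝ) :
    pO.mul (⟨a0, a1, a2, a3⟩, ⟨a4, a5, a6, a7⟩) (⟨b0, b1, b2, b3⟩, ⟨b4, b5, b6, b7⟩) =
      (⟨a0 * b0 - a1 * b1 - a2 * b2 - a3 * b3 - a4 * b4 - a5 * b5 - a6 * b6 - a7 * b7,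
        a2 * b3 + a4 * b5 + a7 * b6 - a0 * b1 - a1 * b0 - a3 * b2 - a5 * b4 - a6 * b7,
        a3 * b1 + a4 * b6 + a5 * b7 - a0 * b2 - a1 * b3 - a2 * b0 - a6 * b4 - a7 * b5,
        a1 * b2 + a4 * b7 + a6 * b5 - a0 * b3 - a2 * b1 - a3 * b0 - a5 * b6 - a7 * b4⟩,
       ⟨a5 * b1 + a6 * b2 + a7 * b3 - a0 * b4 - a1 * b5 - a2 * b6 - a3 * b7 - a4 * b0,
        a1 * b4 + a3 * b6 + a7 * b2 - a0 * b5 - a2 * b7 - a4 * b1 - a5 * b0 - a6 * b3,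
        a1 * b7 + a2 * b4 + a5 * b3 - a0 * b6 - a3 * b5 - a4 * b2 - a6 * b0 - a7 * b1,
        a2 * b5 + a3 * b4 + a6 * b1 - a0 * b7 - a1 * b6 - a4 * b3 - a5 * b2 - a7 * b0⟩) :=
  pO_mul_eq _ _

lemma octConj_eq (x : Octonion) : octConj x = (⟨x.1.re, -x.1.imI, -x.1.imJ, -x.1.imK⟩,
    ⟨-x.2.re, -x.2.imI, -x.2.imJ, -x.2.imK⟩) := by
  refine Prod.ext (Quaternion.ext _ _ ?_ ?_ ?_ ?_) (Quaternion.ext _ _ ?_ ?_ ?_ ?_) <;>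
    simp [octConj]

lemma octConj_mk (a0 a1 a2 a3 a4 a5 a6 a7 : ℝ) :
    octConj (⟨a0, a1, a2, a3⟩, ⟨a4, a5, a6, a7⟩) =
      (⟨a0, -a1, -a2, -a3⟩, ⟨-a4, -a5, -a6, -a7⟩) := octConj_eq _

lemma octCoord_injective : Function.Injective octCoord := octEquiv.injective

lemma oct_mk_inj {a0 a1 a2 a3 a4 a5 a6 a7 b0 b1 b2 b3 b4 b5 b6 b7 : ℝ}
    (h : ((⟨a0, a1, a2, a3⟩, ⟨a4, a5, a6, a7⟩) : Octonion) =
      (⟨b0, b1, b2, b3⟩, ⟨b4, b5, b6, b7⟩)) :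
    a0 = b0 ∧ a1 = b1 ∧ a2 = b2 ∧ a3 = b3 ∧ a4 = b4 ∧ a5 = b5 ∧ a6 = b6 ∧ a7 = b7 :=
  have h := congrFun (congrArg octCoord h)
  ⟨h 0, h 1, h 2, h 3, h 4, h 5, h 6, h 7⟩

lemma octBasis_eq (i : Fin 8) : octBasis i = (⟨if i = 0 then 1 else 0, if i = 1 then 1 else 0,
    if i = 2 then 1 else 0, if i = 3 then 1 else 0⟩, ⟨if i = 4 then 1 else 0,
    if i = 5 then 1 else 0, if i = 6 then 1 else 0, if i = 7 then 1 else 0⟩) := by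
  fin_cases i <;> simp [octBasis] <;> rfl

/-- An element of the triality algebra of `p𝕆` is determined by its zeroth component. -/
lemma pO_tri_eq_zero (d : pO.tri) (h : d.1 0 = 0) : d = 0 := by
  have h0 : ∀ z, d.1 0 z = 0 := fun z => by rw [h]; rfl
  -- Multiplication by `1` is conjugation in `p𝕆`, so the triality identities with one argument
  -- equal to `1` express `d₁` and `d₂` through the single octonion `u = d₁(1)`.
  set u := d.1 1 (1, 0) with hu
  have hconj : ∀ z, octConj (octConj z) = z := fun z => by simp [octConj]
  have hr : ∀ z, pO.mul z (1, 0) = octConj z := fun z => by simp [pO_mul, octMul, octConj]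
  have h2 : ∀ z, d.1 2 z = pO.mul (octConj z) u := fun z => by
    have := pO.tri_two d (octConj z) (1, 0)
    rwa [hr, hconj, h0, map_zero, LinearMap.zero_apply, zero_add, ← hu] at this
  have h1 : ∀ z, d.1 1 z = octConj (pO.mul z u) := fun z => by
    have := pO.tri_one d (octConj z) (1, 0)
    rwa [hr, hconj, h0, map_zero, add_zero, hr, h2, hconj] at this
  -- In terms of the octonion product this is `(x̄ȳ)ū = x̄(ȳū)`, so `u` lies in the nucleus and is
  -- real. Three pairs of basis elements suffice to see it, and skewness of `d₁` (`hre`) kills the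
  -- real part.
  have key : ∀ x y, pO.mul (octConj (pO.mul x y)) u = pO.mul x (octConj (pO.mul y u)) := by
    intro x y
    rw [← h2, ← h1, pO.tri_two, h0, map_zero, LinearMap.zero_apply, zero_add]
  have hre : pO.q (d.1 1 (1, 0)) (1, 0) = 0 := by
    have := pO.tri_skew d 1 (1, 0) (1, 0)
    rw [pO.q_symm (1, 0)] at this
    linarith
  rw [← hu, pO_q, octForm_apply] at hre
  have k1 := key (octBasis 1) (octBasis 2)
  have k2 := key (octBasis 1) (octBasis 4)
  have k3 := key (octBasis 2) (octBasis 4)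
  have hu0 : u = 0 := by
    obtain ⟨⟨a, b, c, d⟩, ⟨p, q, r, s⟩⟩ := u
    simp only [pO_mul_mk, octConj_mk, octBasis_eq] at hre k1 k2 k3
    have k1 := oct_mk_inj k1
    have k2 := oct_mk_inj k2
    have k3 := oct_mk_inj k3
    simp at hre k1 k2 k3
    refine Prod.ext (Quaternion.ext _ _ ?_ ?_ ?_ ?_) (Quaternion.ext _ _ ?_ ?_ ?_ ?_) <;> simp <;> linarith
  refine pO.tri_ext h0 (fun z => ?_) fun z => ?_
  · rw [h1, hu0]; simp [octConj]
  · rw [h2, hu0]; simp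

/-- The invariant form of `tri(p𝕆)`. -/
def pOForm : TrialityForm pO :=
  octB_orthonormal.trialityFormOfCard (by simp) pO_tri_eq_zero

end RealForms
end

noncomputable section

namespace RealForms

open SymmetricCompositionAlgebra MagicAlgebra

/-! ### The algebra `pℂ` -/

lemma pC_q (x y : ℂ) : pC.q x y = 2 * (x.re * y.re + x.im * y.im) := complexNorm_polar x y

lemma pC_mul (x y : ℂ) : pC.mul x y = conj x * conj y := rfl

lemma complexB_apply (i : Fin 2) : Complex.basisOneI i = complexBasis i := by
  rw [Complex.coe_basisOneI]; rfl

lemma pC_q_basis (i j : Fin 2) : pC.q (complexBasis i) (complexBasis j) = if i = j then 2 else 0 := by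
  rw [pC_q]
  fin_cases i <;> fin_cases j <;> simp [complexBasis]

lemma complexB_orthonormal : pC.IsOrthonormalBasis Complex.basisOneI := fun i j => by
  rw [complexB_apply, complexB_apply, pC_q_basis]

/-- The components of an element of `tri(pℂ)` are multiplications by imaginary numbers. -/
def rot (i : Fin 3) : pC.tri →ₗ[ℝ] ℝ where
  toFun d := (d.1 i 1).im
  map_add' d e := by simp
  map_smul' c d := by simp

/-- A skew endomorphism of a Euclidean plane is a real multiple of the rotation by a right angle. -/
lemma pC_tri_apply (d : pC.tri) (i : Fin 3) (z : ℂ) : d.1 i z = rot i d * Complex.I * z := by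
  have h1 := pC.tri_skew d i 1 1
  have h2 := pC.tri_skew d i Complex.I Complex.I
  have h3 := pC.tri_skew d i 1 Complex.I
  rw [pC_q, pC_q] at h1 h2 h3
  simp at h1 h2 h3
  have hz : z = z.re • (1 : ℂ) + z.im • Complex.I := by
    apply Complex.ext <;> simp
  have e : d.1 i z = z.re • d.1 i 1 + z.im • d.1 i Complex.I := by
    conv_lhs => rw [hz]
    rw [map_add, map_smul, map_smul]
  have hre : (d.1 i 1).re = 0 := by linarith
  have him : (d.1 i Complex.I).im = 0 := by linarith
  rw [e]
  apply Complex.ext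
  · simp [rot, hre]
    linear_combination z.im / 2 * h3
  · simp [rot, hre, him]; ring

/-- Triality at `1 * 1`; the conjugations in the product `*` turn `d₀ = d₁ + d₂` into `d₀ = -d₁ -
d₂`. -/
lemma rot_sum (d : pC.tri) : rot 0 d + rot 1 d + rot 2 d = 0 := by
  have h := pC.tri_zero d 1 1
  simp only [pC_tri_apply, pC_mul] at h
  have := congrArg Complex.im h
  simp at this
  linarith

lemma pC_tri_ext {d f : pC.tri} (h1 : rot 1 d = rot 1 f) (h2 : rot 2 d = rot 2 f) : d = f := by
  have h0 : rot 0 d = rot 0 f := by linarith [rot_sum d, rot_sum f]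
  exact pC.tri_ext (fun z => by rw [pC_tri_apply, pC_tri_apply, h0])
    (fun z => by rw [pC_tri_apply, pC_tri_apply, h1])
    fun z => by rw [pC_tri_apply, pC_tri_apply, h2]

/-- Multiplication by the imaginary number `c i`. -/
def mulI (c : ℝ) : Module.End ℝ ℂ := LinearMap.mulLeft ℝ ((c : ℂ) * Complex.I)

lemma mulI_apply (c : ℝ) (z : ℂ) : mulI c z = c * Complex.I * z := rfl

/-- The element of `tri(pℂ)` with given first and second components. -/
def rotTri (a b : ℝ) : pC.tri := ⟨![mulI (-a - b), mulI a, mulI b], by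
  refine ⟨fun i x y => ?_, fun x y => ?_⟩
  · fin_cases i <;> simp [mulI_apply, pC_q] <;> ring
  · simp [mulI_apply, pC_mul]; ring⟩

@[simp] lemma rot_rotTri_zero (a b : ℝ) : rot 0 (rotTri a b) = -a - b := by
  simp [rot, rotTri, mulI_apply]
@[simp] lemma rot_rotTri_one (a b : ℝ) : rot 1 (rotTri a b) = a := by
  simp [rot, rotTri, mulI_apply]
@[simp] lemma rot_rotTri_two (a b : ℝ) : rot 2 (rotTri a b) = b := by
  simp [rot, rotTri, mulI_apply]

@[simp] lemma rot_theta_zero (d : pC.tri) : rot 0 (pC.theta d) = rot 2 d := rfl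
@[simp] lemma rot_theta_one (d : pC.tri) : rot 1 (pC.theta d) = rot 0 d := rfl
@[simp] lemma rot_theta_two (d : pC.tri) : rot 2 (pC.theta d) = rot 1 d := rfl

@[simp] lemma rot_t_zero (x y : ℂ) : rot 0 (pC.t x y) = 2 * (x.re * y.im - x.im * y.re) := by
  change ((pC.t x y).1 0 1).im = _
  rw [t_zero_apply, pC_q, pC_q]
  simp
  ring

@[simp] lemma rot_t_one (x y : ℂ) : rot 1 (pC.t x y) = -(x.re * y.im - x.im * y.re) := by
  change ((pC.t x y).1 1 1).im = _
  rw [t_one_apply, pC_q, pC_mul, pC_mul]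
  simp
  ring

@[simp] lemma rot_t_two (x y : ℂ) : rot 2 (pC.t x y) = -(x.re * y.im - x.im * y.re) := by
  change ((pC.t x y).1 2 1).im = _
  rw [t_two_apply, pC_q, pC_mul, pC_mul]
  simp
  ring

lemma rot_zC_zero : rot 0 zC = 0 := by simp [rot, zC]
lemma rot_zC_one : rot 1 zC = 2 := by simp [rot, zC, sigmaC_apply]
lemma rot_zC_two : rot 2 zC = -2 := by simp [rot, zC, sigmaC_apply]

lemma pC_triLie (d f : pC.tri) : pC.triLie d f = 0 := by
  refine pC.tri_ext (fun z => ?_) (fun z => ?_) (fun z => ?_) <;>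
    simp [pC_tri_apply] <;> ring

/-- The coordinates of `tri(pℂ)`. -/
def rotEquiv : pC.tri ≃ₗ[ℝ] ℝ × ℝ where
  toFun d := (rot 1 d, rot 2 d)
  map_add' d f := by simp
  map_smul' c d := by simp
  invFun p := rotTri p.1 p.2
  left_inv d := pC_tri_ext (by simp) (by simp)
  right_inv p := by simp

lemma finrank_pC_tri : Module.finrank ℝ pC.tri = 2 := by
  rw [rotEquiv.finrank_eq]; simp

lemma pC_traceForm (i : Fin 3) (d f : pC.tri) :
    pC.traceForm i d f = -2 * rot i d * rot i f := by
  rw [traceForm_apply, complexB_orthonormal.trace_eq, Fin.sum_univ_two]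
  simp only [Module.End.mul_apply, pC_tri_apply, pC_q, Complex.coe_basisOneI]
  simp
  ring

/-- The invariant form of `tri(pℂ)`. -/
def pCForm : TrialityForm pC :=
  -- The rotations of `t'_{x,y}` are proportional to `(2, -1, -1)`. Since those of `d` add up to
  -- zero, the three trace forms sum to three times `q(x, d₀ y)`.
  complexB_orthonormal.trialityForm 3⁻¹ (by norm_num) fun x y d => by
    have := rot_sum d
    rw [pC_traceForm, pC_traceForm, pC_traceForm, rot_t_zero, rot_t_one, rot_t_two, pC_tri_apply,
      pC_q]
    simp
    linear_combination (2 / 3 * (x.re * y.im - x.im * y.re)) * this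

lemma pCForm_apply (d f : pC.tri) : pCForm.form d f =
    3⁻¹ * (-2 * rot 0 d * rot 0 f - 2 * rot 1 d * rot 1 f - 2 * rot 2 d * rot 2 f) := by
  change 3⁻¹ * (pC.traceForm 0 d f + pC.traceForm 1 d f + pC.traceForm 2 d f) = _
  rw [pC_traceForm, pC_traceForm, pC_traceForm]
  ring

/-! ### The tensor product `p𝕆 ⊗ pℂ` -/

/-- The element `x ⊗ 1 + y ⊗ i`. -/
def pair : Octonion × Octonion →ₗ[ℝ] Octonion ⊗[ℝ] ℂ where
  toFun p := p.1 ⊗ₜ 1 + p.2 ⊗ₜ Complex.I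
  map_add' p q := by simp [TensorProduct.add_tmul]; abel
  map_smul' c p := by simp [TensorProduct.smul_tmul']

lemma pair_apply (x y : Octonion) : pair (x, y) = x ⊗ₜ 1 + y ⊗ₜ Complex.I := rfl

lemma tmul_eq_pair (x : Octonion) (z : ℂ) : x ⊗ₜ[ℝ] z = pair (z.re • x, z.im • x) := by
  rw [pair_apply, TensorProduct.smul_tmul, TensorProduct.smul_tmul, ← TensorProduct.tmul_add]
  congr 1
  apply Complex.ext <;> simp

lemma tensorForm_pair (x y z w : Octonion) :
    tensorForm pO pC (pair (x, y)) (pair (z, w)) = 2 * pO.q x z + 2 * pO.q y w := by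
  simp [pair_apply, pC_q]
  ring

/-- Injectivity is read off from the positivity of the tensor form in these coordinates. -/
lemma pair_bijective : Function.Bijective pair := by
  constructor
  · refine (injective_iff_map_eq_zero pair).2 fun ⟨x, y⟩ h => ?_
    have h2 := tensorForm_pair x y x y
    simp only [h, map_zero, LinearMap.zero_apply] at h2
    have hx := octB_orthonormal.q_nonneg x
    have hy := octB_orthonormal.q_nonneg y
    refine Prod.ext ?_ ?_ <;> by_contra h3
    · linarith [octB_orthonormal.q_pos h3]
    · linarith [octB_orthonormal.q_pos h3]
  · intro u
    induction u using TensorProduct.induction_on with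
    | zero => exact ⟨0, map_zero _⟩
    | tmul x z => exact ⟨_, (tmul_eq_pair x z).symm⟩
    | add u v hu hv =>
      obtain ⟨p, rfl⟩ := hu
      obtain ⟨q, rfl⟩ := hv
      exact ⟨p + q, map_add _ _ _⟩

lemma pair_eq_zero {x y : Octonion} : pair (x, y) = 0 ↔ x = 0 ∧ y = 0 := by
  rw [map_eq_zero_iff pair pair_bijective.1, Prod.mk_eq_zero]

lemma pair_inj {x y z w : Octonion} : pair (x, y) = pair (z, w) ↔ x = z ∧ y = w := by
  rw [pair_bijective.1.eq_iff, Prod.mk.injEq]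

lemma exists_pair (u : Octonion ⊗[ℝ] ℂ) : ∃ x y, u = pair (x, y) := by
  obtain ⟨⟨x, y⟩, h⟩ := pair_bijective.2 u
  exact ⟨x, y, h.symm⟩

/-- The coordinates of `p𝕆 ⊗ pℂ`. -/
def pairEquiv : (Octonion × Octonion) ≃ₗ[ℝ] Octonion ⊗[ℝ] ℂ :=
  LinearEquiv.ofBijective pair pair_bijective

lemma tensorForm_pos (u : Octonion ⊗[ℝ] ℂ) (hu : u ≠ 0) : 0 < tensorForm pO pC u u := by
  obtain ⟨x, y, rfl⟩ := exists_pair u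
  rw [tensorForm_pair]
  have hx := octB_orthonormal.q_nonneg x
  have hy := octB_orthonormal.q_nonneg y
  rw [Ne, pair_eq_zero, not_and_or] at hu
  rcases hu with h | h
  · linarith [octB_orthonormal.q_pos h]
  · linarith [octB_orthonormal.q_pos h]

@[simp] lemma actL_pair (d : pO.tri) (i : Fin 3) (x y : Octonion) :
    actL d i (pair (x, y)) = pair (d.1 i x, d.1 i y) := by
  simp [pair_apply]

@[simp] lemma actR_pair (d : pC.tri) (i : Fin 3) (x y : Octonion) :
    actR d i (pair (x, y)) = pair (-(rot i d • y), rot i d • x) := by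
  rw [pair_apply, map_add, actR_tmul, actR_tmul, pC_tri_apply, pC_tri_apply, tmul_eq_pair,
    tmul_eq_pair, ← map_add]
  simp

@[simp] lemma tmul_pair (x y z w : Octonion) : tmul pO pC (pair (x, y)) (pair (z, w)) =
    pair (pO.mul x z - pO.mul y w, -(pO.mul x w + pO.mul y z)) := by
  simp only [pair_apply, map_add, LinearMap.add_apply, tmul_tmul, pC_mul]
  simp only [tmul_eq_pair, ← map_add]
  congr 1
  ext1
  · simp; abel
  · simp

@[simp] lemma tauL_pair (x y z w : Octonion) : tauL pO pC (pair (x, y)) (pair (z, w)) =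
    (2 : ℝ) • (pO.t x z + pO.t y w) := by
  simp [pair_apply, pC_q]

@[simp] lemma rot_tauR_pair (i : Fin 3) (x y z w : Octonion) :
    rot i (tauR pO pC (pair (x, y)) (pair (z, w))) =
      (pO.q x w - pO.q y z) * ![2, -1, -1] i := by
  have h : rot i (tauR pO pC (pair (x, y)) (pair (z, w))) =
    pO.q x z * rot i (pC.t 1 1) + pO.q x w * rot i (pC.t 1 Complex.I) +
    (pO.q y z * rot i (pC.t Complex.I 1) + pO.q y w * rot i (pC.t Complex.I Complex.I)) := by
    simp [pair_apply]
  rw [h]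
  fin_cases i <;> simp <;> ring

/-- The Cartan involution of `g`. -/
def cartanG : CartanInvolution G614 := cartanInvolution pOForm pCForm tensorForm_pos

/-! ### Dimensions -/

section TriCoordinates

variable {S : Type*} [AddCommGroup S] [Module ℝ S] {n : ℕ} {A : SymmetricCompositionAlgebra S}

variable (A) in
lemma free_tri : Module.Free ℝ A.tri := inferInstance

/-- The coefficients of the zeroth component of an element of the triality algebra. -/
def triCoeff (A : SymmetricCompositionAlgebra S) (e : Module.Basis (Fin n) ℝ S) :
    A.tri →ₗ[ℝ] ({p : Fin n × Fin n // p.1 < p.2} → ℝ) where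
  toFun d p := (2⁻¹ : ℝ) * A.q (e p.1.1) (d.1 0 (e p.1.2))
  map_add' d f := by ext; simp; ring
  map_smul' c d := by ext; simp; ring

variable {e : Module.Basis (Fin n) ℝ S} (he : A.IsOrthonormalBasis e)
include he

lemma exists_tri_of_skew (M : Matrix (Fin n) (Fin n) ℝ) (hM : ∀ i j, M i j = -M j i) :
    ∃ d : A.tri, ∀ i j, A.q (e i) (d.1 0 (e j)) = 2 * M i j := by
  have key : ∀ i j, A.q (e i) (Matrix.toLin e e M (e j)) = 2 * M i j := by
    intro i j
    rw [he.q_right, Matrix.toLin_self]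
    simp [Finsupp.single_apply]
  obtain ⟨d, hd⟩ := he.exists_tri (Matrix.toLin e e M)
    (skew_of_basis e _ fun i j => by
      rw [A.q_symm, key, key, hM]; ring)
  exact ⟨d, fun i j => by rw [hd, key]⟩

lemma tri_eq_zero_of_q (hu : ∀ d : A.tri, d.1 0 = 0 → d = 0) {d : A.tri}
    (h : ∀ i j, A.q (e i) (d.1 0 (e j)) = 0) : d = 0 := by
  refine hu d (e.ext fun j => ?_)
  have h2 := he.sum_q_smul (d.1 0 (e j))
  simp only [h, zero_smul, Finset.sum_const_zero] at h2
  simpa using h2.symm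

/-- Identifies the triality algebra with the skew matrices of the zeroth component, through their
entries above the diagonal. -/
lemma triCoeff_bijective (hu : ∀ d : A.tri, d.1 0 = 0 → d = 0) :
    Function.Bijective (triCoeff A e) := by
  constructor
  · refine (injective_iff_map_eq_zero (triCoeff A e)).2 fun d h =>
      tri_eq_zero_of_q he hu fun i j => ?_
    have hlt : ∀ i j, i < j → A.q (e i) (d.1 0 (e j)) = 0 := by
      intro i j hij
      simpa [triCoeff] using congrFun h ⟨(i, j), hij⟩
    rcases lt_trichotomy i j with hij | rfl | hij
    · exact hlt i j hij
    · have := A.tri_skew d 0 (e i) (e i)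
      rw [A.q_symm] at this
      linarith
    · rw [A.q_symm, A.tri_skew, hlt j i hij, neg_zero]
  · intro c
    obtain ⟨d, hd⟩ := exists_tri_of_skew he
      (fun i j => if h : i < j then c ⟨(i, j), h⟩ else if h : j < i then -c ⟨(j, i), h⟩ else 0) (by
        intro i j
        rcases lt_trichotomy i j with h | rfl | h
        · simp [h, h.not_gt]
        · simp
        · simp [h, h.not_gt])
    refine ⟨d, funext fun p => ?_⟩
    have h2 := p.2
    change (2⁻¹ : ℝ) * _ = _
    rw [hd, dif_pos h2]
    ring

lemma finrank_tri (hu : ∀ d : A.tri, d.1 0 = 0 → d = 0) :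
    Module.finrank ℝ A.tri = Fintype.card {p : Fin n × Fin n // p.1 < p.2} := by
  rw [(LinearEquiv.ofBijective (triCoeff A e) (triCoeff_bijective he hu)).finrank_eq,
    Module.finrank_pi]

end TriCoordinates

/-- The triality algebra as an additive group. -/
@[reducible] def triAddCommGroup {S : Type*} [AddCommGroup S] [Module ℝ S]
    (A : SymmetricCompositionAlgebra S) : AddCommGroup A.tri := inferInstance

instance : AddCommGroup pO.tri := triAddCommGroup pO
instance : AddCommGroup pC.tri := triAddCommGroup pC
instance : Module.Free ℝ pO.tri := free_tri pO
instance : Module.Free ℝ pC.tri := free_tri pC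

lemma finrank_pO_tri : Module.finrank ℝ pO.tri = 28 := by
  rw [finrank_tri octB_orthonormal pO_tri_eq_zero]
  decide +kernel

lemma finrank_oct_tensor : Module.finrank ℝ (Octonion ⊗[ℝ] ℂ) = 16 := by
  rw [← pairEquiv.finrank_eq, Module.finrank_prod, octEquiv.finrank_eq, Module.finrank_fin_fun]

/-- The coordinates of `t`. -/
def tEquiv : tSub ≃ₗ[ℝ] pO.tri × pC.tri × (Octonion ⊗[ℝ] ℂ) where
  toFun X := (X.1.tri, X.1.tri', X.1.iota 1)
  map_add' X Y := rfl
  map_smul' c X := rfl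
  invFun p := ⟨⟨p.1, p.2.1, Pi.single 1 p.2.2⟩, by constructor <;> rfl⟩
  left_inv X := Subtype.ext (magic_ext rfl rfl X.2.1.symm rfl X.2.2.symm)
  right_inv p := rfl

/-- The coordinates of `p`. -/
def pEquiv : pSub ≃ₗ[ℝ] (Octonion ⊗[ℝ] ℂ) × (Octonion ⊗[ℝ] ℂ) where
  toFun X := (X.1.iota 0, X.1.iota 2)
  map_add' X Y := rfl
  map_smul' c X := rfl
  invFun p := ⟨⟨0, 0, ![p.1, 0, p.2]⟩, by refine ⟨rfl, rfl, rfl⟩⟩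
  left_inv X := Subtype.ext (magic_ext X.2.1.symm X.2.2.1.symm rfl X.2.2.2.symm rfl)
  right_inv p := rfl

lemma finrank_tSub : Module.finrank ℝ tSub = 46 := by
  rw [tEquiv.finrank_eq, Module.finrank_prod, Module.finrank_prod, finrank_pO_tri, finrank_pC_tri,
    finrank_oct_tensor]

lemma finrank_pSub : Module.finrank ℝ pSub = 32 := by
  rw [pEquiv.finrank_eq, Module.finrank_prod, finrank_oct_tensor]

lemma finrank_G614 : Module.finrank ℝ G614 = 78 := by
  rw [(linearEquivProd _ pO pC).finrank_eq, Module.finrank_prod, Module.finrank_prod,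
    Module.finrank_pi_fintype, finrank_pO_tri, finrank_pC_tri, finrank_oct_tensor]
  simp

end RealForms
end

noncomputable section

namespace RealForms

open SymmetricCompositionAlgebra MagicAlgebra

/-! ### Brackets with the generators of the Cartan subalgebra -/

/-- The element of `g` with the given coordinates. -/
def mkG (d : pO.tri) (d' : pC.tri) (a₀ b₀ a₁ b₁ a₂ b₂ : Octonion) : G614 :=
  ⟨d, d', ![pair (a₀, b₀), pair (a₁, b₁), pair (a₂, b₂)]⟩

section mkG

variable (d : pO.tri) (d' : pC.tri) (a₀ b₀ a₁ b₁ a₂ b₂ : Octonion)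

@[simp] lemma mkG_tri : (mkG d d' a₀ b₀ a₁ b₁ a₂ b₂).tri = d := rfl
@[simp] lemma mkG_tri' : (mkG d d' a₀ b₀ a₁ b₁ a₂ b₂).tri' = d' := rfl
@[simp] lemma mkG_iota_zero : (mkG d d' a₀ b₀ a₁ b₁ a₂ b₂).iota 0 = pair (a₀, b₀) := rfl
@[simp] lemma mkG_iota_one : (mkG d d' a₀ b₀ a₁ b₁ a₂ b₂).iota 1 = pair (a₁, b₁) := rfl
@[simp] lemma mkG_iota_two : (mkG d d' a₀ b₀ a₁ b₁ a₂ b₂).iota 2 = pair (a₂, b₂) := rfl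

end mkG

lemma exists_mkG (X : G614) : ∃ d d' a₀ b₀ a₁ b₁ a₂ b₂, X = mkG d d' a₀ b₀ a₁ b₁ a₂ b₂ := by
  obtain ⟨a₀, b₀, h₀⟩ := exists_pair (X.iota 0)
  obtain ⟨a₁, b₁, h₁⟩ := exists_pair (X.iota 1)
  obtain ⟨a₂, b₂, h₂⟩ := exists_pair (X.iota 2)
  exact ⟨X.tri, X.tri', a₀, b₀, a₁, b₁, a₂, b₂, magic_ext rfl rfl h₀ h₁ h₂⟩

lemma mkG_inj {d e : pO.tri} {d' e' : pC.tri}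
    {a₀ b₀ a₁ b₁ a₂ b₂ x₀ y₀ x₁ y₁ x₂ y₂ : Octonion} :
    mkG d d' a₀ b₀ a₁ b₁ a₂ b₂ = mkG e e' x₀ y₀ x₁ y₁ x₂ y₂ ↔
      d = e ∧ d' = e' ∧ a₀ = x₀ ∧ b₀ = y₀ ∧ a₁ = x₁ ∧ b₁ = y₁ ∧ a₂ = x₂ ∧ b₂ = y₂ := by
  constructor
  · intro h
    have h0 := pair_inj.1 (congrArg (fun X => X.iota 0) h)
    have h1 := pair_inj.1 (congrArg (fun X => X.iota 1) h)
    have h2 := pair_inj.1 (congrArg (fun X => X.iota 2) h)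
    exact ⟨congrArg (fun X => X.tri) h, congrArg (fun X => X.tri') h, h0.1, h0.2, h1.1, h1.2,
      h2.1, h2.2⟩
  · rintro ⟨rfl, rfl, rfl, rfl, rfl, rfl, rfl, rfl⟩
    rfl

lemma mkG_zero : mkG 0 0 0 0 0 0 0 0 = 0 := by
  have h : pair (0, 0) = 0 := map_zero pair
  exact magic_ext rfl rfl h h h

lemma mkG_add (d e : pO.tri) (d' e' : pC.tri)
    (a₀ b₀ a₁ b₁ a₂ b₂ x₀ y₀ x₁ y₁ x₂ y₂ : Octonion) :
    mkG d d' a₀ b₀ a₁ b₁ a₂ b₂ + mkG e e' x₀ y₀ x₁ y₁ x₂ y₂ =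
      mkG (d + e) (d' + e') (a₀ + x₀) (b₀ + y₀) (a₁ + x₁) (b₁ + y₁) (a₂ + x₂) (b₂ + y₂) :=
  magic_ext rfl rfl (map_add pair (a₀, b₀) (x₀, y₀)).symm (map_add pair (a₁, b₁) (x₁, y₁)).symm
    (map_add pair (a₂, b₂) (x₂, y₂)).symm

lemma mkG_smul (c : ℝ) (d : pO.tri) (d' : pC.tri) (a₀ b₀ a₁ b₁ a₂ b₂ : Octonion) :
    c • mkG d d' a₀ b₀ a₁ b₁ a₂ b₂ =
      mkG (c • d) (c • d') (c • a₀) (c • b₀) (c • a₁) (c • b₁) (c • a₂) (c • b₂) :=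
  magic_ext rfl rfl (map_smul pair c (a₀, b₀)).symm (map_smul pair c (a₁, b₁)).symm
    (map_smul pair c (a₂, b₂)).symm

lemma mkG_neg (d : pO.tri) (d' : pC.tri) (a₀ b₀ a₁ b₁ a₂ b₂ : Octonion) :
    -mkG d d' a₀ b₀ a₁ b₁ a₂ b₂ = mkG (-d) (-d') (-a₀) (-b₀) (-a₁) (-b₁) (-a₂) (-b₂) :=
  magic_ext rfl rfl (map_neg pair (a₀, b₀)).symm (map_neg pair (a₁, b₁)).symm
    (map_neg pair (a₂, b₂)).symm

lemma ofTri_eq (d : pO.tri) : ofTri d = mkG d 0 0 0 0 0 0 0 := by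
  have h : pair (0, 0) = 0 := map_zero pair
  exact magic_ext rfl rfl h.symm h.symm h.symm

lemma ofTri'_eq (d : pC.tri) : ofTri' d = mkG 0 d 0 0 0 0 0 0 := by
  have h : pair (0, 0) = 0 := map_zero pair
  exact magic_ext rfl rfl h.symm h.symm h.symm

lemma iotaE_zero_zero_one : iotaE 0 0 1 = mkG 0 0 0 (octBasis 0) 0 0 0 0 := by
  have h : pair (0, 0) = 0 := map_zero pair
  refine magic_ext rfl rfl ?_ h.symm h.symm
  rw [mkG_iota_zero, pair_apply, TensorProduct.zero_tmul, zero_add]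
  rfl

lemma iotaE_zero_one_zero : iotaE 0 1 0 = mkG 0 0 (octBasis 1) 0 0 0 0 0 := by
  have h : pair (0, 0) = 0 := map_zero pair
  refine magic_ext rfl rfl ?_ h.symm h.symm
  rw [mkG_iota_zero, pair_apply, TensorProduct.zero_tmul, add_zero]
  rfl

/-- The element of `tri(pℂ)` with components `2i`, `-i`, `-i`. -/
abbrev kC : pC.tri := rotTri (-1) (-1)

lemma tauR_pair (x y z w : Octonion) :
    tauR pO pC (pair (x, y)) (pair (z, w)) = (pO.q x w - pO.q y z) • kC := by
  apply pC_tri_ext <;> simp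

lemma pair_add (x y z w : Octonion) : pair (x, y) + pair (z, w) = pair (x + z, y + w) :=
  (map_add pair (x, y) (z, w)).symm

lemma pair_sub (x y z w : Octonion) : pair (x, y) - pair (z, w) = pair (x - z, y - w) :=
  (map_sub pair (x, y) (z, w)).symm

lemma pair_smul (c : ℝ) (x y : Octonion) : c • pair (x, y) = pair (c • x, c • y) :=
  (map_smul pair c (x, y)).symm

lemma triLie_zero_left {S : Type*} [AddCommGroup S] [Module ℝ S]
    (A : SymmetricCompositionAlgebra S) (d : A.tri) : A.triLie 0 d = 0 := by
  apply A.tri_ext <;> intro z <;> simp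

lemma triLie_zero_right {S : Type*} [AddCommGroup S] [Module ℝ S]
    (A : SymmetricCompositionAlgebra S) (d : A.tri) : A.triLie d 0 = 0 := by
  apply A.tri_ext <;> intro z <;> simp

-- The bracket in coordinates, from which the later commutators are computed. The signs of the
-- triality terms are `ε_{i+1} ε_{i+2}`, and the factor `2` is `q'(1, 1) = q'(i, i)`. In the second
-- coordinate of each `ι_k` the sign `ε_k` is reversed because `1 * i = -i` in `pℂ`.
set_option maxHeartbeats 1000000 in
lemma lie_mkG (d e : pO.tri) (d' e' : pC.tri)
    (a₀ b₀ a₁ b₁ a₂ b₂ x₀ y₀ x₁ y₁ x₂ y₂ : Octonion) :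
    ⁅mkG d d' a₀ b₀ a₁ b₁ a₂ b₂, mkG e e' x₀ y₀ x₁ y₁ x₂ y₂⁆ =
      mkG (pO.triLie d e - (2 : ℝ) • (pO.t a₀ x₀ + pO.t b₀ y₀) +
          (2 : ℝ) • pO.theta (pO.t a₁ x₁ + pO.t b₁ y₁) -
          (2 : ℝ) • pO.theta (pO.theta (pO.t a₂ x₂ + pO.t b₂ y₂)))
        (-((pO.q a₀ y₀ - pO.q b₀ x₀) • kC) + (pO.q a₁ y₁ - pO.q b₁ x₁) • pC.theta kC -
          (pO.q a₂ y₂ - pO.q b₂ x₂) • pC.theta (pC.theta kC))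
        (d.1 0 x₀ - rot 0 d' • y₀ - (e.1 0 a₀ - rot 0 e' • b₀) +
          (pO.mul a₁ x₂ - pO.mul b₁ y₂ - (pO.mul x₁ a₂ - pO.mul y₁ b₂)))
        (d.1 0 y₀ + rot 0 d' • x₀ - (e.1 0 b₀ + rot 0 e' • a₀) -
          (pO.mul a₁ y₂ + pO.mul b₁ x₂ - (pO.mul x₁ b₂ + pO.mul y₁ a₂)))
        (d.1 1 x₁ - rot 1 d' • y₁ - (e.1 1 a₁ - rot 1 e' • b₁) -
          (pO.mul a₂ x₀ - pO.mul b₂ y₀ - (pO.mul x₂ a₀ - pO.mul y₂ b₀)))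
        (d.1 1 y₁ + rot 1 d' • x₁ - (e.1 1 b₁ + rot 1 e' • a₁) +
          (pO.mul a₂ y₀ + pO.mul b₂ x₀ - (pO.mul x₂ b₀ + pO.mul y₂ a₀)))
        (d.1 2 x₂ - rot 2 d' • y₂ - (e.1 2 a₂ - rot 2 e' • b₂) +
          (pO.mul a₀ x₁ - pO.mul b₀ y₁ - (pO.mul x₀ a₁ - pO.mul y₀ b₁)))
        (d.1 2 y₂ + rot 2 d' • x₂ - (e.1 2 b₂ + rot 2 e' • a₂) -
          (pO.mul a₀ y₁ + pO.mul b₀ x₁ - (pO.mul x₀ b₁ + pO.mul y₀ a₁))) := by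
  refine magic_ext ?_ ?_ ?_ ?_ ?_
  · rw [lie_tri]
    simp only [mkG_tri, mkG_iota_zero, mkG_iota_one, mkG_iota_two, tauL_pair, map_smul]
    simp
    module
  · rw [lie_tri']
    simp only [mkG_tri', mkG_iota_zero, mkG_iota_one, mkG_iota_two, tauR_pair, map_smul, pC_triLie]
    simp
    module
  · rw [lie_iota]
    simp only [zero_add, mkG_tri, mkG_tri', mkG_iota_zero, mkG_iota_one, mkG_iota_two, actL_pair,
      actR_pair, tmul_pair, pair_add, pair_sub, pair_smul, pair_inj]
    constructor
    · simp; abel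
    · simp; abel
  · rw [lie_iota]
    simp only [f1, f2, mkG_tri, mkG_tri', mkG_iota_zero, mkG_iota_one, mkG_iota_two, actL_pair,
      actR_pair, tmul_pair, pair_add, pair_sub, pair_smul, pair_inj]
    constructor
    · simp; abel
    · simp; abel
  · rw [lie_iota]
    simp only [f3, f4, mkG_tri, mkG_tri', mkG_iota_zero, mkG_iota_one, mkG_iota_two, actL_pair,
      actR_pair, tmul_pair, pair_add, pair_sub, pair_smul, pair_inj]
    constructor
    · simp; abel
    · simp; abel

lemma mul_octBasis_zero (x : Octonion) : pO.mul x (octBasis 0) = octConj x := by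
  simp [pO_mul, octMul, octConj, octBasis]

lemma octBasis_zero_mul (x : Octonion) : pO.mul (octBasis 0) x = octConj x := by
  simp [pO_mul, octMul, octConj, octBasis]

lemma octConj_eq_zero {x : Octonion} : octConj x = 0 ↔ x = 0 := by
  simp [octConj, Prod.ext_iff]

lemma lie_tE (i j : Fin 8) (d : pO.tri) (d' : pC.tri) (a₀ b₀ a₁ b₁ a₂ b₂ : Octonion) :
    ⁅tE i j, mkG d d' a₀ b₀ a₁ b₁ a₂ b₂⁆ =
      let e := pO.t (octBasis i) (octBasis j)
      mkG (pO.triLie e d) 0 (e.1 0 a₀) (e.1 0 b₀) (e.1 1 a₁) (e.1 1 b₁) (e.1 2 a₂) (e.1 2 b₂) := by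
  rw [tE, ofTri_eq, lie_mkG]
  simp

lemma lie_iotaE_zero_one (d : pO.tri) (d' : pC.tri) (a₀ b₀ a₁ b₁ a₂ b₂ : Octonion) :
    ⁅iotaE 0 0 1, mkG d d' a₀ b₀ a₁ b₁ a₂ b₂⁆ =
      mkG (-((2 : ℝ) • pO.t (octBasis 0) b₀)) (pO.q (octBasis 0) a₀ • kC)
        (rot 0 d' • octBasis 0) (-d.1 0 (octBasis 0))
        (-octConj b₂) (-octConj a₂) (-octConj b₁) (-octConj a₁) := by
  rw [iotaE_zero_zero_one, lie_mkG]
  simp [triLie_zero_left, mul_octBasis_zero, octBasis_zero_mul]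

lemma lie_iotaE_one_zero (d : pO.tri) (d' : pC.tri) (a₀ b₀ a₁ b₁ a₂ b₂ : Octonion) :
    ⁅iotaE 0 1 0, mkG d d' a₀ b₀ a₁ b₁ a₂ b₂⁆ =
      mkG (-((2 : ℝ) • pO.t (octBasis 1) a₀)) (-(pO.q (octBasis 1) b₀ • kC))
        (-d.1 0 (octBasis 1)) (-(rot 0 d' • octBasis 1))
        (pO.mul a₂ (octBasis 1)) (-pO.mul b₂ (octBasis 1))
        (pO.mul (octBasis 1) a₁) (-pO.mul (octBasis 1) b₁) := by
  rw [iotaE_zero_one_zero, lie_mkG]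
  simp [triLie_zero_left]

lemma octBasis_ne_zero (i : Fin 8) : octBasis i ≠ 0 := by
  rw [← octB_apply]
  exact octB.ne_zero i

/-- Brackets with `ι₀(x ⊗ 1)` for all `x` kill `d₀`, hence `d`, and the zeroth rotation of `d'`. The
two test vectors `ι₀(1 ⊗ 1)` and `ι₁(1 ⊗ 1)` remove the remaining coordinates. -/
lemma G614_center (X : G614) (h : ∀ Y : G614, ⁅X, Y⁆ = 0) : X = 0 := by
  obtain ⟨d, d', a₀, b₀, a₁, b₁, a₂, b₂, rfl⟩ := exists_mkG X
  have hd : ∀ x, d.1 0 x = 0 ∧ rot 0 d' • x = 0 := fun x => by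
    have h1 := h (mkG 0 0 x 0 0 0 0 0)
    rw [lie_mkG, ← mkG_zero, mkG_inj] at h1
    have h2 := And.intro h1.2.2.1 h1.2.2.2.1
    simpa using h2
  have hd0 := pO_tri_eq_zero d (LinearMap.ext fun x => (hd x).1)
  subst hd0
  have h0 := h (mkG 0 0 (octBasis 0) 0 0 0 0 0)
  have h1 := h (mkG 0 0 0 0 (octBasis 0) 0 0 0)
  rw [lie_mkG, ← mkG_zero, mkG_inj] at h0 h1
  simp [mul_octBasis_zero, octBasis_zero_mul, octConj_eq_zero, octBasis_ne_zero] at h0 h1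
  have hs := rot_sum d'
  rw [← mkG_zero, mkG_inj]
  refine ⟨rfl, pC_tri_ext ?_ ?_, ?_⟩
  · rw [map_zero]; tauto
  · rw [map_zero]
    have h2 : rot 0 d' = 0 := by tauto
    have h3 : rot 1 d' = 0 := by tauto
    linarith
  · tauto

/-! ### The Cartan decomposition -/

lemma mem_tSub_iff (X : G614) : X ∈ tSub ↔ cartanG.theta X = X := by
  have h2 : ∀ u : Octonion ⊗[ℝ] ℂ, -u = u ↔ u = 0 := fun u => by
    rw [neg_eq_iff_add_eq_zero, ← two_smul ℝ, smul_eq_zero]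
    simp
  constructor
  · rintro ⟨h, h'⟩
    refine magic_ext rfl rfl ?_ rfl ?_
    · exact (h2 _).2 h
    · exact (h2 _).2 h'
  · intro h
    exact ⟨(h2 _).1 (congrArg (fun X => X.iota 0) h), (h2 _).1 (congrArg (fun X => X.iota 2) h)⟩

lemma mem_pSub_iff (X : G614) : X ∈ pSub ↔ cartanG.theta X = -X := by
  have hself : ∀ {V : Type} [AddCommGroup V] [Module ℝ V] (u : V), u = -u ↔ u = 0 := fun u => by
    rw [eq_neg_iff_add_eq_zero, ← two_smul ℝ, smul_eq_zero]
    simp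
  constructor
  · rintro ⟨h, h', h''⟩
    refine magic_ext ?_ ?_ rfl ?_ rfl
    · change X.tri = -X.tri
      rw [h, neg_zero]
    · change X.tri' = -X.tri'
      rw [h', neg_zero]
    · change X.iota 1 = -X.iota 1
      rw [h'', neg_zero]
  · intro h
    exact ⟨(hself _).1 (congrArg (fun X => X.tri) h), (hself _).1 (congrArg (fun X => X.tri') h),
      (hself _).1 (congrArg (fun X => X.iota 1) h)⟩

lemma isCartanDecomposition_G614 : IsCartanDecomposition tSub pSub :=
  cartanG.isCartanDecomposition G614_center tSub pSub mem_tSub_iff mem_pSub_iff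

lemma killingForm_tSub (x : G614) (hx : x ∈ tSub) (h0 : x ≠ 0) : killingForm ℝ G614 x x < 0 := by
  obtain ⟨r, hr, h⟩ := cartanG.killingForm_self G614_center (c := -1) (by norm_num)
    (by rw [(mem_tSub_iff x).1 hx]; simp) h0
  rw [h]
  linarith

lemma killingForm_pSub (x : G614) (hx : x ∈ pSub) (h0 : x ≠ 0) : 0 < killingForm ℝ G614 x x := by
  obtain ⟨r, hr, h⟩ := cartanG.killingForm_self G614_center (c := 1) (by norm_num)
    (by rw [(mem_pSub_iff x).1 hx]; simp) h0
  rw [h]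
  linarith

lemma killingSignature_G614 : killingSignature G614 = -14 := by
  rw [killingSignature_eq (t := tSub.toSubmodule) (p := pSub) isCartanDecomposition_G614.1
    killingForm_tSub killingForm_pSub, finrank_pSub]
  have := finrank_tSub
  change ((32 : ℕ) : ℤ) - (Module.finrank ℝ tSub : ℤ) = _
  rw [this]
  norm_num

instance isKilling_G614 : LieAlgebra.IsKilling ℂ (ℂ ⊗[ℝ] G614) :=
  cartanG.isKilling_complexification G614_center

end RealForms
end

noncomputable section

namespace RealForms

open SymmetricCompositionAlgebra MagicAlgebra

/-! ### The Cartan subalgebra -/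

lemma t_zero_basis (i j k : Fin 8) : (pO.t (octBasis i) (octBasis j)).1 0 (octBasis k) =
    (if i = k then (2 : ℝ) else 0) • octBasis j - (if j = k then (2 : ℝ) else 0) • octBasis i := by
  rw [t_zero_apply, pO_q_basis, pO_q_basis]

/-- The general element of `h`, in terms of its coordinates. -/
def hVec (c : Fin 6 → ℝ) : G614 :=
  mkG (((1 / 2) * c 0) • pO.t (octBasis 2) (octBasis 3) +
      ((1 / 2) * c 1) • pO.t (octBasis 4) (octBasis 5) +
      ((1 / 2) * c 2) • pO.t (octBasis 7) (octBasis 6))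
    (((1 / 4) * c 3) • zC) (((1 / 2) * c 5) • octBasis 1) (((1 / 2) * c 4) • octBasis 0) 0 0 0 0

lemma sum_hGen (c : Fin 6 → ℝ) : ∑ i, c i • hGen i = hVec c := by
  rw [Fin.sum_univ_six]
  simp only [hGen, tE, ofTri_eq, ofTri'_eq, iotaE_zero_zero_one, iotaE_zero_one_zero, hVec,
    Matrix.cons_val, mkG_smul, mkG_add, mkG_inj, smul_zero, add_zero, zero_add, smul_smul,
    mul_comm (c _), and_self]

lemma hGen_eq (i : Fin 6) : hGen i = hVec (Pi.single i 1) := by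
  rw [← sum_hGen]
  simp [Pi.single_apply]

lemma triLie_t_basis {i j k l : Fin 8} (hki : k ≠ i) (hkj : k ≠ j) (hli : l ≠ i) (hlj : l ≠ j) :
    pO.triLie (pO.t (octBasis i) (octBasis j)) (pO.t (octBasis k) (octBasis l)) = 0 := by
  rw [pO.triLie_t]
  simp [t_zero_basis, hki.symm, hkj.symm, hli.symm, hlj.symm]

lemma triLie_self (d : pO.tri) : pO.triLie d d = 0 := by
  apply pO.tri_ext <;> intro z <;> simp

lemma t_self (x : Octonion) : pO.t x x = 0 := by
  have h := pO.t_skew x x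
  have h2 : (2 : ℝ) • pO.t x x = 0 := by linear_combination (norm := module) h
  simpa using h2

lemma triLie_smul_left {S : Type*} [AddCommGroup S] [Module ℝ S]
    (A : SymmetricCompositionAlgebra S) (c : ℝ) (d e : A.tri) :
    A.triLie (c • d) e = c • A.triLie d e := by
  apply A.tri_ext <;> intro z <;> simp [smul_sub]

/-- The index pairs `23`, `45`, `76` are disjoint from each other and from `0, 1`; moreover `zC`
acts trivially on `ι₀`, and `t_{x,x} = 0` with `q(e₀, e₁) = 0` disposes of the two `ι₀` generators.
-/
lemma hVec_lie (c c' : Fin 6 → ℝ) : ⁅hVec c, hVec c'⁆ = 0 := by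
  rw [hVec, hVec, lie_mkG, ← mkG_zero, mkG_inj]
  refine ⟨?_, ?_, ?_, ?_, ?_, ?_, ?_, ?_⟩
  · simp [triLie_add_left, triLie_add_right, triLie_smul_left, triLie_smul_right, triLie_t_basis,
      triLie_self, t_self]
  · simp [pO_q_basis]
  all_goals simp [rot_zC_zero, t_zero_basis]

/-- The span of the generators is the Cartan subalgebra. -/
lemma hSub_toSubmodule : hSub.toSubmodule = Submodule.span ℝ (Set.range hGen) := by
  refine le_antisymm ?_ LieSubalgebra.submodule_span_le_lieSpan
  have hmem : ∀ x ∈ Submodule.span ℝ (Set.range hGen), ∃ c, x = hVec c := by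
    intro x hx
    obtain ⟨c, rfl⟩ := (Submodule.mem_span_range_iff_exists_fun ℝ).1 hx
    exact ⟨c, sum_hGen c⟩
  -- All brackets in the span vanish, so the span is already a subalgebra.
  let K : LieSubalgebra ℝ G614 :=
    { Submodule.span ℝ (Set.range hGen) with
      lie_mem' := by
        intro x y hx hy
        obtain ⟨c, rfl⟩ := hmem x hx
        obtain ⟨c', rfl⟩ := hmem y hy
        rw [hVec_lie]
        exact Submodule.zero_mem _ }
  have : hSub ≤ K := LieSubalgebra.lieSpan_le.2 Submodule.subset_span
  exact this

lemma mem_hSub_iff (X : G614) : X ∈ hSub ↔ ∃ c, X = hVec c := by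
  rw [← LieSubalgebra.mem_toSubmodule, hSub_toSubmodule,
    Submodule.mem_span_range_iff_exists_fun]
  simp only [sum_hGen, eq_comm]

lemma hGen_mem_hSub (i : Fin 6) : hGen i ∈ hSub := (mem_hSub_iff _).2 ⟨_, hGen_eq i⟩

/-- The elements of `g` commuting with `a`. -/
lemma of_lie_iotaE {d : pO.tri} {d' : pC.tri} {a₀ b₀ a₁ b₁ a₂ b₂ : Octonion}
    (h₁ : ⁅iotaE 0 0 1, mkG d d' a₀ b₀ a₁ b₁ a₂ b₂⁆ = 0)
    (h₂ : ⁅iotaE 0 1 0, mkG d d' a₀ b₀ a₁ b₁ a₂ b₂⁆ = 0) :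
    (d.1 0 (octBasis 0) = 0 ∧ d.1 0 (octBasis 1) = 0 ∧ rot 0 d' = 0) ∧
      (∃ r : ℝ, a₀ = r • octBasis 1) ∧ (∃ r : ℝ, b₀ = r • octBasis 0) ∧
      a₁ = 0 ∧ b₁ = 0 ∧ a₂ = 0 ∧ b₂ = 0 := by
  rw [lie_iotaE_zero_one, ← mkG_zero, mkG_inj] at h₁
  rw [lie_iotaE_one_zero, ← mkG_zero, mkG_inj] at h₂
  -- The zeroth component of `t_{e_i,x}` at `e_i` is `2x - q(x, e_i) e_i`.
  have key : ∀ (i : Fin 8) (x : Octonion), -((2 : ℝ) • pO.t (octBasis i) x) = 0 →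
      ∃ r : ℝ, x = r • octBasis i := by
    intro i x hx
    have h : pO.t (octBasis i) x = 0 := by simpa using hx
    have h2 := pO.t_zero_apply (octBasis i) x (octBasis i)
    rw [h, pO_q_basis, if_pos rfl] at h2
    refine ⟨2⁻¹ * pO.q x (octBasis i), ?_⟩
    have h3 : (2 : ℝ) • x = pO.q x (octBasis i) • octBasis i := by
      rw [← sub_eq_zero, ← h2]; rfl
    rw [mul_smul, ← h3, smul_smul]
    norm_num
  simp only [neg_eq_zero, octConj_eq_zero] at h₁ h₂
  obtain ⟨e1, e2, e3, e4, e5, e6, e7, e8⟩ := h₁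
  obtain ⟨f1, f2, f3, f4, f5, f6, f7, f8⟩ := h₂
  refine ⟨⟨e4, f3, ?_⟩, key _ _ (by rw [f1, neg_zero]), key _ _ (by rw [e1, neg_zero]),
    e8, e7, e6, e5⟩
  simpa [octBasis_ne_zero] using e3

/-- The joint centralizer of the generators is the Cartan subalgebra. -/
lemma mem_hSub_of_lie_hGen (X : G614) (h : ∀ i, ⁅hGen i, X⁆ = 0) : X ∈ hSub := by
  obtain ⟨d, d', a₀, b₀, a₁, b₁, a₂, b₂, rfl⟩ := exists_mkG X
  have hs : ∀ {c : ℝ} {Y Z : G614}, c ≠ 0 → ⁅c • Y, Z⁆ = 0 → ⁅Y, Z⁆ = 0 := by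
    intro c Y Z hc h
    rw [smul_lie] at h
    exact (smul_eq_zero.1 h).resolve_left hc
  have h0 := hs (by norm_num) (h 0)
  have h1 := hs (by norm_num) (h 1)
  have h2 := hs (by norm_num) (h 2)
  obtain ⟨⟨hd0, hd1, hr⟩, ⟨r, rfl⟩, ⟨s, rfl⟩, rfl, rfl, rfl, rfl⟩ :=
    of_lie_iotaE (hs (by norm_num) (h 4)) (hs (by norm_num) (h 5))
  -- For `k` outside the pair, `σ_{e_i,e_j}` kills `e_k`; commuting with it, `d₀` must send `e_k` to
  -- a vector without components along `e_i` and `e_j`. So `d₀` preserves each of the coordinate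
  -- planes.
  have key : ∀ i j : Fin 8, i ≠ j → ⁅tE i j, mkG d d' (r • octBasis 1) (s • octBasis 0) 0 0 0 0⁆ = 0 →
      ∀ k, k ≠ i → k ≠ j → pO.q (octBasis i) (d.1 0 (octBasis k)) = 0 ∧
        pO.q (octBasis j) (d.1 0 (octBasis k)) = 0 := by
    intro i j hij h k hki hkj
    rw [lie_tE, ← mkG_zero, mkG_inj] at h
    have h3 := congrArg (fun f : pO.tri => f.1 0 (octBasis k)) h.1
    simp only [triLie_apply, t_zero_apply, pO_q_basis, hki.symm, hkj.symm, if_false, zero_smul,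
      sub_zero, map_zero] at h3
    replace h3 : pO.q (octBasis i) (d.1 0 (octBasis k)) • octBasis j -
      pO.q (octBasis j) (d.1 0 (octBasis k)) • octBasis i = 0 := h3
    have h4 := congrArg (pO.q (octBasis i)) h3
    have h5 := congrArg (pO.q (octBasis j)) h3
    simp only [map_sub, map_smul, pO_q_basis, hij, hij.symm, if_false, if_true, smul_eq_mul,
      map_zero] at h4 h5
    constructor <;> linarith
  have k0 := key 2 3 (by decide) h0
  have k1 := key 4 5 (by decide) h1
  have k2 := key 7 6 (by decide) h2
  have hq : ∀ i j, pO.q (octBasis i) (d.1 0 (octBasis j)) =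
      -pO.q (octBasis j) (d.1 0 (octBasis i)) := fun i j => by
    rw [pO.q_symm, pO.tri_skew]
  rw [mem_hSub_iff]
  -- Since `σ_{e_2,e_3}` sends `e_2` to `2 e_3`, `h₁` sends `e_2` to `e_3`, and likewise for the
  -- other two planes. The factors `2` undo `rot 1 (zC / 4) = 1/2` and the halves in `h₅`, `h₆`.
  refine ⟨![2⁻¹ * pO.q (octBasis 3) (d.1 0 (octBasis 2)), 2⁻¹ * pO.q (octBasis 5) (d.1 0 (octBasis 4)),
    2⁻¹ * pO.q (octBasis 6) (d.1 0 (octBasis 7)), 2 * rot 1 d', 2 * s, 2 * r], ?_⟩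
  rw [hVec, mkG_inj]
  refine ⟨?_, pC_tri_ext ?_ ?_, ?_, ?_, rfl, rfl, rfl, rfl⟩
  · rw [← sub_eq_zero]
    refine tri_eq_zero_of_q octB_orthonormal pO_tri_eq_zero fun i j => ?_
    have hcoe : ∀ d e : pO.tri, (d - e).1 = d.1 - e.1 := fun _ _ => rfl
    have hcoe' : ∀ d e : pO.tri, (d + e).1 = d.1 + e.1 := fun _ _ => rfl
    have hcoe'' : ∀ (c : ℝ) (e : pO.tri), (c • e).1 = c • e.1 := fun _ _ => rfl
    have hdiag : ∀ i, pO.q (octBasis i) (d.1 0 (octBasis i)) = 0 := fun i => by linarith [hq i i]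
    have z0 : ∀ j, pO.q (octBasis 0) (d.1 0 (octBasis j)) = 0 := fun j => by
      rw [hq, hd0, map_zero, neg_zero]
    have z1 : ∀ j, pO.q (octBasis 1) (d.1 0 (octBasis j)) = 0 := fun j => by
      rw [hq, hd1, map_zero, neg_zero]
    have z2 := fun k h h' => (k0 k h h').1
    have z3 := fun k h h' => (k0 k h h').2
    have z4 := fun k h h' => (k1 k h h').1
    have z5 := fun k h h' => (k1 k h h').2
    have z7 := fun k h h' => (k2 k h h').1
    have z6 := fun k h h' => (k2 k h h').2
    simp only [octB_apply, hcoe, hcoe', hcoe'', Pi.sub_apply, Pi.add_apply, Pi.smul_apply,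
      LinearMap.sub_apply, LinearMap.add_apply, LinearMap.smul_apply, t_zero_basis, map_sub,
      map_add, map_smul, pO_q_basis, smul_eq_mul, Matrix.cons_val]
    fin_cases i <;> fin_cases j <;>
      simp [z0, z1, z2, z3, z4, z5, z6, z7, hd0, hd1, hdiag, hq 2 3, hq 4 5, hq 7 6] <;> ring
  · simp [rot_zC_one]; ring
  · have := rot_sum d'
    simp [rot_zC_two]
    linarith
  · simp
  · simp

end RealForms
end

/-! ### Bases, maximality and intersections of `a` and `h`. -/

noncomputable section

namespace RealForms

open SymmetricCompositionAlgebra MagicAlgebra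

lemma hVec_add (c c' : Fin 6 → ℝ) : hVec (c + c') = hVec c + hVec c' := by
  simp only [← sum_hGen, Pi.add_apply, add_smul, Finset.sum_add_distrib]

lemma hVec_eq_zero {c : Fin 6 → ℝ} (h : hVec c = 0) : c = 0 := by
  rw [hVec, ← mkG_zero, mkG_inj] at h
  obtain ⟨h1, h2, h3, h4, -⟩ := h
  have key : ∀ k, (((1 / 2) * c 0) • pO.t (octBasis 2) (octBasis 3) +
      ((1 / 2) * c 1) • pO.t (octBasis 4) (octBasis 5) +
      ((1 / 2) * c 2) • pO.t (octBasis 7) (octBasis 6) : pO.tri).1 0 (octBasis k) = 0 := by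
    intro k
    rw [h1]
    rfl
  have hcoe : ∀ d e : pO.tri, (d + e).1 = d.1 + e.1 := fun _ _ => rfl
  have hcoe' : ∀ (c : ℝ) (e : pO.tri), (c • e).1 = c • e.1 := fun _ _ => rfl
  simp only [hcoe, hcoe', Pi.add_apply, Pi.smul_apply, LinearMap.add_apply, LinearMap.smul_apply,
    t_zero_basis] at key
  have k0 := key 2
  have k1 := key 4
  have k2 := key 7
  have h5 := congrArg (rot 1) h2
  simp [smul_smul, octBasis_ne_zero, rot_zC_one] at k0 k1 k2 h3 h4 h5
  ext i
  fin_cases i <;> assumption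

lemma linearIndependent_hGen : LinearIndependent ℝ hGen :=
  Fintype.linearIndependent_iff.2 fun c hc i => by
    rw [sum_hGen] at hc
    rw [hVec_eq_zero hc]
    rfl

lemma isMaximalAbelianIn_hSub : IsMaximalAbelianIn hSub.toSubmodule ⊤ := by
  refine ⟨⟨le_top, fun x hx y hy => ?_⟩, fun b hb hab x hx => ?_⟩
  · obtain ⟨c, rfl⟩ := (mem_hSub_iff x).1 hx
    obtain ⟨c', rfl⟩ := (mem_hSub_iff y).1 hy
    exact hVec_lie c c'
  · exact mem_hSub_of_lie_hGen x fun i => hb.2 _ (hab (hGen_mem_hSub i)) _ hx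

lemma aSub_eq : aSub = Submodule.span ℝ (Set.range ![hGen 4, hGen 5]) := by
  have e4 : iotaE 0 0 1 = (2 : ℝ) • hGen 4 := by
    change _ = (2 : ℝ) • ((1 / 2 : ℝ) • iotaE 0 0 1)
    rw [smul_smul]; norm_num
  have e5 : iotaE 0 1 0 = (2 : ℝ) • hGen 5 := by
    change _ = (2 : ℝ) • ((1 / 2 : ℝ) • iotaE 0 1 0)
    rw [smul_smul]; norm_num
  rw [Matrix.range_cons, Matrix.range_cons, Matrix.range_empty, Set.union_empty,
    Set.singleton_union]
  refine le_antisymm (Submodule.span_le.2 ?_) (Submodule.span_le.2 ?_)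
  · rintro x (rfl | rfl)
    · rw [e4]
      exact Submodule.smul_mem _ _ (Submodule.subset_span (Or.inl rfl))
    · rw [e5]
      exact Submodule.smul_mem _ _ (Submodule.subset_span (Or.inr rfl))
  · rintro x (rfl | rfl)
    · exact Submodule.smul_mem _ _ (Submodule.subset_span (Or.inl rfl))
    · exact Submodule.smul_mem _ _ (Submodule.subset_span (Or.inr rfl))

lemma linearIndependent_aGen : LinearIndependent ℝ ![hGen 4, hGen 5] := by
  have h := linearIndependent_hGen.comp ![4, 5] (by decide)
  convert h using 1
  ext i : 1
  fin_cases i <;> rfl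

/-- The basis `h₅, h₆` of `a`. -/
def aBasis : Module.Basis (Fin 2) ℝ aSub :=
  (Module.Basis.span linearIndependent_aGen).map (LinearEquiv.ofEq _ _ aSub_eq.symm)

lemma aBasis_zero : (aBasis 0 : G614) = hGen 4 := by
  simp [aBasis, Module.Basis.span_apply]

lemma aBasis_one : (aBasis 1 : G614) = hGen 5 := by
  simp [aBasis, Module.Basis.span_apply]

lemma finrank_aSub : Module.finrank ℝ aSub = 2 := by
  rw [Module.finrank_eq_card_basis aBasis, Fintype.card_fin]

lemma mem_aSub_iff (X : G614) : X ∈ aSub ↔ ∃ r s : ℝ, X = hVec ![0, 0, 0, 0, r, s] := by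
  rw [aSub_eq, Submodule.mem_span_range_iff_exists_fun]
  have e : ∀ r s : ℝ, hVec ![0, 0, 0, 0, r, s] = r • hGen 4 + s • hGen 5 := fun r s => by
    rw [← sum_hGen, Fin.sum_univ_six]
    simp
  simp only [Fin.sum_univ_two, e]
  constructor
  · rintro ⟨c, rfl⟩
    exact ⟨c 0, c 1, rfl⟩
  · rintro ⟨r, s, rfl⟩
    exact ⟨![r, s], rfl⟩

lemma aSub_le_pSub : aSub ≤ pSub := by
  intro X hX
  obtain ⟨r, s, rfl⟩ := (mem_aSub_iff X).1 hX
  refine ⟨?_, ?_, ?_⟩ <;> simp [hVec]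
  exact map_zero pair

/-- An element commuting with both generators has all its `ι` parts in `a` by `of_lie_iotaE`, and an
element of `p` has no triality part. -/
lemma isMaximalAbelianIn_aSub : IsMaximalAbelianIn aSub pSub := by
  refine ⟨⟨aSub_le_pSub, fun x hx y hy => ?_⟩, fun b hb hab X hX => ?_⟩
  · obtain ⟨r, s, rfl⟩ := (mem_aSub_iff x).1 hx
    obtain ⟨r', s', rfl⟩ := (mem_aSub_iff y).1 hy
    exact hVec_lie _ _
  · obtain ⟨hX1, hX2, -⟩ := hb.1 hX
    have h4 := hb.2 _ (hab (Submodule.subset_span (Or.inl rfl))) _ hX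
    have h5 := hb.2 _ (hab (Submodule.subset_span (Or.inr rfl))) _ hX
    obtain ⟨d, d', a₀, b₀, a₁, b₁, a₂, b₂, rfl⟩ := exists_mkG X
    obtain ⟨-, ⟨r, rfl⟩, ⟨s, rfl⟩, rfl, rfl, rfl, rfl⟩ := of_lie_iotaE h4 h5
    rw [mkG_tri] at hX1
    rw [mkG_tri'] at hX2
    subst hX1 hX2
    refine (mem_aSub_iff _).2 ⟨2 * s, 2 * r, ?_⟩
    rw [hVec, mkG_inj]
    simp

lemma hVec_mem_tSub_iff (c : Fin 6 → ℝ) : hVec c ∈ tSub ↔ c 4 = 0 ∧ c 5 = 0 := by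
  have h : hVec c ∈ tSub ↔ pair (((1 / 2) * c 5) • octBasis 1, ((1 / 2) * c 4) • octBasis 0) = 0 ∧
      pair (0, 0) = 0 := Iff.rfl
  rw [h, pair_eq_zero, pair_eq_zero]
  simp [octBasis_ne_zero, and_comm]

lemma hSub_inf_tSub : hSub.toSubmodule ⊓ tSub.toSubmodule =
    Submodule.span ℝ {tE 2 3, tE 4 5, tE 6 7, ofTri' zC} := by
  have e67 : tE 7 6 = -tE 6 7 := by
    rw [tE, tE, ofTri_eq, ofTri_eq, mkG_neg, pO.t_skew (octBasis 6)]
    simp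
  refine le_antisymm ?_ (Submodule.span_le.2 ?_)
  · rintro X ⟨hX, hX'⟩
    obtain ⟨c, rfl⟩ := (mem_hSub_iff X).1 hX
    obtain ⟨h4, h5⟩ := (hVec_mem_tSub_iff c).1 hX'
    rw [← sum_hGen, Fin.sum_univ_six, h4, h5, zero_smul, zero_smul, add_zero, add_zero]
    have hs : ∀ (r s : ℝ) {Y : G614}, Y ∈ ({tE 2 3, tE 4 5, tE 6 7, ofTri' zC} : Set G614) →
        r • s • Y ∈ Submodule.span ℝ ({tE 2 3, tE 4 5, tE 6 7, ofTri' zC} : Set G614) :=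
      fun r s Y hY => Submodule.smul_mem _ _ (Submodule.smul_mem _ _ (Submodule.subset_span hY))
    refine add_mem (add_mem (add_mem (hs _ _ (by simp)) (hs _ _ (by simp))) ?_) (hs _ _ (by simp))
    change c 2 • (1 / 2 : ℝ) • tE 7 6 ∈ _
    rw [e67, smul_neg, smul_neg]
    exact neg_mem (hs _ _ (by simp))
  · have ht : ∀ d d', mkG d d' 0 0 0 0 0 0 ∈ tSub := fun d d' =>
      ⟨map_zero pair, map_zero pair⟩
    have hh : ∀ (i : Fin 6) (r s : ℝ) (Y : G614), hGen i = s • Y → r * s = 1 →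
        Y ∈ hSub.toSubmodule := by
      intro i r s Y h hrs
      have h2 := hSub.smul_mem r (hGen_mem_hSub i)
      rw [h, smul_smul, hrs, one_smul] at h2
      exact h2
    have h67 : tE 6 7 ∈ hSub.toSubmodule := by
      have := hh 2 2 (1 / 2) (tE 7 6) rfl (by norm_num)
      rw [e67] at this
      simpa using neg_mem this
    rintro X (rfl | rfl | rfl | rfl)
    · exact ⟨hh 0 2 (1 / 2) _ rfl (by norm_num), by rw [tE, ofTri_eq]; exact ht _ _⟩
    · exact ⟨hh 1 2 (1 / 2) _ rfl (by norm_num), by rw [tE, ofTri_eq]; exact ht _ _⟩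
    · exact ⟨h67, by rw [tE, ofTri_eq]; exact ht _ _⟩
    · exact ⟨hh 3 4 (1 / 4) _ rfl (by norm_num), by rw [ofTri'_eq]; exact ht _ _⟩

lemma aSub_sup_hSub_inf_tSub :
    aSub ⊔ (hSub.toSubmodule ⊓ tSub.toSubmodule) = hSub.toSubmodule := by
  refine le_antisymm (sup_le aSub_le_hSub inf_le_left) fun X hX => ?_
  obtain ⟨c, rfl⟩ := (mem_hSub_iff X).1 hX
  have e : hVec c = hVec ![0, 0, 0, 0, c 4, c 5] + hVec ![c 0, c 1, c 2, c 3, 0, 0] := by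
    rw [← hVec_add]
    congr 1
    ext i
    fin_cases i <;> simp
  rw [e]
  exact Submodule.add_mem_sup ((mem_aSub_iff _).2 ⟨_, _, rfl⟩)
    ⟨(mem_hSub_iff _).2 ⟨_, rfl⟩, (hVec_mem_tSub_iff _).2 ⟨rfl, rfl⟩⟩

/-! ### The complexification of the Cartan subalgebra -/

lemma complexify_hSub : (complexify hSub).toSubmodule =
    Submodule.span ℂ (Set.range fun j => (1 : ℂ) ⊗ₜ[ℝ] hGen j) := by
  change hSub.toSubmodule.baseChange ℂ = _
  rw [hSub_toSubmodule, Submodule.baseChange_span, ← Set.range_comp]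
  rfl

lemma linearIndependent_tmul_hGen :
    LinearIndependent ℂ fun j => (1 : ℂ) ⊗ₜ[ℝ] hGen j := by
  exact Module.Flat.linearIndependent_one_tmul linearIndependent_hGen

/-- The basis `h₁, …, h₆` of the complexification of `h`. -/
def hBasis : Module.Basis (Fin 6) ℂ (complexify hSub) :=
  (Module.Basis.span linearIndependent_tmul_hGen).map (LinearEquiv.ofEq _ _ complexify_hSub.symm)

lemma hBasis_apply (j : Fin 6) : (hBasis j : ℂ ⊗[ℝ] G614) = 1 ⊗ₜ[ℝ] hGen j := by
  change ((Module.Basis.span linearIndependent_tmul_hGen j : _) : ℂ ⊗[ℝ] G614) = _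
  rw [Module.Basis.span_apply]

lemma one_tmul_lie (h x y : G614) : ⁅(1 : ℂ) ⊗ₜ[ℝ] h, (1 : ℂ) ⊗ₜ[ℝ] x + Complex.I ⊗ₜ[ℝ] y⁆ =
    (1 : ℂ) ⊗ₜ[ℝ] ⁅h, x⁆ + Complex.I ⊗ₜ[ℝ] ⁅h, y⁆ := by
  rw [complex_lie_add, LieAlgebra.ExtendScalars.bracket_tmul,
    LieAlgebra.ExtendScalars.bracket_tmul, one_mul, one_mul]

lemma lie_complexify_hSub (z w : ℂ ⊗[ℝ] G614) (hz : z ∈ complexify hSub)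
    (hw : w ∈ complexify hSub) : ⁅z, w⁆ = 0 := by
  rw [← LieSubalgebra.mem_toSubmodule, complexify_hSub] at hz hw
  obtain ⟨c, rfl⟩ := (Submodule.mem_span_range_iff_exists_fun ℂ).1 hz
  obtain ⟨c', rfl⟩ := (Submodule.mem_span_range_iff_exists_fun ℂ).1 hw
  change LieAlgebra.ad ℂ (ℂ ⊗[ℝ] G614) _ _ = 0
  simp only [map_sum, map_smul, LinearMap.sum_apply, LinearMap.smul_apply]
  refine Finset.sum_eq_zero fun i _ => ?_
  rw [Finset.sum_eq_zero, smul_zero]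
  intro j _
  rw [LieAlgebra.ad_apply, LieAlgebra.ExtendScalars.bracket_tmul, hGen_eq, hGen_eq, hVec_lie,
    TensorProduct.tmul_zero, smul_zero]

lemma hGen_mem_tSub {j : Fin 6} (h4 : j ≠ 4) (h5 : j ≠ 5) : hGen j ∈ tSub := by
  rw [hGen_eq, hVec_mem_tSub_iff]
  simp [h4.symm, h5.symm]

lemma hGen_mem_pSub {j : Fin 6} (h : j = 4 ∨ j = 5) : hGen j ∈ pSub := by
  rcases h with rfl | rfl
  · exact aSub_le_pSub (aBasis_zero ▸ (aBasis 0).2)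
  · exact aSub_le_pSub (aBasis_one ▸ (aBasis 1).2)

/-- Each generator lies in `t` or in `p`, and therefore acts by a skew or a symmetric endomorphism.
-/
lemma hGen_lie_eq_zero (j : Fin 6) {x : G614} (h : ⁅hGen j, ⁅hGen j, x⁆⁆ = 0) :
    ⁅hGen j, x⁆ = 0 := by
  by_cases hj : j = 4 ∨ j = 5
  · refine cartanG.lie_eq_zero_of_lie_lie_eq_zero (c := 1) (by norm_num) ?_ h
    rw [(mem_pSub_iff _).1 (hGen_mem_pSub hj), neg_one_smul]
  · rw [not_or] at hj
    refine cartanG.lie_eq_zero_of_lie_lie_eq_zero (c := -1) (by norm_num) ?_ h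
    rw [(mem_tSub_iff _).1 (hGen_mem_tSub hj.1 hj.2), neg_neg, one_smul]

lemma one_tmul_hGen_mem (j : Fin 6) : (1 : ℂ) ⊗ₜ[ℝ] hGen j ∈ complexify hSub :=
  one_tmul_mem_complexify (hGen_mem_hSub j)

lemma re_add_im_mem_complexify {h : LieSubalgebra ℝ G614} {x y : G614} (hx : x ∈ h) (hy : y ∈ h) :
    (1 : ℂ) ⊗ₜ[ℝ] x + Complex.I ⊗ₜ[ℝ] y ∈ complexify h := by
  have e : Complex.I ⊗ₜ[ℝ] y = Complex.I • ((1 : ℂ) ⊗ₜ[ℝ] y) := by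
    rw [TensorProduct.smul_tmul', smul_eq_mul, mul_one]
  rw [e]
  exact add_mem (one_tmul_mem_complexify hx)
    ((complexify h).smul_mem _ (one_tmul_mem_complexify hy))

/-- If `x + iy` normalises `h^ℂ`, then `[h_j, [h_j, x]] = 0`, because `h^ℂ` is abelian, and the same
holds for `y`. Semisimplicity makes `x` and `y` centralise `h`, so they lie in `h`. -/
instance isCartanSubalgebra_hSub : (complexify hSub).IsCartanSubalgebra where
  nilpotent := by
    have : IsLieAbelian (complexify hSub) :=
      ⟨fun x y => Subtype.ext (lie_complexify_hSub x y x.2 y.2)⟩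
    infer_instance
  self_normalizing := by
    refine le_antisymm (fun z hz => ?_) (LieSubalgebra.le_normalizer _)
    rw [LieSubalgebra.mem_normalizer_iff'] at hz
    obtain ⟨x, y, rfl⟩ := exists_re_add_im z
    have key : ∀ j, ⁅hGen j, x⁆ = 0 ∧ ⁅hGen j, y⁆ = 0 := by
      intro j
      have h1 := lie_complexify_hSub _ _ (one_tmul_hGen_mem j) (hz _ (one_tmul_hGen_mem j))
      rw [one_tmul_lie, one_tmul_lie, re_add_im_eq_zero] at h1
      exact ⟨hGen_lie_eq_zero j h1.1, hGen_lie_eq_zero j h1.2⟩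
    exact re_add_im_mem_complexify (mem_hSub_of_lie_hGen x fun j => (key j).1)
      (mem_hSub_of_lie_hGen y fun j => (key j).2)

end RealForms
end

noncomputable section

namespace RealForms

open SymmetricCompositionAlgebra MagicAlgebra

/-! ### Root vectors of the simple roots -/

/-- The signs in the multiplication table of `p𝕆`. -/
def mulSign : Fin 8 → Fin 8 → ℝ :=
  ![![1, -1, -1, -1, -1, -1, -1, -1],
    ![-1, -1, 1, -1, 1, -1, -1, 1],
    ![-1, -1, -1, 1, 1, 1, -1, -1],
    ![-1, 1, -1, -1, 1, -1, 1, -1],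
    ![-1, -1, -1, -1, -1, 1, 1, 1],
    ![-1, 1, -1, 1, -1, -1, -1, 1],
    ![-1, 1, 1, -1, -1, 1, -1, -1],
    ![-1, -1, 1, 1, -1, -1, 1, -1]]

/-- The indices in the multiplication table of `p𝕆`. -/
def mulIndex : Fin 8 → Fin 8 → Fin 8 :=
  ![![0, 1, 2, 3, 4, 5, 6, 7],
    ![1, 0, 3, 2, 5, 4, 7, 6],
    ![2, 3, 0, 1, 6, 7, 4, 5],
    ![3, 2, 1, 0, 7, 6, 5, 4],
    ![4, 5, 6, 7, 0, 1, 2, 3],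
    ![5, 4, 7, 6, 1, 0, 3, 2],
    ![6, 7, 4, 5, 2, 3, 0, 1],
    ![7, 6, 5, 4, 3, 2, 1, 0]]

set_option maxHeartbeats 1000000 in
lemma mul_octBasis (i j : Fin 8) :
    pO.mul (octBasis i) (octBasis j) = mulSign i j • octBasis (mulIndex i j) := by
  refine octCoord_injective ?_
  have hs : ∀ (c : ℝ) (x : Octonion), octCoord (c • x) = c • octCoord x := octEquiv.map_smul
  rw [hs]
  simp only [octBasis_eq, pO_mul_mk]
  fin_cases i <;> fin_cases j <;> simp [mulSign, mulIndex, octCoord]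

/-- The real parts of the root vectors of the simple roots. -/
def rootRe : Fin 6 → G614 :=
  ![mkG 0 0 0 0 (octBasis 0) (octBasis 1) (-octBasis 1) (octBasis 0),
    mkG (pO.t (octBasis 0) (octBasis 2)) 0 0 (-octBasis 2) 0 0 0 0,
    mkG (pO.t (octBasis 4) (octBasis 6) + pO.t (octBasis 5) (octBasis 7)) 0 0 0 0 0 0 0,
    mkG (pO.t (octBasis 2) (octBasis 4) + pO.t (octBasis 3) (octBasis 5)) 0 0 0 0 0 0 0,
    mkG (pO.t (octBasis 4) (octBasis 6) - pO.t (octBasis 5) (octBasis 7)) 0 0 0 0 0 0 0,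
    mkG 0 0 0 0 (octBasis 6) (octBasis 7) (-octBasis 7) (-octBasis 6)]

/-- The imaginary parts of the root vectors of the simple roots. -/
def rootIm : Fin 6 → G614 :=
  ![mkG 0 0 0 0 (-octBasis 1) (octBasis 0) (octBasis 0) (octBasis 1),
    mkG (pO.t (octBasis 0) (octBasis 3)) 0 0 (-octBasis 3) 0 0 0 0,
    mkG (pO.t (octBasis 4) (octBasis 7) - pO.t (octBasis 5) (octBasis 6)) 0 0 0 0 0 0 0,
    mkG (pO.t (octBasis 2) (octBasis 5) - pO.t (octBasis 3) (octBasis 4)) 0 0 0 0 0 0 0,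
    mkG (-pO.t (octBasis 4) (octBasis 7) - pO.t (octBasis 5) (octBasis 6)) 0 0 0 0 0 0 0,
    mkG 0 0 0 0 (octBasis 7) (-octBasis 6) (octBasis 6) (-octBasis 7)]

/-- The coordinates of the simple roots: `α_k = ½ (𝐢 (n₀ w₀ + … + n₃ w₃) + n₄ w₄ + n₅ w₅)`. -/
def simpleVec : Fin 6 → Fin 6 → ℤ :=
  ![![-1, -1, -1, -1, -1, 1], ![-2, 0, 0, 0, 2, 0], ![0, 2, 2, 0, 0, 0], ![2, -2, 0, 0, 0, 0],
    ![0, 2, -2, 0, 0, 0], ![-1, -1, 1, 1, -1, 1]]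

/-- The imaginary part of the value of a root on an element of `h`. -/
def imPart (n : Fin 6 → ℤ) (c : Fin 6 → ℝ) : ℝ :=
  2⁻¹ * (n 0 * c 0 + n 1 * c 1 + n 2 * c 2 + n 3 * c 3)

/-- The real part of the value of a root on an element of `h`. -/
def rePart (n : Fin 6 → ℤ) (c : Fin 6 → ℝ) : ℝ := 2⁻¹ * (n 4 * c 4 + n 5 * c 5)

lemma mkG_sub (d e : pO.tri) (d' e' : pC.tri)
    (a₀ b₀ a₁ b₁ a₂ b₂ x₀ y₀ x₁ y₁ x₂ y₂ : Octonion) :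
    mkG d d' a₀ b₀ a₁ b₁ a₂ b₂ - mkG e e' x₀ y₀ x₁ y₁ x₂ y₂ =
      mkG (d - e) (d' - e') (a₀ - x₀) (b₀ - y₀) (a₁ - x₁) (b₁ - y₁) (a₂ - x₂) (b₂ - y₂) := by
  rw [sub_eq_add_neg, mkG_neg, mkG_add]
  simp only [← sub_eq_add_neg]

lemma t_one_basis (i j k : Fin 8) : (pO.t (octBasis i) (octBasis j)).1 1 (octBasis k) =
    (2⁻¹ * if i = j then (2 : ℝ) else 0) • octBasis k -
      (mulSign j k * mulSign (mulIndex j k) i) • octBasis (mulIndex (mulIndex j k) i) := by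
  rw [t_one_apply, pO_q_basis, mul_octBasis, map_smul, LinearMap.smul_apply, mul_octBasis,
    smul_smul]

lemma t_two_basis (i j k : Fin 8) : (pO.t (octBasis i) (octBasis j)).1 2 (octBasis k) =
    (2⁻¹ * if i = j then (2 : ℝ) else 0) • octBasis k -
      (mulSign k j * mulSign i (mulIndex k j)) • octBasis (mulIndex i (mulIndex k j)) := by
  rw [t_two_apply, pO_q_basis, mul_octBasis, map_smul, mul_octBasis, smul_smul]

lemma triLie_sub_right {S : Type*} [AddCommGroup S] [Module ℝ S]
    (A : SymmetricCompositionAlgebra S) (d e f : A.tri) :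
    A.triLie d (e - f) = A.triLie d e - A.triLie d f := by
  apply A.tri_ext <;> intro z <;> simp <;> abel

lemma triLie_neg_right {S : Type*} [AddCommGroup S] [Module ℝ S]
    (A : SymmetricCompositionAlgebra S) (d e : A.tri) :
    A.triLie d (-e) = -A.triLie d e := by
  apply A.tri_ext <;> intro z <;> simp <;> abel

-- Together with `lie_rootIm` this says that `rootRe + 𝐢 rootIm` is an eigenvector of `h` with
-- eigenvalue `rePart + 𝐢 imPart`. Only the six simple roots have to be verified by multiplication
-- in `p𝕆`.
set_option maxHeartbeats 4000000 in
lemma lie_rootRe (c : Fin 6 → ℝ) (i : Fin 6) : ⁅hVec c, rootRe i⁆ =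
    rePart (simpleVec i) c • rootRe i - imPart (simpleVec i) c • rootIm i := by
  have hcoe : ∀ d e : pO.tri, (d + e).1 = d.1 + e.1 := fun _ _ => rfl
  have hcoe' : ∀ (c : ℝ) (e : pO.tri), (c • e).1 = c • e.1 := fun _ _ => rfl
  fin_cases i <;>
    simp only [rootRe, rootIm, hVec, lie_mkG, mkG_smul, mkG_sub, mkG_add, mkG_inj, simpleVec,
      rePart, imPart, Matrix.cons_val, Fin.zero_eta, Fin.mk_one, Fin.reduceFinMk] <;>
    refine ⟨?_, ?_, ?_, ?_, ?_, ?_, ?_, ?_⟩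
  all_goals
    try simp [triLie_add_left, triLie_smul_left, pO.triLie_t, t_zero_basis, t_one_basis,
      t_two_basis, hcoe, hcoe', pO_q_basis, mul_octBasis, mulSign, mulIndex, rot_zC_zero,
      rot_zC_one, rot_zC_two, triLie_add_right, triLie_zero_right, triLie_sub_right,
      triLie_neg_right]
  all_goals module

set_option maxHeartbeats 4000000 in
lemma lie_rootIm (c : Fin 6 → ℝ) (i : Fin 6) : ⁅hVec c, rootIm i⁆ =
    rePart (simpleVec i) c • rootIm i + imPart (simpleVec i) c • rootRe i := by
  have hcoe : ∀ d e : pO.tri, (d + e).1 = d.1 + e.1 := fun _ _ => rfl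
  have hcoe' : ∀ (c : ℝ) (e : pO.tri), (c • e).1 = c • e.1 := fun _ _ => rfl
  fin_cases i <;>
    simp only [rootRe, rootIm, hVec, lie_mkG, mkG_smul, mkG_sub, mkG_add, mkG_inj, simpleVec,
      rePart, imPart, Matrix.cons_val, Fin.zero_eta, Fin.mk_one, Fin.reduceFinMk] <;>
    refine ⟨?_, ?_, ?_, ?_, ?_, ?_, ?_, ?_⟩
  all_goals
    try simp [triLie_add_left, triLie_smul_left, pO.triLie_t, t_zero_basis, t_one_basis,
      t_two_basis, hcoe, hcoe', pO_q_basis, mul_octBasis, mulSign, mulIndex, rot_zC_zero,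
      rot_zC_one, rot_zC_two, triLie_add_right, triLie_zero_right, triLie_sub_right,
      triLie_neg_right]
  all_goals module

lemma rootRe_ne_zero (i : Fin 6) : rootRe i ≠ 0 := by
  intro h
  have hcoe : ∀ d e : pO.tri, (d + e).1 = d.1 + e.1 := fun _ _ => rfl
  have hcoe' : ∀ d e : pO.tri, (d - e).1 = d.1 - e.1 := fun _ _ => rfl
  have key : ∀ d : pO.tri, mkG d 0 0 0 0 0 0 0 = 0 → ∀ z, d.1 0 z = 0 := by
    intro d hd z
    rw [← mkG_zero, mkG_inj] at hd
    rw [hd.1]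
    rfl
  fin_cases i
  · have h' : mkG 0 0 0 0 (octBasis 0) (octBasis 1) (-octBasis 1) (octBasis 0) = 0 := h
    rw [← mkG_zero, mkG_inj] at h'
    exact octBasis_ne_zero 0 h'.2.2.2.2.1
  · have h' : mkG (pO.t (octBasis 0) (octBasis 2)) 0 0 (-octBasis 2) 0 0 0 0 = 0 := h
    rw [← mkG_zero, mkG_inj] at h'
    exact octBasis_ne_zero 2 (neg_eq_zero.1 h'.2.2.2.1)
  · have h1 := key _ h (octBasis 4)
    simp only [hcoe, Pi.add_apply, LinearMap.add_apply, t_zero_basis] at h1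
    simp [octBasis_ne_zero] at h1
  · have h1 := key _ h (octBasis 2)
    simp only [hcoe, Pi.add_apply, LinearMap.add_apply, t_zero_basis] at h1
    simp [octBasis_ne_zero] at h1
  · have h1 := key _ h (octBasis 4)
    simp only [hcoe', Pi.sub_apply, LinearMap.sub_apply, t_zero_basis] at h1
    simp [octBasis_ne_zero] at h1
  · have h' : mkG 0 0 0 0 (octBasis 6) (octBasis 7) (-octBasis 7) (-octBasis 6) = 0 := h
    rw [← mkG_zero, mkG_inj] at h'
    exact octBasis_ne_zero 6 h'.2.2.2.2.1

end RealForms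
end

noncomputable section

namespace RealForms

open SymmetricCompositionAlgebra MagicAlgebra LieAlgebra LieAlgebra.IsKilling

/-! ### The invariant form on the Cartan subalgebra -/

/-- The diagonal entries of the invariant form in the basis `hGen`. -/
def formDiag : Fin 6 → ℝ := ![-1, -1, -1, -1 / 3, 1, 1]

/-- The generators are orthogonal. The square `-1/3` of `h₄` comes from the factor `1/3` in the form
on `tri(pℂ)`, and its inverse is the weight `3` in `dotp`. -/
lemma form_hVec (c d : Fin 6 → ℝ) :
    cartanG.form (hVec c) (hVec d) = ∑ i, formDiag i * (c i * d i) := by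
  have h0 : ∀ i j (e : pO.tri), pOForm.form (pO.t (octBasis i) (octBasis j)) e =
      pO.q (octBasis i) (e.1 0 (octBasis j)) := fun i j e => pOForm.t_left _ _ e
  have hcoe : ∀ d e : pO.tri, (d + e).1 = d.1 + e.1 := fun _ _ => rfl
  have hcoe' : ∀ (c : ℝ) (e : pO.tri), (c • e).1 = c • e.1 := fun _ _ => rfl
  change form _ pOForm pCForm (hVec c) (hVec d) = _
  rw [form_apply]
  have ht : ∀ c, (hVec c).tri = ((1 / 2) * c 0) • pO.t (octBasis 2) (octBasis 3) +
      ((1 / 2) * c 1) • pO.t (octBasis 4) (octBasis 5) +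
      ((1 / 2) * c 2) • pO.t (octBasis 7) (octBasis 6) := fun _ => rfl
  have ht' : ∀ c, (hVec c).tri' = ((1 / 4) * c 3) • zC := fun _ => rfl
  rw [ht, ht, ht', ht']
  change pOForm.form _ _ + pCForm.form _ _ - _ * tensorForm pO pC (pair _) (pair _) -
    _ * tensorForm pO pC (pair _) (pair _) - _ * tensorForm pO pC (pair _) (pair _) = _
  rw [tensorForm_pair, tensorForm_pair, pCForm_apply]
  simp only [map_add, map_smul, LinearMap.add_apply, LinearMap.smul_apply, h0, hcoe, hcoe',
    Pi.add_apply, Pi.smul_apply, t_zero_basis, rot_zC_zero, rot_zC_one, rot_zC_two, smul_eq_mul]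
  simp [pO_q_basis, Fin.sum_univ_six, formDiag]
  ring

lemma form_hGen (i j : Fin 6) :
    cartanG.form (hGen i) (hGen j) = if i = j then formDiag i else 0 := by
  rw [hGen_eq, hGen_eq, form_hVec, Finset.sum_eq_single i]
  · by_cases h : i = j
    · subst h; simp
    · simp [h]
  · intro k _ hk
    simp [hk]
  · simp

/-! ### The functionals with integral coordinates -/

/-- The values on `hBasis` of the functionals spanning the root lattice are integral multiples
of these. -/
def coordUnit : Fin 6 → ℂ :=
  ![Complex.I / 2, Complex.I / 2, Complex.I / 2, Complex.I / 2, 1 / 2, 1 / 2]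

/-- The functional `½ (𝐢 (n₀ w₀ + … + n₃ w₃) + n₄ w₄ + n₅ w₅)`. -/
def fnc : (Fin 6 → ℤ) →+ Module.Dual ℂ (complexify hSub) where
  toFun n := ∑ k, (coordUnit k * n k) • hBasis.coord k
  map_zero' := by simp
  map_add' n m := by
    simp only [Pi.add_apply, Int.cast_add, mul_add, add_smul, Finset.sum_add_distrib]

lemma fnc_apply (n : Fin 6 → ℤ) : fnc n = ∑ k, (coordUnit k * n k) • hBasis.coord k := rfl

@[simp] lemma fnc_hBasis (n : Fin 6 → ℤ) (k : Fin 6) : fnc n (hBasis k) = coordUnit k * n k := by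
  simp [fnc_apply, LinearMap.sum_apply, Finsupp.single_apply]

lemma coordUnit_ne_zero (k : Fin 6) : coordUnit k ≠ 0 := by
  fin_cases k <;> simp [coordUnit]

lemma fnc_injective : Function.Injective fnc := by
  intro n m h
  ext k
  have := LinearMap.congr_fun h (hBasis k)
  rw [fnc_hBasis, fnc_hBasis] at this
  exact_mod_cast mul_left_cancel₀ (coordUnit_ne_zero k) this

lemma fnc_simpleVec (i : Fin 6) : fnc (simpleVec i) = simpleRoots hBasis.coord i := by
  rw [fnc_apply, Fin.sum_univ_six]
  fin_cases i <;> simp [simpleVec, simpleRoots, coordUnit] <;> module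

/-! ### Root vectors of the simple roots -/

/-- The root vector of the `i`-th simple root. -/
def rootVec (i : Fin 6) : ℂ ⊗[ℝ] G614 := (1 : ℂ) ⊗ₜ[ℝ] rootRe i + Complex.I ⊗ₜ[ℝ] rootIm i

lemma rootVec_ne_zero (i : Fin 6) : rootVec i ≠ 0 := fun h =>
  rootRe_ne_zero i (re_add_im_eq_zero.1 h).1

lemma lie_hBasis_rootVec (i j : Fin 6) :
    ⁅(hBasis j : ℂ ⊗[ℝ] G614), rootVec i⁆ = fnc (simpleVec i) (hBasis j) • rootVec i := by
  have e : fnc (simpleVec i) (hBasis j) = ⟨rePart (simpleVec i) (Pi.single j 1),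
      imPart (simpleVec i) (Pi.single j 1)⟩ := by
    rw [fnc_hBasis]
    apply Complex.ext <;> fin_cases j <;>
      simp [coordUnit, rePart, imPart]
  rw [hBasis_apply, rootVec, one_tmul_lie, hGen_eq, lie_rootRe, lie_rootIm, e, smul_re_add_im]
  congr 2
  exact add_comm _ _

lemma lie_rootVec (i : Fin 6) (h : complexify hSub) :
    ⁅(h : ℂ ⊗[ℝ] G614), rootVec i⁆ = fnc (simpleVec i) h • rootVec i := by
  let A : complexify hSub →ₗ[ℂ] ℂ ⊗[ℝ] G614 :=
    { toFun := fun h => ⁅(h : ℂ ⊗[ℝ] G614), rootVec i⁆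
      map_add' := fun x y => add_lie _ _ _
      map_smul' := fun c x => smul_lie _ _ _ }
  have key : A = (fnc (simpleVec i)).smulRight (rootVec i) :=
    hBasis.ext fun j => lie_hBasis_rootVec i j
  exact LinearMap.congr_fun key h

/-- A joint eigenvector lies in the weight space of its eigenvalue, so the functional is a weight;
roots are the nonzero weights. -/
lemma mem_range_root_of_eigenvector {f : Module.Dual ℂ (complexify hSub)} (hf : f ≠ 0)
    {z : ℂ ⊗[ℝ] G614} (hz : z ≠ 0)
    (h : ∀ x : complexify hSub, ⁅(x : ℂ ⊗[ℝ] G614), z⁆ = f x • z) :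
    f ∈ Set.range (rootSystem (complexify hSub)).root := by
  have hm : z ∈ rootSpace (complexify hSub) f :=
    LieModule.weightSpace_le_genWeightSpace _ _ ((LieModule.mem_weightSpace _ _).2 h)
  let α : LieModule.Weight ℂ (complexify hSub) (ℂ ⊗[ℝ] G614) :=
    ⟨f, fun hb => hz ((LieSubmodule.eq_bot_iff _).1 hb z hm)⟩
  have hα : α.IsNonZero := fun h0 => hf (by ext x; exact congrFun h0 _)
  refine ⟨⟨α, by simpa using hα⟩, ?_⟩
  rw [rootSystem_root_apply]
  rfl

lemma simpleVec_ne_zero (i : Fin 6) : simpleVec i ≠ 0 := by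
  revert i; decide

lemma fnc_eq_zero {n : Fin 6 → ℤ} : fnc n = 0 ↔ n = 0 := map_eq_zero_iff fnc fnc_injective

lemma fnc_simpleVec_mem (i : Fin 6) :
    fnc (simpleVec i) ∈ Set.range (rootSystem (complexify hSub)).root :=
  mem_range_root_of_eigenvector (mt fnc_eq_zero.1 (simpleVec_ne_zero i)) (rootVec_ne_zero i)
    (lie_rootVec i)

/-! ### Coroots -/

/-- The bilinear form on the root lattice; roots have norm `8`. -/
def dotp (n m : Fin 6 → ℤ) : ℤ :=
  n 0 * m 0 + n 1 * m 1 + n 2 * m 2 + 3 * (n 3 * m 3) + n 4 * m 4 + n 5 * m 5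

lemma form_hBasis (h : complexify hSub) (j : Fin 6) :
    cartanG.form.baseChange ℂ (h : ℂ ⊗[ℝ] G614) (hBasis j) = formDiag j * hBasis.coord j h := by
  have key : (cartanG.form.baseChange ℂ).flip (hBasis j) ∘ₗ
      (complexify hSub).toSubmodule.subtype = (formDiag j : ℂ) • hBasis.coord j := by
    refine hBasis.ext fun i => ?_
    change cartanG.form.baseChange ℂ (hBasis i : ℂ ⊗[ℝ] G614) (hBasis j) =
      formDiag j * hBasis.coord j (hBasis i)
    rw [hBasis_apply, hBasis_apply, LinearMap.BilinForm.baseChange_tmul, form_hGen]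
    by_cases hij : i = j
    · subst hij; simp
    · simp [hij]
  exact LinearMap.congr_fun key h

/-- The coroot is `[e, f]` for an `sl₂`-triple, and invariance gives `B([e, f], h_j) = B(e, f)
α(h_j)`. Since `B` is diagonal on `h`, this determines the coroot up to the scalar `c = B(e, f)`.
Any invariant form would do, so the Killing form is not needed. -/
lemma fnc_coroot {α : LieModule.Weight ℂ (complexify hSub) (ℂ ⊗[ℝ] G614)} {n : Fin 6 → ℤ}
    (hα : α.toLinear = fnc n) (hn : dotp n n = 8) (m : Fin 6 → ℤ) :
    fnc m (coroot α) = (dotp m n : ℂ) / 4 := by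
  have hn0 : n ≠ 0 := by rintro rfl; simp [dotp] at hn
  have hnz : α.IsNonZero := fun h0 => hn0 (fnc_eq_zero.1 (by
    rw [← hα]; ext x; exact congrFun h0 _))
  obtain ⟨h, e, f, ht, he, hf⟩ := exists_isSl2Triple_of_weight_isNonZero hnz
  have hh := ht.h_eq_coroot hnz he hf
  set c := cartanG.form.baseChange ℂ e f with hc
  have hv : ∀ x, α x = fnc n x := fun x => by rw [← hα]; rfl
  have h1 : ∀ j, formDiag j * hBasis.coord j (coroot α) = c * (coordUnit j * n j) := by
    intro j
    rw [← form_hBasis, ← hh, ← ht.lie_e_f, cartanG.baseChange_form_lie]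
    have h2 : ⁅(hBasis j : ℂ ⊗[ℝ] G614), f⁆ = (-α) (hBasis j) • f :=
      lie_eq_smul_of_mem_rootSpace hf (hBasis j)
    have h3 : ⁅f, (hBasis j : ℂ ⊗[ℝ] G614)⁆ = (coordUnit j * n j) • f := by
      rw [← lie_skew, h2, ← neg_smul]
      congr 1
      rw [← fnc_hBasis, ← hv]
      simp
    rw [h3, map_smul, smul_eq_mul, mul_comm]
  have hsum : ∀ m : Fin 6 → ℤ, fnc m (coroot α) = c * ((dotp m n : ℂ) / 4) := by
    intro m
    have hI := Complex.I_mul_I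
    have e0 := h1 0
    have e1 := h1 1
    have e2 := h1 2
    have e3 := h1 3
    have e4 := h1 4
    have e5 := h1 5
    simp only [formDiag, coordUnit, Matrix.cons_val] at e0 e1 e2 e3 e4 e5
    rw [fnc_apply, Fin.sum_univ_six]
    simp only [LinearMap.add_apply, LinearMap.smul_apply, smul_eq_mul, coordUnit, Matrix.cons_val,
      dotp]
    push_cast at e0 e1 e2 e3 e4 e5 ⊢
    linear_combination (-Complex.I / 2 * m 0) * e0 + (-Complex.I / 2 * m 1) * e1 +
      (-Complex.I / 2 * m 2) * e2 + (-3 * Complex.I / 2 * m 3) * e3 + (1 / 2 * m 4) * e4 +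
      (1 / 2 * m 5) * e5 - c / 4 * (m 0 * n 0 + m 1 * n 1 + m 2 * n 2 + 3 * m 3 * n 3) * hI
  -- The normalisation `α(α^∨) = 2` against `dotp n n / 4 = 2`.
  have h2 : c = 1 := by
    have := root_apply_coroot hnz
    rw [hv, hsum, hn] at this
    push_cast at this
    linear_combination this / 2
  rw [hsum, h2, one_mul]

end RealForms
end

noncomputable section

namespace RealForms

open SymmetricCompositionAlgebra MagicAlgebra LieAlgebra LieAlgebra.IsKilling

/-! ### The positive roots of `E₆` -/

/-- The coefficients of the positive roots with respect to the simple roots, by increasing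
height. -/
def posCoeff : Fin 36 → Fin 6 → ℤ :=
  ![![1, 0, 0, 0, 0, 0], ![0, 1, 0, 0, 0, 0], ![0, 0, 1, 0, 0, 0], ![0, 0, 0, 1, 0, 0],
    ![0, 0, 0, 0, 1, 0], ![0, 0, 0, 0, 0, 1], ![1, 0, 1, 0, 0, 0], ![0, 1, 0, 1, 0, 0],
    ![0, 0, 1, 1, 0, 0], ![0, 0, 0, 1, 1, 0], ![0, 0, 0, 0, 1, 1], ![1, 0, 1, 1, 0, 0],
    ![0, 1, 1, 1, 0, 0], ![0, 1, 0, 1, 1, 0], ![0, 0, 1, 1, 1, 0], ![0, 0, 0, 1, 1, 1],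
    ![1, 1, 1, 1, 0, 0], ![1, 0, 1, 1, 1, 0], ![0, 1, 1, 1, 1, 0], ![0, 1, 0, 1, 1, 1],
    ![0, 0, 1, 1, 1, 1], ![1, 1, 1, 1, 1, 0], ![1, 0, 1, 1, 1, 1], ![0, 1, 1, 2, 1, 0],
    ![0, 1, 1, 1, 1, 1], ![1, 1, 1, 2, 1, 0], ![1, 1, 1, 1, 1, 1], ![0, 1, 1, 2, 1, 1],
    ![1, 1, 2, 2, 1, 0], ![1, 1, 1, 2, 1, 1], ![0, 1, 1, 2, 2, 1], ![1, 1, 2, 2, 1, 1],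
    ![1, 1, 1, 2, 2, 1], ![1, 1, 2, 2, 2, 1], ![1, 1, 2, 3, 2, 1], ![1, 2, 2, 3, 2, 1]]

/-- The combination of the simple roots with coefficients `c`. -/
def simpleSum (c : Fin 6 → ℤ) : Fin 6 → ℤ := fun k =>
  c 0 * simpleVec 0 k + c 1 * simpleVec 1 k + c 2 * simpleVec 2 k + c 3 * simpleVec 3 k +
    c 4 * simpleVec 4 k + c 5 * simpleVec 5 k

/-- The sign given by a truth value. -/
def sg (b : Bool) : ℤ := cond b 1 (-1)

/-- The coordinates of the roots. -/
def rootCoord (p : Bool × Fin 36) : Fin 6 → ℤ := fun k => sg p.1 * simpleSum (posCoeff p.2) k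

/-- Every listed root that is not simple is the reflection, in some simple root `α_i`, of an earlier
one. The two differ only in the coefficient at `i`, by the pairing, which is `dotp / 4`. -/
lemma exists_reflection_posCoeff (k : Fin 36) : (∃ i, simpleSum (posCoeff k) = simpleVec i) ∨
    ∃ l < k, ∃ i, 4 * (posCoeff l i - posCoeff k i) = dotp (simpleSum (posCoeff l)) (simpleVec i) ∧
      simpleSum (posCoeff k) = fun m => simpleSum (posCoeff l) m -
        (posCoeff l i - posCoeff k i) * simpleVec i m := by
  revert k
  decide +kernel

lemma rootCoord_injective : Function.Injective rootCoord := by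
  have h : ∀ p q, rootCoord p = rootCoord q → p = q := by decide +kernel
  exact fun p q => h p q

/-- The index of one of the first three coordinates. -/
def lowIndex : Fin 3 → Fin 6 := ![0, 1, 2]

/-- The index of one of the last two coordinates. -/
def highIndex : Fin 2 → Fin 6 := ![4, 5]

/-- The coordinates of the roots `±𝐢w_k ± w_m`. -/
def mixedCoord (k : Fin 3) (m : Fin 2) (s t : Bool) : Fin 6 → ℤ := fun j =>
  (if j = lowIndex k then 2 * sg s else 0) + if j = highIndex m then 2 * sg t else 0

/-- The coordinates of the roots `𝐢(±w_k ± w_m)`. -/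
def lowCoord (k m : Fin 3) (s t : Bool) : Fin 6 → ℤ := fun j =>
  (if j = lowIndex k then 2 * sg s else 0) + if j = lowIndex m then 2 * sg t else 0

/-- The coordinates of the roots `±w₅ ± w₆`. -/
def highCoord (s t : Bool) : Fin 6 → ℤ := ![0, 0, 0, 0, 2 * sg s, 2 * sg t]

lemma exists_mixedCoord (k : Fin 3) (m : Fin 2) (s t : Bool) :
    ∃ p, mixedCoord k m s t = rootCoord p := by
  revert k m s t
  decide +kernel

lemma exists_lowCoord (k m : Fin 3) (h : k < m) (s t : Bool) :
    ∃ p, lowCoord k m s t = rootCoord p := by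
  revert k m s t
  decide +kernel

lemma exists_highCoord (s t : Bool) : ∃ p, highCoord s t = rootCoord p := by
  revert s t
  decide +kernel

lemma exists_spinCoord (a b c d e f : Bool)
    (h : sg a * sg b * sg c * sg d * sg e * sg f = -1) :
    ∃ p, ![sg a, sg b, sg c, sg d, sg e, sg f] = rootCoord p := by
  revert a b c d e f
  decide +kernel

lemma rootCoord_cases (p : Bool × Fin 36) :
    (∃ k m s t, rootCoord p = mixedCoord k m s t) ∨
    (∃ k m, k < m ∧ ∃ s t, rootCoord p = lowCoord k m s t) ∨
    (∃ s t, rootCoord p = highCoord s t) ∨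
    ∃ a b c d e f, sg a * sg b * sg c * sg d * sg e * sg f = -1 ∧
      rootCoord p = ![sg a, sg b, sg c, sg d, sg e, sg f] := by
  revert p
  decide +kernel

end RealForms
end

noncomputable section

namespace RealForms

open SymmetricCompositionAlgebra MagicAlgebra LieAlgebra LieAlgebra.IsKilling

/-! ### The root system -/

/-- The roots are stable under reflections, and the coroot formula expresses the multiple to be
subtracted in integral coordinates. -/
lemma fnc_reflection_mem {m n : Fin 6 → ℤ} (hn : dotp n n = 8)
    (hnr : fnc n ∈ Set.range (rootSystem (complexify hSub)).root)
    (hmr : fnc m ∈ Set.range (rootSystem (complexify hSub)).root) {k : ℤ}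
    (hk : 4 * k = dotp m n) :
    fnc (fun j => m j - k * n j) ∈ Set.range (rootSystem (complexify hSub)).root := by
  obtain ⟨α, hα⟩ := hnr
  obtain ⟨β, hβ⟩ := hmr
  refine ⟨(rootSystem (complexify hSub)).reflectionPerm α β, ?_⟩
  rw [RootPairing.root_reflectionPerm, RootPairing.reflection_apply, hα, hβ]
  have e : (rootSystem (complexify hSub)).coroot' α (fnc m) = k := by
    change fnc m (coroot α.1) = k
    rw [fnc_coroot hα hn, ← hk]
    push_cast
    ring
  rw [e, Int.cast_smul_eq_zsmul, ← map_zsmul, ← map_sub]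
  congr 1

lemma fnc_neg_mem {m : Fin 6 → ℤ} (h : fnc m ∈ Set.range (rootSystem (complexify hSub)).root) :
    fnc (-m) ∈ Set.range (rootSystem (complexify hSub)).root := by
  obtain ⟨α, hα⟩ := h
  refine ⟨(rootSystem (complexify hSub)).reflectionPerm α α, ?_⟩
  rw [RootPairing.root_reflectionPerm, RootPairing.reflection_apply_self, hα, map_neg]

lemma dotp_simpleVec (i : Fin 6) : dotp (simpleVec i) (simpleVec i) = 8 := by
  revert i
  decide

/-- Induction along the list: the simple roots have explicit eigenvectors, and each further root is
a simple reflection of an earlier one. -/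
lemma fnc_simpleSum_posCoeff_mem (k : Fin 36) : fnc (simpleSum (posCoeff k)) ∈
    Set.range (rootSystem (complexify hSub)).root := by
  induction k using WellFoundedLT.induction with
  | ind k ih =>
    rcases exists_reflection_posCoeff k with ⟨i, hi⟩ | ⟨l, hl, i, h1, h2⟩
    · rw [hi]
      exact fnc_simpleVec_mem i
    · rw [h2]
      exact fnc_reflection_mem (dotp_simpleVec i) (fnc_simpleVec_mem i) (ih l hl) h1

lemma fnc_rootCoord_mem (p : Bool × Fin 36) :
    fnc (rootCoord p) ∈ Set.range (rootSystem (complexify hSub)).root := by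
  obtain ⟨b, k⟩ := p
  cases b
  · have h := fnc_neg_mem (fnc_simpleSum_posCoeff_mem k)
    convert h using 2
    ext j
    simp [rootCoord, sg]
  · have h := fnc_simpleSum_posCoeff_mem k
    convert h using 2
    ext j
    simp [rootCoord, sg]

lemma finrank_complexify_hSub : Module.finrank ℂ (complexify hSub) = 6 := by
  rw [Module.finrank_eq_card_basis hBasis, Fintype.card_fin]

instance nontrivial_complexification : Nontrivial (ℂ ⊗[ℝ] G614) :=
  ⟨rootVec 0, 0, rootVec_ne_zero 0⟩

open Classical in
lemma isInternal_rootSpaces : DirectSum.IsInternal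
    fun w : LieModule.Weight ℂ (complexify hSub) (ℂ ⊗[ℝ] G614) =>
      (rootSpace (complexify hSub) w).toSubmodule := by
  refine DirectSum.isInternal_submodule_of_iSupIndep_of_iSup_eq_top ?_ ?_
  · exact LieSubmodule.iSupIndep_toSubmodule.2 (LieModule.iSupIndep_genWeightSpace' _ _ _)
  · rw [← LieSubmodule.iSup_toSubmodule, LieModule.iSup_genWeightSpace_eq_top',
      LieSubmodule.top_toSubmodule]

/-- The index type of a basis adapted to the decomposition into root spaces. -/
abbrev WeightIndex : Type := Σ w : LieModule.Weight ℂ (complexify hSub) (ℂ ⊗[ℝ] G614),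
  Fin (Module.finrank ℂ (rootSpace (complexify hSub) w).toSubmodule)

/-- A basis adapted to the decomposition into root spaces. -/
def weightBasis : Module.Basis WeightIndex ℂ (ℂ ⊗[ℝ] G614) :=
  open Classical in
  isInternal_rootSpaces.collectedBasis fun _ => Module.finBasis ℂ _

lemma weightBasis_mem (x : WeightIndex) :
    weightBasis x ∈ rootSpace (complexify hSub) x.1 :=
  open Classical in
  isInternal_rootSpaces.collectedBasis_mem (fun _ => Module.finBasis ℂ _) x

lemma lie_weightBasis (x : WeightIndex) (h : complexify hSub) :
    ⁅(h : ℂ ⊗[ℝ] G614), weightBasis x⁆ = x.1 h • weightBasis x :=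
  lie_eq_smul_of_mem_rootSpace (weightBasis_mem x) h

/-- In the decomposition of the 78-dimensional algebra the zero weight space is `h^ℂ`, of dimension
6, and every other weight space is a line. -/
lemma card_root : Fintype.card (complexify hSub).root = 72 := by
  classical
  have h1 := Module.finrank_eq_card_basis weightBasis
  rw [Module.finrank_baseChange, finrank_G614, Fintype.card_sigma] at h1
  simp only [Fintype.card_fin] at h1
  have h0 : Module.finrank ℂ (rootSpace (complexify hSub)
      (0 : LieModule.Weight ℂ (complexify hSub) (ℂ ⊗[ℝ] G614))).toSubmodule = 6 := by
    have e : (rootSpace (complexify hSub)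
      (0 : LieModule.Weight ℂ (complexify hSub) (ℂ ⊗[ℝ] G614))).toSubmodule =
        (complexify hSub).toSubmodule := by
      rw [FunLike.coe_zero, rootSpace_zero_eq, LieSubalgebra.coe_toLieSubmodule]
    rw [e]
    exact finrank_complexify_hSub
  rw [← Finset.add_sum_erase _ _ (Finset.mem_univ 0), h0, Finset.sum_congr rfl (g := fun _ => 1),
    Finset.sum_const, smul_eq_mul, mul_one] at h1
  · rw [Fintype.card_coe]
    have e : (complexify hSub).root = Finset.univ.erase 0 := by
      ext w
      simp [LieModule.Weight.isNonZero_iff_ne_zero]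
    rw [e]
    omega
  · intro w hw
    refine finrank_rootSpace_eq_one w fun h => ?_
    exact (Finset.mem_erase.1 hw).1 (LieModule.Weight.isZero_iff_eq_zero.1 h)

/-- The 72 functionals already known to be roots are distinct, and there are only 72 roots. -/
lemma range_root : Set.range (rootSystem (complexify hSub)).root =
    Set.range fun p => fnc (rootCoord p) := by
  symm
  refine Set.eq_of_subset_of_ncard_le (Set.range_subset_iff.2 fnc_rootCoord_mem) ?_
    (Set.finite_range _)
  have h := Set.ncard_range_of_injective (fnc_injective.comp rootCoord_injective)
  rw [Function.comp_def] at h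
  rw [h, Set.ncard_range_of_injective (rootSystem (complexify hSub)).root.injective,
    Nat.card_eq_fintype_card, card_root]
  simp

end RealForms
end

noncomputable section

namespace RealForms

open SymmetricCompositionAlgebra MagicAlgebra LieAlgebra LieAlgebra.IsKilling

/-! ### The explicit list of roots -/

lemma exists_sg {s : ℂ} (hs : s ∈ signs) : ∃ b, s = (sg b : ℂ) := by
  rcases hs with rfl | rfl
  · exact ⟨true, by simp [sg]⟩
  · exact ⟨false, by simp [sg]⟩

lemma sg_mem (b : Bool) : (sg b : ℂ) ∈ signs := by
  cases b <;> simp [sg, signs]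

section

variable {V : Type*} [AddCommGroup V] [Module ℂ V] (w : Fin 6 → V)

/-- The functional `±𝐢w_k ± w_m`. -/
def mixedForm (k : Fin 3) (m : Fin 2) (s t : Bool) : V :=
  ((sg s : ℂ) * Complex.I) • w (lowIndex k) + (sg t : ℂ) • w (highIndex m)

/-- The functional `𝐢(±w_k ± w_m)`. -/
def lowForm (k m : Fin 3) (s t : Bool) : V :=
  ((sg s : ℂ) * Complex.I) • w (lowIndex k) + ((sg t : ℂ) * Complex.I) • w (lowIndex m)

/-- The functional `±w₅ ± w₆`. -/
def highForm (s t : Bool) : V := (sg s : ℂ) • w 4 + (sg t : ℂ) • w 5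

/-- The functional `½(𝐢(±w₁ ± w₂ ± w₃ ± w₄) ± w₅ ± w₆)`. -/
def spinForm (a b c d e f : Bool) : V :=
  (1 / 2 : ℂ) • (Complex.I • ((sg a : ℂ) • w 0 + (sg b : ℂ) • w 1 + (sg c : ℂ) • w 2 +
    (sg d : ℂ) • w 3) + (sg e : ℂ) • w 4 + (sg f : ℂ) • w 5)

lemma exists_lowIndex {k : Fin 6} (hk : k ∈ ({0, 1, 2} : Set (Fin 6))) : ∃ i, k = lowIndex i := by
  rcases hk with rfl | rfl | rfl
  exacts [⟨0, rfl⟩, ⟨1, rfl⟩, ⟨2, rfl⟩]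

lemma exists_highIndex {k : Fin 6} (hk : k ∈ ({4, 5} : Set (Fin 6))) : ∃ i, k = highIndex i := by
  rcases hk with rfl | rfl
  exacts [⟨0, rfl⟩, ⟨1, rfl⟩]

lemma lowIndex_mem (i : Fin 3) : lowIndex i ∈ ({0, 1, 2} : Set (Fin 6)) := by
  fin_cases i <;> simp [lowIndex]

lemma highIndex_mem (i : Fin 2) : highIndex i ∈ ({4, 5} : Set (Fin 6)) := by
  fin_cases i <;> simp [highIndex]

lemma lowIndex_lt_iff (i j : Fin 3) : lowIndex i < lowIndex j ↔ i < j := by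
  revert i j
  decide

lemma mem_rootList_cases {f : V} (hf : f ∈ rootList w) :
    (∃ k m s t, f = mixedForm w k m s t) ∨ (∃ k m, k < m ∧ ∃ s t, f = lowForm w k m s t) ∨
    (∃ s t, f = highForm w s t) ∨
    ∃ a b c d e f', sg a * sg b * sg c * sg d * sg e * sg f' = -1 ∧
      f = spinForm w a b c d e f' := by
  rcases hf with ((⟨k, hk, m, hm, s, hs, t, ht, rfl⟩ | ⟨k, hk, m, hm, hkm, s, hs, t, ht, rfl⟩) |
    ⟨s, hs, t, ht, rfl⟩) | ⟨s, hs, hprod, rfl⟩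
  · obtain ⟨i, rfl⟩ := exists_lowIndex hk
    obtain ⟨j, rfl⟩ := exists_highIndex hm
    obtain ⟨b, rfl⟩ := exists_sg hs
    obtain ⟨b', rfl⟩ := exists_sg ht
    exact Or.inl ⟨i, j, b, b', rfl⟩
  · obtain ⟨i, rfl⟩ := exists_lowIndex hk
    obtain ⟨j, rfl⟩ := exists_lowIndex hm
    obtain ⟨b, rfl⟩ := exists_sg hs
    obtain ⟨b', rfl⟩ := exists_sg ht
    exact Or.inr (Or.inl ⟨i, j, (lowIndex_lt_iff i j).1 hkm, b, b', rfl⟩)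
  · obtain ⟨b, rfl⟩ := exists_sg hs
    obtain ⟨b', rfl⟩ := exists_sg ht
    exact Or.inr (Or.inr (Or.inl ⟨b, b', rfl⟩))
  · choose b hb using fun j => exists_sg (hs j)
    obtain rfl : s = fun j => (sg (b j) : ℂ) := funext hb
    rw [Fin.prod_univ_six] at hprod
    exact Or.inr (Or.inr (Or.inr ⟨b 0, b 1, b 2, b 3, b 4, b 5, by exact_mod_cast hprod, rfl⟩))

lemma mixedForm_mem_rootList (k : Fin 3) (m : Fin 2) (s t : Bool) :
    mixedForm w k m s t ∈ rootList w :=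
  Or.inl (Or.inl (Or.inl ⟨lowIndex k, lowIndex_mem k, highIndex m, highIndex_mem m, sg s, sg_mem s,
    sg t, sg_mem t, rfl⟩))

lemma lowForm_mem_rootList {k m : Fin 3} (h : k < m) (s t : Bool) :
    lowForm w k m s t ∈ rootList w :=
  Or.inl (Or.inl (Or.inr ⟨lowIndex k, lowIndex_mem k, lowIndex m, lowIndex_mem m,
    (lowIndex_lt_iff k m).2 h, sg s, sg_mem s, sg t, sg_mem t, rfl⟩))

lemma highForm_mem_rootList (s t : Bool) : highForm w s t ∈ rootList w :=
  Or.inl (Or.inr ⟨sg s, sg_mem s, sg t, sg_mem t, rfl⟩)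

lemma spinForm_mem_rootList {a b c d e f : Bool}
    (h : sg a * sg b * sg c * sg d * sg e * sg f = -1) : spinForm w a b c d e f ∈ rootList w := by
  refine Or.inr ⟨![(sg a : ℂ), sg b, sg c, sg d, sg e, sg f], ?_, ?_, rfl⟩
  · intro j
    fin_cases j <;> exact sg_mem _
  · rw [Fin.prod_univ_six]
    change (sg a : ℂ) * sg b * sg c * sg d * sg e * sg f = -1
    exact_mod_cast h

end

lemma fnc_mixedCoord (k : Fin 3) (m : Fin 2) (s t : Bool) :
    fnc (mixedCoord k m s t) = mixedForm hBasis.coord k m s t := by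
  rw [fnc_apply, Fin.sum_univ_six, mixedForm]
  fin_cases k <;> fin_cases m <;> simp [mixedCoord, lowIndex, highIndex, coordUnit] <;> module

lemma fnc_lowCoord {k m : Fin 3} (h : k < m) (s t : Bool) :
    fnc (lowCoord k m s t) = lowForm hBasis.coord k m s t := by
  rw [fnc_apply, Fin.sum_univ_six, lowForm]
  fin_cases k <;> fin_cases m <;> first | exact absurd h (by decide) | skip
  all_goals
    simp [lowCoord, lowIndex, coordUnit]
    module

lemma fnc_highCoord (s t : Bool) : fnc (highCoord s t) = highForm hBasis.coord s t := by
  rw [fnc_apply, Fin.sum_univ_six, highForm]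
  simp [highCoord, coordUnit]

lemma fnc_spinCoord (a b c d e f : Bool) :
    fnc ![sg a, sg b, sg c, sg d, sg e, sg f] = spinForm hBasis.coord a b c d e f := by
  rw [fnc_apply, Fin.sum_univ_six, spinForm]
  simp [coordUnit]
  module

lemma exists_of_mem_rootList {f : Module.Dual ℂ (complexify hSub)}
    (hf : f ∈ rootList hBasis.coord) : ∃ p, fnc (rootCoord p) = f := by
  rcases mem_rootList_cases _ hf with ⟨k, m, s, t, rfl⟩ | ⟨k, m, hkm, s, t, rfl⟩ | ⟨s, t, rfl⟩ |
    ⟨a, b, c, d, e, f, hprod, rfl⟩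
  · obtain ⟨p, hp⟩ := exists_mixedCoord k m s t
    exact ⟨p, by rw [← hp, fnc_mixedCoord]⟩
  · obtain ⟨p, hp⟩ := exists_lowCoord k m hkm s t
    exact ⟨p, by rw [← hp, fnc_lowCoord hkm]⟩
  · obtain ⟨p, hp⟩ := exists_highCoord s t
    exact ⟨p, by rw [← hp, fnc_highCoord]⟩
  · obtain ⟨p, hp⟩ := exists_spinCoord a b c d e f hprod
    exact ⟨p, by rw [← hp, fnc_spinCoord]⟩

lemma fnc_rootCoord_mem_rootList (p : Bool × Fin 36) :
    fnc (rootCoord p) ∈ rootList hBasis.coord := by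
  rcases rootCoord_cases p with ⟨k, m, s, t, h⟩ | ⟨k, m, hkm, s, t, h⟩ | ⟨s, t, h⟩ |
    ⟨a, b, c, d, e, f, hprod, h⟩ <;> rw [h]
  · rw [fnc_mixedCoord]
    exact mixedForm_mem_rootList _ k m s t
  · rw [fnc_lowCoord hkm]
    exact lowForm_mem_rootList _ hkm s t
  · rw [fnc_highCoord]
    exact highForm_mem_rootList _ s t
  · rw [fnc_spinCoord]
    exact spinForm_mem_rootList _ hprod

lemma rootList_eq : rootList hBasis.coord = Set.range fun p => fnc (rootCoord p) :=
  Set.Subset.antisymm (fun _ hf => exists_of_mem_rootList hf)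
    (Set.range_subset_iff.2 fnc_rootCoord_mem_rootList)

lemma range_root_eq_rootList :
    Set.range (rootSystem (complexify hSub)).root = rootList hBasis.coord := by
  rw [range_root, rootList_eq]

/-! ### The simple roots -/

/-- The simple roots, as elements of the index type of the root system. -/
def simpleIndex (i : Fin 6) : (complexify hSub).root := (fnc_simpleVec_mem i).choose

lemma root_simpleIndex (i : Fin 6) :
    (rootSystem (complexify hSub)).root (simpleIndex i) = fnc (simpleVec i) :=
  (fnc_simpleVec_mem i).choose_spec

lemma simpleIndex_toLinear (i : Fin 6) : LieModule.Weight.toLinear _ _ _ (simpleIndex i).1 = fnc (simpleVec i) := by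
  rw [← root_simpleIndex, rootSystem_root_apply]

lemma simpleVec_injective : Function.Injective simpleVec := by
  have h : ∀ i j, simpleVec i = simpleVec j → i = j := by decide
  exact fun i j => h i j

lemma simpleIndex_injective : Function.Injective simpleIndex := fun i j h => by
  have := root_simpleIndex i
  rw [h, root_simpleIndex] at this
  exact (simpleVec_injective (fnc_injective this)).symm

lemma coroot'_simpleIndex (i : Fin 6) (m : Fin 6 → ℤ) :
    fnc m (coroot (simpleIndex i).1) = (dotp m (simpleVec i) : ℂ) / 4 :=
  fnc_coroot (simpleIndex_toLinear i) (dotp_simpleVec i) m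

lemma dotp_simpleVec_eq (i j : Fin 6) :
    dotp (simpleVec i) (simpleVec j) = 4 * CartanMatrix.E₆ i j := by
  revert i j
  decide

lemma pairing_simpleIndex (i j : Fin 6) :
    (rootSystem (complexify hSub)).pairing (simpleIndex i) (simpleIndex j) =
      CartanMatrix.E₆ i j := by
  change LieModule.Weight.toLinear _ _ _ (simpleIndex i).1 (coroot (simpleIndex j).1) = _
  rw [simpleIndex_toLinear, coroot'_simpleIndex, dotp_simpleVec_eq]
  push_cast
  ring

lemma fnc_simpleSum (c : Fin 6 → ℤ) : fnc (simpleSum c) = ∑ i, c i • fnc (simpleVec i) := by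
  have e : simpleSum c = ∑ i, c i • simpleVec i := by
    ext k
    simp [simpleSum, Fin.sum_univ_six]
  rw [e, map_sum]
  simp only [map_zsmul]

lemma linearIndependent_fnc_simpleVec :
    LinearIndependent ℂ fun i => fnc (simpleVec i) := by
  rw [Fintype.linearIndependent_iff]
  intro c hc
  have h : ∀ k, ∑ i, c i * simpleVec i k = 0 := by
    intro k
    have := LinearMap.congr_fun hc (hBasis k)
    simp only [LinearMap.sum_apply, LinearMap.smul_apply, fnc_hBasis, smul_eq_mul,
      LinearMap.zero_apply] at this
    apply mul_left_cancel₀ (coordUnit_ne_zero k)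
    rw [mul_zero, ← this, Finset.mul_sum]
    exact Finset.sum_congr rfl fun _ _ => by ring
  have h0 := h 0
  have h1 := h 1
  have h2 := h 2
  have h3 := h 3
  have h4 := h 4
  have h5 := h 5
  simp [Fin.sum_univ_six, simpleVec] at h0 h1 h2 h3 h4 h5
  have hc1 : c 1 = 0 := by linear_combination (h4 + h5) / 2
  have hc5 : c 5 = 0 := by linear_combination (h3 + h5) / 2
  have hc0 : c 0 = 0 := by linear_combination h5 - hc5
  have hc3 : c 3 = 0 := by linear_combination h0 / 2 + hc0 / 2 + hc1 + hc5 / 2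
  have hc4 : c 4 = 0 := by linear_combination (h1 - h2) / 4 + hc5 / 2 + hc3 / 2
  have hc2 : c 2 = 0 := by linear_combination h2 / 2 + hc0 / 2 - hc5 / 2 + hc4
  intro i
  fin_cases i <;> assumption

lemma span_fnc_simpleVec : Submodule.span ℂ (Set.range fun i => fnc (simpleVec i)) = ⊤ :=
  linearIndependent_fnc_simpleVec.span_eq_top_of_card_eq_finrank' (by
    rw [Subspace.dual_finrank_eq, finrank_complexify_hSub, Fintype.card_fin])

end RealForms
end

noncomputable section

namespace RealForms

open SymmetricCompositionAlgebra MagicAlgebra LieAlgebra LieAlgebra.IsKilling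

/-! ### Simplicity -/

/-- The Cartan matrix of `E₆` is invertible. -/
lemma exists_coroot_ne_zero {v : Module.Dual ℂ (complexify hSub)} (hv : v ≠ 0) :
    ∃ i, v (coroot (simpleIndex i).1) ≠ 0 := by
  by_contra! h
  have hmem : v ∈ Submodule.span ℂ (Set.range fun i => fnc (simpleVec i)) := by
    rw [span_fnc_simpleVec]
    trivial
  obtain ⟨c, rfl⟩ := (Submodule.mem_span_range_iff_exists_fun ℂ).1 hmem
  have key : ∀ j, ∑ i, c i * (CartanMatrix.E₆ i j : ℂ) = 0 := by
    intro j
    rw [← h j, LinearMap.sum_apply]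
    refine Finset.sum_congr rfl fun i _ => ?_
    rw [LinearMap.smul_apply, coroot'_simpleIndex, dotp_simpleVec_eq, smul_eq_mul]
    push_cast
    ring
  have h0 := key 0
  have h1 := key 1
  have h2 := key 2
  have h3 := key 3
  have h4 := key 4
  have h5 := key 5
  simp [Fin.sum_univ_six, CartanMatrix.E₆] at h0 h1 h2 h3 h4 h5
  -- The coefficients in these combinations are the rows of the inverse Cartan matrix.
  have hc0 : c 0 = 0 := by linear_combination (4/3) * h0 + 1 * h1 + (5/3) * h2 + 2 * h3 + (4/3) * h4 + (2/3) * h5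
  have hc1 : c 1 = 0 := by linear_combination 1 * h0 + 2 * h1 + 2 * h2 + 3 * h3 + 2 * h4 + 1 * h5
  have hc2 : c 2 = 0 := by linear_combination (5/3) * h0 + 2 * h1 + (10/3) * h2 + 4 * h3 + (8/3) * h4 + (4/3) * h5
  have hc3 : c 3 = 0 := by linear_combination 2 * h0 + 3 * h1 + 4 * h2 + 6 * h3 + 4 * h4 + 2 * h5
  have hc4 : c 4 = 0 := by linear_combination (4/3) * h0 + 2 * h1 + (8/3) * h2 + 4 * h3 + (10/3) * h4 + (5/3) * h5
  have hc5 : c 5 = 0 := by linear_combination (2/3) * h0 + 1 * h1 + (4/3) * h2 + 2 * h3 + (5/3) * h4 + (4/3) * h5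
  exact hv (by simp [Fin.sum_univ_six, hc0, hc1, hc2, hc3, hc4, hc5])

/-- The difference of `v` and its reflection is `v(α_i^∨) α_i`. -/
lemma fnc_simpleVec_mem_of_invariant {q : Submodule ℂ (Module.Dual ℂ (complexify hSub))}
    (hq : ∀ i, q ∈ Module.End.invtSubmodule ((rootSystem (complexify hSub)).reflection i).toLinearMap)
    {v : Module.Dual ℂ (complexify hSub)} (hv : v ∈ q) {i : Fin 6}
    (hi : v (coroot (simpleIndex i).1) ≠ 0) : fnc (simpleVec i) ∈ q := by
  have h : (rootSystem (complexify hSub)).reflection (simpleIndex i) v ∈ q :=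
    hq (simpleIndex i) hv
  rw [RootPairing.reflection_apply, root_simpleIndex] at h
  have h2 := q.sub_mem hv h
  rw [sub_sub_cancel] at h2
  exact (q.smul_mem_iff hi).1 h2

lemma fnc_simpleVec_mem_of_adjacent {q : Submodule ℂ (Module.Dual ℂ (complexify hSub))}
    (hq : ∀ i, q ∈ Module.End.invtSubmodule ((rootSystem (complexify hSub)).reflection i).toLinearMap)
    {i j : Fin 6} (hi : fnc (simpleVec i) ∈ q) (hij : CartanMatrix.E₆ i j ≠ 0) :
    fnc (simpleVec j) ∈ q := by
  refine fnc_simpleVec_mem_of_invariant hq hi ?_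
  rw [coroot'_simpleIndex, dotp_simpleVec_eq]
  simpa using hij

/-- A nonzero invariant subspace contains some simple root. Moving along the edges of the Dynkin
diagram one reaches the branch node `α₄`, and from there all the others, which span. -/
instance isIrreducible_rootSystem : (rootSystem (complexify hSub)).IsIrreducible := by
  have : Nontrivial (Module.Dual ℂ (complexify hSub)) :=
    ⟨fnc (simpleVec 0), 0, mt fnc_eq_zero.1 (simpleVec_ne_zero 0)⟩
  refine RootPairing.IsIrreducible.mk' _ fun q hq hne => ?_
  obtain ⟨v, hv, hv0⟩ := q.ne_bot_iff.1 hne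
  obtain ⟨i, hi⟩ := exists_coroot_ne_zero hv0
  have hmem := fnc_simpleVec_mem_of_invariant hq hv hi
  have step : ∀ {i j : Fin 6}, CartanMatrix.E₆ i j ≠ 0 → fnc (simpleVec i) ∈ q →
      fnc (simpleVec j) ∈ q := fun h hi => fnc_simpleVec_mem_of_adjacent hq hi h
  have h3 : fnc (simpleVec 3) ∈ q := by
    fin_cases i
    · exact step (i := 2) (by decide) (step (i := 0) (by decide) hmem)
    · exact step (i := 1) (by decide) hmem
    · exact step (i := 2) (by decide) hmem
    · exact hmem
    · exact step (i := 4) (by decide) hmem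
    · exact step (i := 4) (by decide) (step (i := 5) (by decide) hmem)
  have h2 : fnc (simpleVec 2) ∈ q := step (i := 3) (by decide) h3
  have h4 : fnc (simpleVec 4) ∈ q := step (i := 3) (by decide) h3
  rw [eq_top_iff, ← span_fnc_simpleVec, Submodule.span_le]
  rintro - ⟨j, rfl⟩
  fin_cases j
  · exact step (i := 2) (by decide) h2
  · exact step (i := 3) (by decide) h3
  · exact h2
  · exact h3
  · exact h4
  · exact step (i := 4) (by decide) h4

theorem isSimple_G614 : LieAlgebra.IsSimple ℂ (ℂ ⊗[ℝ] G614) :=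
  isSimple_iff_isIrreducible.1 isIrreducible_rootSystem

/-! ### The Satake diagram -/

lemma restrictToReal_add {α β : Module.Dual ℂ (complexify hSub)} :
    restrictToReal aSub_le_hSub (α + β) =
      restrictToReal aSub_le_hSub α + restrictToReal aSub_le_hSub β := rfl

lemma restrictToReal_neg {α : Module.Dual ℂ (complexify hSub)} :
    restrictToReal aSub_le_hSub (-α) = -restrictToReal aSub_le_hSub α := rfl

lemma restrictToReal_aBasis (α : Module.Dual ℂ (complexify hSub)) :
    restrictToReal aSub_le_hSub α (aBasis 0) = α (hBasis 4) ∧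
      restrictToReal aSub_le_hSub α (aBasis 1) = α (hBasis 5) := by
  constructor <;> refine congrArg α (Subtype.ext ?_)
  · exact (congrArg (fun x => (1 : ℂ) ⊗ₜ[ℝ] x) aBasis_zero).trans (hBasis_apply 4).symm
  · exact (congrArg (fun x => (1 : ℂ) ⊗ₜ[ℝ] x) aBasis_one).trans (hBasis_apply 5).symm

lemma restrictToReal_eq_iff {α β : Module.Dual ℂ (complexify hSub)} :
    restrictToReal aSub_le_hSub α = restrictToReal aSub_le_hSub β ↔
      α (hBasis 4) = β (hBasis 4) ∧ α (hBasis 5) = β (hBasis 5) := by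
  rw [← (restrictToReal_aBasis α).1, ← (restrictToReal_aBasis α).2,
    ← (restrictToReal_aBasis β).1, ← (restrictToReal_aBasis β).2]
  refine ⟨fun h => by rw [h]; exact ⟨rfl, rfl⟩, fun h => aBasis.ext fun i => ?_⟩
  fin_cases i
  exacts [h.1, h.2]

/-- On `a` only the last two coordinates survive; conditions on restrictions become decidable
conditions on integers. -/
lemma restrictToReal_fnc_eq_iff {n m : Fin 6 → ℤ} :
    restrictToReal aSub_le_hSub (fnc n) = restrictToReal aSub_le_hSub (fnc m) ↔
      n 4 = m 4 ∧ n 5 = m 5 := by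
  rw [restrictToReal_eq_iff, fnc_hBasis, fnc_hBasis, fnc_hBasis, fnc_hBasis,
    mul_right_inj' (coordUnit_ne_zero 4), mul_right_inj' (coordUnit_ne_zero 5)]
  norm_cast

lemma restrictToReal_fnc_eq_zero_iff {n : Fin 6 → ℤ} :
    restrictToReal aSub_le_hSub (fnc n) = 0 ↔ n 4 = 0 ∧ n 5 = 0 := by
  have h : restrictToReal aSub_le_hSub (fnc 0) = 0 := by rw [map_zero]; rfl
  rw [← h, restrictToReal_fnc_eq_iff]
  rfl

lemma fnc_simpleSum_mem_closure {S : Set (Module.Dual ℂ (complexify hSub))} {c : Fin 6 → ℤ}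
    (hc : ∀ i, 0 ≤ c i) (hS : ∀ i, c i ≠ 0 → fnc (simpleVec i) ∈ S) :
    fnc (simpleSum c) ∈ AddSubmonoid.closure S := by
  rw [fnc_simpleSum]
  refine AddSubmonoid.sum_mem _ fun i _ => ?_
  by_cases h : c i = 0
  · rw [h, zero_smul]
    exact zero_mem _
  · obtain ⟨n, hn⟩ := Int.eq_ofNat_of_zero_le (hc i)
    rw [hn, natCast_zsmul]
    exact AddSubmonoid.nsmul_mem _ (AddSubmonoid.subset_closure (hS i h)) n

lemma posCoeff_nonneg (k : Fin 36) (i : Fin 6) : 0 ≤ posCoeff k i := by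
  revert k i
  decide +kernel

lemma fnc_rootCoord (p : Bool × Fin 36) : fnc (rootCoord p) = fnc (simpleSum (posCoeff p.2)) ∨
    fnc (rootCoord p) = -fnc (simpleSum (posCoeff p.2)) := by
  obtain ⟨b, k⟩ := p
  cases b
  · right
    rw [← map_neg]
    congr 1
    ext j
    simp [rootCoord, sg]
  · left
    congr 1
    ext j
    simp [rootCoord, sg]

lemma fnc_rootCoord_mem_closure {S : Set (Module.Dual ℂ (complexify hSub))} (p : Bool × Fin 36)
    (hS : ∀ i, posCoeff p.2 i ≠ 0 → fnc (simpleVec i) ∈ S) :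
    fnc (rootCoord p) ∈ AddSubmonoid.closure S ∨ -fnc (rootCoord p) ∈ AddSubmonoid.closure S := by
  have h := fnc_simpleSum_mem_closure (posCoeff_nonneg p.2) hS
  rcases fnc_rootCoord p with e | e <;> rw [e]
  · exact Or.inl h
  · rw [neg_neg]
    exact Or.inr h

lemma exists_root_eq (r : (complexify hSub).root) :
    ∃ p, (rootSystem (complexify hSub)).root r = fnc (rootCoord p) := by
  have h : (rootSystem (complexify hSub)).root r ∈
      Set.range (rootSystem (complexify hSub)).root := ⟨r, rfl⟩
  rw [range_root] at h
  obtain ⟨p, hp⟩ := h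
  exact ⟨p, hp.symm⟩

/-- The base of simple roots. -/
def simpleBase : (rootSystem (complexify hSub)).Base :=
  RootPairing.Base.mk' _ (Set.range simpleIndex)
    (by
      rw [LinearIndepOn, ← linearIndependent_equiv (Equiv.ofInjective _ simpleIndex_injective)]
      have e : (fun i => (rootSystem (complexify hSub)).root (simpleIndex i)) =
          fun i => fnc (simpleVec i) := funext root_simpleIndex
      have h := linearIndependent_fnc_simpleVec
      rw [← e] at h
      exact h)
    (fun r => by
      obtain ⟨p, hp⟩ := exists_root_eq r
      rw [hp]
      exact fnc_rootCoord_mem_closure p fun i _ =>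
        ⟨simpleIndex i, ⟨i, rfl⟩, root_simpleIndex i⟩)

lemma mem_support_simpleBase (r : (complexify hSub).root) :
    r ∈ simpleBase.support ↔ ∃ i, simpleIndex i = r := by
  simp [simpleBase, RootPairing.Base.mk']

/-- The simple roots as the elements of the support of the base. -/
def simpleEquiv : Fin 6 ≃ simpleBase.support :=
  Equiv.ofBijective
    (fun i => ⟨simpleIndex i, (mem_support_simpleBase _).2 ⟨i, rfl⟩⟩)
    ⟨fun i j h => simpleIndex_injective (congrArg Subtype.val h), fun r => by
      obtain ⟨i, hi⟩ := (mem_support_simpleBase r.1).1 r.2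
      exact ⟨i, Subtype.ext hi⟩⟩

lemma cartanMatrix_simpleBase (i j : Fin 6) :
    simpleBase.cartanMatrix (simpleEquiv i) (simpleEquiv j) = CartanMatrix.E₆ i j := by
  have h := simpleBase.algebraMap_cartanMatrixIn_apply ℤ (simpleEquiv i) (simpleEquiv j)
  have h2 := pairing_simpleIndex i j
  have h3 : algebraMap ℤ ℂ (simpleBase.cartanMatrix (simpleEquiv i) (simpleEquiv j)) =
      (CartanMatrix.E₆ i j : ℂ) := h.trans h2
  rw [eq_intCast] at h3
  exact_mod_cast h3

/-- This is the adaptedness of the base. The white simple roots restrict to `½(w₆ - w₅)`, `w₅` and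
`½(w₆ - w₅)`, and no nontrivial combination of these with nonnegative coefficients vanishes. -/
lemma posCoeff_of_compact (p : Bool × Fin 36) (h4 : rootCoord p 4 = 0) (h5 : rootCoord p 5 = 0)
    (i : Fin 6) (hi : posCoeff p.2 i ≠ 0) : simpleVec i 4 = 0 ∧ simpleVec i 5 = 0 := by
  revert p i
  decide +kernel

theorem isSatakeDiagram_simpleRoots :
    IsSatakeDiagram aSub_le_hSub (simpleRoots hBasis.coord) satakeEIII := by
  have e : simpleRoots hBasis.coord = fun i => fnc (simpleVec i) :=
    funext fun i => (fnc_simpleVec i).symm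
  rw [e]
  refine ⟨simpleBase, simpleEquiv, fun i => root_simpleIndex i, fun r => ?_,
    cartanMatrix_simpleBase, fun i => ?_, fun i j => ?_⟩
  · constructor
    · intro h
      obtain ⟨p, hp⟩ := exists_root_eq r
      rw [hp, restrictToReal_fnc_eq_zero_iff] at h
      rw [hp]
      exact fnc_rootCoord_mem_closure p fun i hi =>
        ⟨i, rfl, restrictToReal_fnc_eq_zero_iff.2 (posCoeff_of_compact p h.1 h.2 i hi)⟩
    · have key : ∀ f ∈ AddSubmonoid.closure {f : Module.Dual ℂ (complexify hSub) |
          ∃ i, f = fnc (simpleVec i) ∧ restrictToReal aSub_le_hSub f = 0},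
          restrictToReal aSub_le_hSub f = 0 := by
        intro f hf
        induction hf using AddSubmonoid.closure_induction with
        | mem f hf => exact hf.choose_spec.2
        | zero => rfl
        | add f g _ _ hf hg => rw [restrictToReal_add, hf, hg, add_zero]
      rintro (h | h)
      · exact key _ h
      · have h2 := key _ h
        rwa [restrictToReal_neg, neg_eq_zero] at h2
  · rw [restrictToReal_fnc_eq_zero_iff]
    change i ∈ ({2, 3, 4} : Set (Fin 6)) ↔ _
    simp only [Set.mem_insert_iff, Set.mem_singleton_iff]
    revert i
    decide
  · rw [Ne, Ne, Ne, restrictToReal_fnc_eq_zero_iff, restrictToReal_fnc_eq_zero_iff,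
      restrictToReal_fnc_eq_iff]
    change (i = 0 ∧ j = 5) ∨ (i = 5 ∧ j = 0) ↔ _
    revert i j
    decide

end RealForms
end

noncomputable section

namespace RealForms

open SymmetricCompositionAlgebra MagicAlgebra LieAlgebra LieAlgebra.IsKilling

/-! ### Joint eigenspaces -/

section JointEigenspace

variable {K V ι κ : Type*} [Field K] [AddCommGroup V] [Module K V] [Fintype ι]

/-- The joint eigenspace of a family of endomorphisms. -/
def jointEigenspace (T : κ → Module.End K V) (μ : κ → K) : Submodule K V :=
  ⨅ j, Module.End.eigenspace (T j) (μ j)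

lemma mem_jointEigenspace {T : κ → Module.End K V} {μ : κ → K} {v : V} :
    v ∈ jointEigenspace T μ ↔ ∀ j, T j v = μ j • v := by
  simp [jointEigenspace, Module.End.mem_eigenspace_iff]

/-- In a basis of joint eigenvectors, a vector has character `μ` exactly when its support consists
of basis vectors with that character. -/
lemma jointEigenspace_eq_span (b : Module.Basis ι K V) {T : κ → Module.End K V} {χ : ι → κ → K}
    (h : ∀ i j, T j (b i) = χ i j • b i) (μ : κ → K) :
    jointEigenspace T μ = Submodule.span K (b '' {i | χ i = μ}) := by
  ext v
  rw [mem_jointEigenspace, Module.Basis.mem_span_image]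
  have hT : ∀ j i, b.repr (T j v) i = χ i j * b.repr v i := by
    intro j i
    conv_lhs => rw [← b.sum_repr v, map_sum]
    simp only [map_smul, h, map_sum, Finsupp.coe_finsetSum, Finset.sum_apply, Finsupp.smul_apply,
      Module.Basis.repr_self, smul_eq_mul]
    rw [Finset.sum_eq_single i]
    · simp [mul_comm]
    · intro k _ hk
      simp [hk]
    · simp
  constructor
  · intro hv i hi
    have hi' : b.repr v i ≠ 0 := Finsupp.mem_support_iff.1 hi
    refine funext fun j => ?_
    have := hT j i
    rw [hv j, map_smul, Finsupp.smul_apply, smul_eq_mul] at this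
    exact (mul_right_cancel₀ hi' this).symm
  · intro hs j
    refine b.ext_elem fun i => ?_
    rw [hT, map_smul, Finsupp.smul_apply, smul_eq_mul]
    by_cases hi : b.repr v i = 0
    · rw [hi, mul_zero, mul_zero]
    · have : χ i = μ := hs (Finsupp.mem_support_iff.2 hi)
      rw [this]

lemma finrank_jointEigenspace (b : Module.Basis ι K V) {T : κ → Module.End K V} {χ : ι → κ → K}
    (h : ∀ i j, T j (b i) = χ i j • b i) (μ : κ → K) :
    Module.finrank K (jointEigenspace T μ) = Nat.card {i // χ i = μ} := by
  classical
  have : Fintype {i // χ i = μ} := Fintype.ofFinite _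
  rw [jointEigenspace_eq_span b h μ, Nat.card_eq_fintype_card]
  have e : b '' {i | χ i = μ} = Set.range fun i : {i // χ i = μ} => b i := by
    rw [← Function.comp_def, Set.range_comp, Subtype.range_coe_subtype]
  rw [e]
  exact finrank_span_eq_card (b.linearIndependent.comp _ Subtype.val_injective)

end JointEigenspace

lemma finrank_baseChange_submodule {V : Type*} [AddCommGroup V] [Module ℝ V]
    (W : Submodule ℝ V) : Module.finrank ℂ (W.baseChange ℂ) = Module.finrank ℝ W := by
  rw [← Module.finrank_baseChange (R := ℂ) (S := ℝ) (M' := W)]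
  exact (Submodule.toBaseChange.toLinearEquiv ℂ W).finrank_eq.symm

/-! ### Restricted root spaces -/

/-- The functional `½ (r w₅ + s w₆)` on `a`. -/
def aFnc (n : ℤ × ℤ) : Module.Dual ℝ aSub :=
  ((n.1 : ℝ) / 2) • aBasis.coord 0 + ((n.2 : ℝ) / 2) • aBasis.coord 1

lemma aFnc_aBasis (n : ℤ × ℤ) : aFnc n (aBasis 0) = n.1 / 2 ∧ aFnc n (aBasis 1) = n.2 / 2 := by
  simp [aFnc]

lemma dual_aSub_ext {l l' : Module.Dual ℝ aSub} (h0 : l (aBasis 0) = l' (aBasis 0))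
    (h1 : l (aBasis 1) = l' (aBasis 1)) : l = l' :=
  aBasis.ext fun i => by fin_cases i; exacts [h0, h1]

lemma aFnc_injective : Function.Injective aFnc := by
  intro n m h
  have h0 := LinearMap.congr_fun h (aBasis 0)
  have h1 := LinearMap.congr_fun h (aBasis 1)
  rw [(aFnc_aBasis _).1, (aFnc_aBasis _).1] at h0
  rw [(aFnc_aBasis _).2, (aFnc_aBasis _).2] at h1
  have h0' : (n.1 : ℝ) = m.1 := by linarith
  have h1' : (n.2 : ℝ) = m.2 := by linarith
  exact Prod.ext (by exact_mod_cast h0') (by exact_mod_cast h1')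

/-- The adjoint actions of `h₅` and `h₆` on the complexification. -/
def adA (j : Fin 2) : Module.End ℂ (ℂ ⊗[ℝ] G614) where
  toFun z := ⁅(1 : ℂ) ⊗ₜ[ℝ] (aBasis j : G614), z⁆
  map_add' := complex_lie_add _
  map_smul' c z := complex_lie_smul c _ z

/-- The eigenvalues are real, so the real and imaginary parts of a joint eigenvector are joint
eigenvectors in `g`. By linearity it is enough to test on `h₅` and `h₆`. -/
lemma baseChange_restrictedRootSpace (l : Module.Dual ℝ aSub) :
    (restrictedRootSpace aSub l).baseChange ℂ =
      jointEigenspace adA fun j => (l (aBasis j) : ℂ) := by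
  have hmem : ∀ x, x ∈ restrictedRootSpace aSub l ↔
      ∀ j, ⁅(aBasis j : G614), x⁆ = l (aBasis j) • x := by
    intro x
    refine ⟨fun h j => h (aBasis j), fun h y => ?_⟩
    let A : aSub →ₗ[ℝ] G614 :=
      { toFun := fun y => ⁅(y : G614), x⁆
        map_add' := fun y z => add_lie _ _ _
        map_smul' := fun c y => smul_lie _ _ _ }
    have key : A = l.smulRight x := aBasis.ext h
    exact LinearMap.congr_fun key y
  apply le_antisymm
  · rw [Submodule.baseChange_eq_span, Submodule.span_le]
    rintro - ⟨x, hx, rfl⟩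
    refine mem_jointEigenspace.2 fun j => ?_
    change ⁅(1 : ℂ) ⊗ₜ[ℝ] (aBasis j : G614), (1 : ℂ) ⊗ₜ[ℝ] x⁆ = (l (aBasis j) : ℂ) • (1 : ℂ) ⊗ₜ[ℝ] x
    rw [LieAlgebra.ExtendScalars.bracket_tmul, one_mul, hx (aBasis j), ← TensorProduct.smul_tmul,
      TensorProduct.smul_tmul', Complex.real_smul, smul_eq_mul]
  · intro z hz
    obtain ⟨x, y, rfl⟩ := exists_re_add_im z
    have h : ∀ j, ⁅(aBasis j : G614), x⁆ = l (aBasis j) • x ∧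
        ⁅(aBasis j : G614), y⁆ = l (aBasis j) • y := by
      intro j
      have h1 : ⁅(1 : ℂ) ⊗ₜ[ℝ] (aBasis j : G614), (1 : ℂ) ⊗ₜ[ℝ] x + Complex.I ⊗ₜ[ℝ] y⁆ =
        (l (aBasis j) : ℂ) • ((1 : ℂ) ⊗ₜ[ℝ] x + Complex.I ⊗ₜ[ℝ] y) := mem_jointEigenspace.1 hz j
      rw [one_tmul_lie, smul_re_add_im, re_add_im_inj] at h1
      simpa using h1
    have hx := (hmem x).2 fun j => (h j).1
    have hy := (hmem y).2 fun j => (h j).2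
    exact add_mem (Submodule.tmul_mem_baseChange_of_mem _ hx)
      (Submodule.tmul_mem_baseChange_of_mem _ hy)

lemma adA_weightBasis (x : WeightIndex) (j : Fin 2) :
    adA j (weightBasis x) = x.1 (hBasis (![4, 5] j)) • weightBasis x := by
  rw [← lie_weightBasis]
  have e : (1 : ℂ) ⊗ₜ[ℝ] (aBasis j : G614) = (hBasis (![4, 5] j) : ℂ ⊗[ℝ] G614) := by
    rw [hBasis_apply]
    fin_cases j
    · exact congrArg _ aBasis_zero
    · exact congrArg _ aBasis_one
  rw [← e]
  rfl

/-- Complexification preserves dimensions, and a basis adapted to the weight spaces of `h^ℂ`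
diagonalises `ad h₅` and `ad h₆`; the multiplicity counts the basis vectors whose weight restricts
to `l`. -/
lemma multiplicity_eq (l : Module.Dual ℝ aSub) : multiplicity aSub l =
    Nat.card {x : WeightIndex // (fun j => x.1 (hBasis (![4, 5] j))) = fun j => (l (aBasis j) : ℂ)} := by
  rw [multiplicity, ← finrank_baseChange_submodule, baseChange_restrictedRootSpace]
  exact finrank_jointEigenspace weightBasis adA_weightBasis _

/-- The element of the index type of the root system with given coordinates. -/
def rootIndex (p : Bool × Fin 36) : (complexify hSub).root := (fnc_rootCoord_mem p).choose

lemma root_rootIndex (p : Bool × Fin 36) :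
    (rootSystem (complexify hSub)).root (rootIndex p) = fnc (rootCoord p) :=
  (fnc_rootCoord_mem p).choose_spec

lemma rootIndex_bijective : Function.Bijective rootIndex := by
  refine ⟨fun p q h => ?_, fun r => ?_⟩
  · have := root_rootIndex p
    rw [h, root_rootIndex] at this
    exact (rootCoord_injective (fnc_injective this)).symm
  · obtain ⟨p, hp⟩ := exists_root_eq r
    refine ⟨p, (rootSystem (complexify hSub)).root.injective ?_⟩
    rw [root_rootIndex, hp]

lemma rootIndex_hBasis (p : Bool × Fin 36) (k : Fin 6) :
    (rootIndex p).1 (hBasis k) = coordUnit k * rootCoord p k := by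
  have h := LinearMap.congr_fun (root_rootIndex p) (hBasis k)
  rw [fnc_hBasis] at h
  exact h

lemma finrank_rootSpace_rootIndex (p : Bool × Fin 36) :
    Module.finrank ℂ (rootSpace (complexify hSub) (rootIndex p).1).toSubmodule = 1 :=
  finrank_rootSpace_eq_one _ (LieSubalgebra.isNonZero_coe_root _)

/-- The zero weight restricts to zero and is excluded by `hl`; each remaining weight is a root with
a one-dimensional space, and contributes one basis vector. -/
lemma multiplicity_of_ne_zero {l : Module.Dual ℝ aSub} (hl : l ≠ 0) : multiplicity aSub l =
    Nat.card {p : Bool × Fin 36 // l = aFnc (rootCoord p 4, rootCoord p 5)} := by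
  rw [multiplicity_eq]
  have hiff : ∀ p, (fun j => (rootIndex p).1 (hBasis (![4, 5] j))) = (fun j => (l (aBasis j) : ℂ)) ↔
      l = aFnc (rootCoord p 4, rootCoord p 5) := by
    intro p
    have h4 := rootIndex_hBasis p 4
    have h5 := rootIndex_hBasis p 5
    simp only [coordUnit, Matrix.cons_val] at h4 h5
    have e : ∀ (x : ℂ) (r : ℝ) (n : ℤ), x = 1 / 2 * n → (x = r ↔ r = n / 2) := by
      rintro x r n rfl
      rw [eq_comm, show (1 / 2 * n : ℂ) = ((n / 2 : ℝ) : ℂ) by push_cast; ring, Complex.ofReal_inj]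
    have e4 := e _ (l (aBasis 0)) _ h4
    have e5 := e _ (l (aBasis 1)) _ h5
    rw [funext_iff, Fin.forall_fin_two]
    refine (and_congr e4 e5).trans ⟨fun h => dual_aSub_ext ?_ ?_, fun h => ?_⟩
    · rw [h.1, (aFnc_aBasis _).1]
    · rw [h.2, (aFnc_aBasis _).2]
    · rw [h]
      exact aFnc_aBasis _
  symm
  refine Nat.card_congr (Equiv.ofBijective (fun p =>
    -- The index `0` is the only one available, the root space being a line.
    ⟨⟨(rootIndex p.1).1, ⟨0, by rw [finrank_rootSpace_rootIndex]; exact one_pos⟩⟩,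
      (hiff p.1).2 p.2⟩) ⟨fun p q h => ?_, fun x => ?_⟩)
  · have h1 := congrArg (fun y => y.1.1) h
    exact Subtype.ext (rootIndex_bijective.1 (Subtype.ext h1))
  · obtain ⟨⟨w, k⟩, hx⟩ := x
    have hw : w.IsNonZero := by
      intro h0
      apply hl
      refine dual_aSub_ext ?_ ?_
      · have := congrFun hx 0
        simpa [h0] using this.symm
      · have := congrFun hx 1
        simpa [h0] using this.symm
    obtain ⟨p, hp⟩ := rootIndex_bijective.2 ⟨w, by simpa using hw⟩
    obtain rfl : (rootIndex p).1 = w := congrArg Subtype.val hp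
    refine ⟨⟨p, (hiff p).1 hx⟩, Subtype.ext (Sigma.ext rfl (heq_of_eq ?_))⟩
    have h1 := finrank_rootSpace_rootIndex p
    refine Fin.ext ?_
    have := k.2
    change 0 = (k : ℕ)
    omega

lemma multiplicity_aFnc {n : ℤ × ℤ} (hn : n ≠ 0) : multiplicity aSub (aFnc n) =
    Fintype.card {p : Bool × Fin 36 // rootCoord p 4 = n.1 ∧ rootCoord p 5 = n.2} := by
  have h0 : aFnc n ≠ 0 := by
    have e : aFnc 0 = 0 := by simp [aFnc]
    rw [← e]
    exact fun h => hn (aFnc_injective h)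
  rw [multiplicity_of_ne_zero h0, ← Nat.card_eq_fintype_card]
  refine Nat.card_congr (Equiv.subtypeEquivRight fun p => ?_)
  rw [aFnc_injective.eq_iff, Prod.ext_iff]
  exact ⟨fun h => ⟨h.1.symm, h.2.symm⟩, fun h => ⟨h.1.symm, h.2.symm⟩⟩

lemma mem_restrictedRoots_iff (l : Module.Dual ℝ aSub) : l ∈ restrictedRoots aSub ↔
    ∃ p, (rootCoord p 4, rootCoord p 5) ≠ (0, 0) ∧ l = aFnc (rootCoord p 4, rootCoord p 5) := by
  have e : aFnc (0, 0) = 0 := by simp [aFnc]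
  have h : ∀ l : Module.Dual ℝ aSub, l ≠ 0 → (restrictedRootSpace aSub l ≠ ⊥ ↔
      ∃ p, l = aFnc (rootCoord p 4, rootCoord p 5)) := by
    intro l hl
    rw [← Submodule.one_le_finrank_iff, ← nonempty_subtype, Nat.one_le_iff_ne_zero]
    change multiplicity aSub l ≠ 0 ↔ _
    rw [multiplicity_of_ne_zero hl, ← Nat.pos_iff_ne_zero, Nat.card_pos_iff]
    exact ⟨fun h => h.1, fun h => ⟨h, inferInstance⟩⟩
  constructor
  · rintro ⟨hl, hne⟩
    obtain ⟨p, hp⟩ := (h l hl).1 hne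
    refine ⟨p, fun h0 => hl ?_, hp⟩
    rw [hp, h0, e]
  · rintro ⟨p, hp, rfl⟩
    have hne : aFnc (rootCoord p 4, rootCoord p 5) ≠ 0 := by
      rw [← e]
      exact fun h => hp (aFnc_injective h)
    exact ⟨hne, (h _ hne).2 ⟨p, rfl⟩⟩

end RealForms
end

noncomputable section

namespace RealForms

open SymmetricCompositionAlgebra MagicAlgebra LieAlgebra LieAlgebra.IsKilling

/-! ### The restricted root system -/

/-- The coordinates of the restricted roots. -/
def restrictedCoords : Finset (ℤ × ℤ) :=
  {(2, 0), (-2, 0), (0, 2), (0, -2), (2, 2), (2, -2), (-2, 2), (-2, -2),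
    (1, 1), (1, -1), (-1, 1), (-1, -1)}

lemma rootCoord_mem_restrictedCoords (p : Bool × Fin 36)
    (h : (rootCoord p 4, rootCoord p 5) ≠ (0, 0)) :
    (rootCoord p 4, rootCoord p 5) ∈ restrictedCoords := by
  revert p
  decide +kernel

lemma exists_rootCoord_of_mem_restrictedCoords (n : ℤ × ℤ) (h : n ∈ restrictedCoords) :
    ∃ p, (rootCoord p 4, rootCoord p 5) ≠ (0, 0) ∧ n = (rootCoord p 4, rootCoord p 5) := by
  revert n
  decide +kernel

lemma mem_restrictedRoots_iff_exists (l : Module.Dual ℝ aSub) :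
    l ∈ restrictedRoots aSub ↔ ∃ n ∈ restrictedCoords, l = aFnc n := by
  rw [mem_restrictedRoots_iff]
  constructor
  · rintro ⟨p, hp, rfl⟩
    exact ⟨_, rootCoord_mem_restrictedCoords p hp, rfl⟩
  · rintro ⟨n, hn, rfl⟩
    obtain ⟨p, hp, rfl⟩ := exists_rootCoord_of_mem_restrictedCoords n hn
    exact ⟨p, hp, rfl⟩

lemma mem_restrictedRoots_iff_or (l : Module.Dual ℝ aSub) : l ∈ restrictedRoots aSub ↔
    l = aFnc (2, 0) ∨ l = aFnc (-2, 0) ∨ l = aFnc (0, 2) ∨ l = aFnc (0, -2) ∨ l = aFnc (2, 2) ∨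
    l = aFnc (2, -2) ∨ l = aFnc (-2, 2) ∨ l = aFnc (-2, -2) ∨ l = aFnc (1, 1) ∨
    l = aFnc (1, -1) ∨ l = aFnc (-1, 1) ∨ l = aFnc (-1, -1) := by
  rw [mem_restrictedRoots_iff_exists]
  simp only [restrictedCoords, Finset.mem_insert, Finset.mem_singleton, exists_eq_or_imp,
    exists_eq_left]

lemma coord_zero_eq : aBasis.coord 0 = aFnc (2, 0) := by simp [aFnc]

lemma coord_one_eq : aBasis.coord 1 = aFnc (0, 2) := by simp [aFnc]

lemma aFnc_add (n m : ℤ × ℤ) : aFnc n + aFnc m = aFnc (n.1 + m.1, n.2 + m.2) := by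
  simp only [aFnc]
  push_cast
  module

lemma aFnc_sub (n m : ℤ × ℤ) : aFnc n - aFnc m = aFnc (n.1 - m.1, n.2 - m.2) := by
  simp only [aFnc]
  push_cast
  module

lemma aFnc_neg (n : ℤ × ℤ) : -aFnc n = aFnc (-n.1, -n.2) := by
  simp only [aFnc]
  push_cast
  module

lemma aFnc_two_smul (n : ℤ × ℤ) : (2 : ℝ) • aFnc n = aFnc (2 * n.1, 2 * n.2) := by
  simp only [aFnc]
  push_cast
  module

lemma aFnc_two_nsmul (n : ℤ × ℤ) : (2 : ℕ) • aFnc n = aFnc (2 * n.1, 2 * n.2) := by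
  simp only [aFnc]
  push_cast
  module

lemma smul_coord_add {s t : ℝ} (a b : ℤ) (hs : s = a) (ht : t = b) :
    s • aBasis.coord 0 + t • aBasis.coord 1 = aFnc (2 * a, 2 * b) := by
  simp [aFnc, hs, ht]

lemma half_smul_coord_add {s t : ℝ} (a b : ℤ) (hs : s = a) (ht : t = b) :
    (1 / 2 : ℝ) • (s • aBasis.coord 0 + t • aBasis.coord 1) = aFnc (a, b) := by
  simp only [aFnc, hs, ht]
  module

lemma restrictedRoots_eq : restrictedRoots aSub =
    {l | l = aBasis.coord 0 ∨ l = -aBasis.coord 0 ∨ l = aBasis.coord 1 ∨ l = -aBasis.coord 1 ∨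
      ∃ s ∈ ({1, -1} : Set ℝ), ∃ t ∈ ({1, -1} : Set ℝ),
        l = s • aBasis.coord 0 + t • aBasis.coord 1 ∨
        l = (1 / 2 : ℝ) • (s • aBasis.coord 0 + t • aBasis.coord 1)} := by
  ext l
  rw [mem_restrictedRoots_iff_or, Set.mem_ofPred_eq]
  simp only [Set.mem_insert_iff, Set.mem_singleton_iff, exists_eq_or_imp, exists_eq_left]
  rw [half_smul_coord_add 1 1 (by simp) (by simp), half_smul_coord_add 1 (-1) (by simp) (by simp),
    half_smul_coord_add (-1) 1 (by simp) (by simp),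
    half_smul_coord_add (-1) (-1) (by simp) (by simp), smul_coord_add 1 1 (by simp) (by simp),
    smul_coord_add 1 (-1) (by simp) (by simp), smul_coord_add (-1) 1 (by simp) (by simp),
    smul_coord_add (-1) (-1) (by simp) (by simp), coord_zero_eq, coord_one_eq, aFnc_neg, aFnc_neg]
  simp only [mul_one, mul_neg, neg_zero]
  tauto

/-- The basis `½ (w₅ + w₆)`, `½ (w₅ - w₆)` of the dual of `a`. -/
def shortBasis : Module.Basis (Fin 2) ℝ (Module.Dual ℝ aSub) :=
  basisOfLinearIndependentOfCardEqFinrank (b := ![aFnc (1, 1), aFnc (1, -1)])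
    (by
      rw [LinearIndependent.pair_iff]
      intro s t h
      have h0 := LinearMap.congr_fun h (aBasis 0)
      have h1 := LinearMap.congr_fun h (aBasis 1)
      simp [(aFnc_aBasis _).1, (aFnc_aBasis _).2] at h0 h1
      constructor <;> linarith)
    (by rw [Subspace.dual_finrank_eq, finrank_aSub, Fintype.card_fin])

lemma shortBasis_zero : shortBasis 0 = aFnc (1, 1) := by simp [shortBasis]

lemma shortBasis_one : shortBasis 1 = aFnc (1, -1) := by simp [shortBasis]

/-- In the basis `f₁, f₂ = ½(w₅ ± w₆)`, the doubled short roots are `w₅ ± w₆`, while `f₁ + f₂ = w₅`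
and `f₁ - f₂ = w₆`. -/
lemma isTypeBC_restrictedRoots : IsTypeBC 2 (restrictedRoots aSub) := by
  refine ⟨shortBasis, ?_⟩
  ext l
  rw [mem_restrictedRoots_iff_or, Set.mem_union, Set.mem_ofPred_eq, Set.mem_ofPred_eq]
  simp only [Fin.exists_fin_two, shortBasis_zero, shortBasis_one, aFnc_neg, aFnc_add, aFnc_sub,
    aFnc_two_smul, ne_eq, not_true_eq_false, false_and, zero_ne_one, one_ne_zero,
    not_false_eq_true, true_and, false_or, or_false]
  norm_num
  tauto

lemma restrictedRoots_eq_of_base {β₁ β₂ : Module.Dual ℝ aSub} (h₁ : β₁ = aFnc (1, 1))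
    (h₂ : β₂ = aFnc (-2, 0)) : restrictedRoots aSub =
      {l | ∃ r ∈ ({β₁, β₂, β₁ + β₂, 2 • β₁ + β₂, 2 • β₁, 2 • β₁ + 2 • β₂} :
        Set (Module.Dual ℝ aSub)), l = r ∨ l = -r} := by
  subst h₁ h₂
  ext l
  rw [mem_restrictedRoots_iff_or, Set.mem_ofPred_eq]
  simp only [Set.mem_insert_iff, Set.mem_singleton_iff, exists_eq_or_imp, exists_eq_left,
    aFnc_two_nsmul, aFnc_add, aFnc_neg]
  norm_num
  tauto

lemma multiplicity_eq_eight {n : ℤ × ℤ} (h : n ∈ ({(1, 1), (1, -1), (-1, 1), (-1, -1)} :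
    Finset (ℤ × ℤ))) : multiplicity aSub (aFnc n) = 8 := by
  have h0 : n ≠ 0 := by rintro rfl; revert h; decide
  rw [multiplicity_aFnc h0]
  revert n
  decide +kernel

lemma multiplicity_eq_one {n : ℤ × ℤ} (h : n ∈ ({(2, 2), (2, -2), (-2, 2), (-2, -2)} :
    Finset (ℤ × ℤ))) : multiplicity aSub (aFnc n) = 1 := by
  have h0 : n ≠ 0 := by rintro rfl; revert h; decide
  rw [multiplicity_aFnc h0]
  revert n
  decide +kernel

lemma multiplicity_eq_six {n : ℤ × ℤ} (h : n ∈ ({(2, 0), (-2, 0), (0, 2), (0, -2)} :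
    Finset (ℤ × ℤ))) : multiplicity aSub (aFnc n) = 6 := by
  have h0 : n ≠ 0 := by rintro rfl; revert h; decide
  rw [multiplicity_aFnc h0]
  revert n
  decide +kernel

lemma sg_pair_mem (b b' : Bool) :
    (sg b, sg b') ∈ ({(1, 1), (1, -1), (-1, 1), (-1, -1)} : Finset (ℤ × ℤ)) ∧
    (2 * sg b, 2 * sg b') ∈ ({(2, 2), (2, -2), (-2, 2), (-2, -2)} : Finset (ℤ × ℤ)) ∧
    (2 * sg b, 0) ∈ ({(2, 0), (-2, 0), (0, 2), (0, -2)} : Finset (ℤ × ℤ)) ∧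
    (0, 2 * sg b) ∈ ({(2, 0), (-2, 0), (0, 2), (0, -2)} : Finset (ℤ × ℤ)) := by
  revert b b'
  decide

lemma multiplicities {s t : ℝ} (hs : s ∈ ({1, -1} : Set ℝ)) (ht : t ∈ ({1, -1} : Set ℝ)) :
    multiplicity aSub ((1 / 2 : ℝ) • (s • aBasis.coord 0 + t • aBasis.coord 1)) = 8 ∧
      multiplicity aSub (s • aBasis.coord 0 + t • aBasis.coord 1) = 1 ∧
      multiplicity aSub (s • aBasis.coord 0) = 6 ∧
      multiplicity aSub (s • aBasis.coord 1) = 6 := by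
  have h : ∀ s ∈ ({1, -1} : Set ℝ), ∃ b, s = ((sg b : ℤ) : ℝ) := by
    rintro s (rfl | rfl)
    exacts [⟨true, by simp [sg]⟩, ⟨false, by simp [sg]⟩]
  obtain ⟨b, hb⟩ := h s hs
  obtain ⟨b', hb'⟩ := h t ht
  have e0 : s • aBasis.coord 0 = aFnc (2 * sg b, 0) := by simp [aFnc, hb]
  have e1 : s • aBasis.coord 1 = aFnc (0, 2 * sg b) := by simp [aFnc, hb]
  rw [half_smul_coord_add _ _ hb hb', smul_coord_add _ _ hb hb', e0, e1]
  obtain ⟨h1, h2, h3, h4⟩ := sg_pair_mem b b'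
  exact ⟨multiplicity_eq_eight h1, multiplicity_eq_one h2, multiplicity_eq_six h3,
    multiplicity_eq_six h4⟩

/-! ### The maximal root -/

/-- Functionals in the root lattice are real on `a`, so their complex-valued restrictions come from
real functionals. -/
lemma restrictToReal_fnc (n : Fin 6 → ℤ) (x : aSub) :
    restrictToReal aSub_le_hSub (fnc n) x = (aFnc (n 4, n 5) x : ℂ) := by
  have key : restrictToReal aSub_le_hSub (fnc n) = Algebra.linearMap ℝ ℂ ∘ₗ aFnc (n 4, n 5) := by
    refine aBasis.ext fun i => ?_
    fin_cases i
    · refine (restrictToReal_aBasis _).1.trans ?_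
      change _ = ((aFnc (n 4, n 5) (aBasis 0) : ℝ) : ℂ)
      rw [fnc_hBasis, (aFnc_aBasis _).1]
      simp [coordUnit]
      ring
    · refine (restrictToReal_aBasis _).2.trans ?_
      change _ = ((aFnc (n 4, n 5) (aBasis 1) : ℝ) : ℂ)
      rw [fnc_hBasis, (aFnc_aBasis _).2]
      simp [coordUnit]
      ring
  exact LinearMap.congr_fun key x

lemma maximalRoot_eq_fnc : maximalRoot hBasis.coord = fnc (simpleSum ![1, 2, 2, 3, 2, 1]) := by
  rw [fnc_simpleSum, Fin.sum_univ_six]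
  simp only [maximalRoot, ← fnc_simpleVec, Matrix.cons_val, one_smul]
  module

lemma simpleSum_maximal : simpleSum ![1, 2, 2, 3, 2, 1] = ![0, 0, 0, 0, 2, 2] := by
  decide

lemma maximalRoot_eq : maximalRoot hBasis.coord = hBasis.coord 4 + hBasis.coord 5 := by
  rw [maximalRoot_eq_fnc, simpleSum_maximal, fnc_apply, Fin.sum_univ_six]
  simp [coordUnit]

lemma rootCoord_maximal : rootCoord (true, 35) = simpleSum ![1, 2, 2, 3, 2, 1] := by
  decide +kernel

lemma maximalRoot_mem : maximalRoot hBasis.coord ∈ rootList hBasis.coord := by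
  rw [rootList_eq]
  exact ⟨(true, 35), by rw [maximalRoot_eq_fnc, ← rootCoord_maximal]⟩

lemma maximal_sub_nonneg (p : Bool × Fin 36) (i : Fin 6) :
    0 ≤ (![1, 2, 2, 3, 2, 1] : Fin 6 → ℤ) i - sg p.1 * posCoeff p.2 i := by
  revert p i
  decide +kernel

/-- The coefficients `1, 2, 2, 3, 2, 1` dominate those of every root, by inspection of the list, so
the difference has nonnegative coefficients. -/
lemma maximalRoot_sub_mem {r : Module.Dual ℂ (complexify hSub)} (hr : r ∈ rootList hBasis.coord) :
    maximalRoot hBasis.coord - r ∈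
      AddSubmonoid.closure (Set.range (simpleRoots hBasis.coord)) := by
  rw [rootList_eq] at hr
  obtain ⟨p, rfl⟩ := hr
  have e : maximalRoot hBasis.coord - fnc (rootCoord p) =
      fnc (simpleSum fun i => (![1, 2, 2, 3, 2, 1] : Fin 6 → ℤ) i - sg p.1 * posCoeff p.2 i) := by
    rw [maximalRoot_eq_fnc, ← map_sub]
    congr 1
    ext k
    simp only [simpleSum, rootCoord, Pi.sub_apply]
    ring
  simp only [e]
  exact fnc_simpleSum_mem_closure (maximal_sub_nonneg p) fun i _ => ⟨i, (fnc_simpleVec i).symm⟩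

lemma simpleRoots_sum_eq : simpleRoots hBasis.coord 0 + simpleRoots hBasis.coord 1 +
    simpleRoots hBasis.coord 2 + simpleRoots hBasis.coord 3 =
      fnc (simpleSum ![1, 1, 1, 1, 0, 0]) := by
  rw [fnc_simpleSum, Fin.sum_univ_six]
  simp [← fnc_simpleVec]

end RealForms
end

noncomputable section

namespace RealForms

open SymmetricCompositionAlgebra MagicAlgebra

/-! ### Skew matrices -/

section SkewMatrices

variable {n : Type*} [DecidableEq n]

/-- The skew matrix `E_{ij} - E_{ji}`. -/
def skewUnit (i j : n) : Matrix n n ℝ := Matrix.single i j 1 - Matrix.single j i 1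

lemma transpose_skewUnit (i j : n) : (skewUnit i j).transpose = -skewUnit i j := by
  simp [skewUnit]

variable [Fintype n]

lemma commutator_skewUnit {i j k : n} (hik : i ≠ k) (hjk : j ≠ k) (hij : i ≠ j) :
    skewUnit i k * skewUnit k j - skewUnit k j * skewUnit i k = skewUnit i j := by
  rw [skewUnit, skewUnit, skewUnit]
  simp only [sub_mul, mul_sub]
  simp [Matrix.single_mul_single_of_ne, hik, hjk, hij, hik.symm, hjk.symm, hij.symm]

lemma eq_sum_skewUnit {A : Matrix n n ℝ} (hA : A.transpose = -A) :
    A = ∑ i, ∑ j, (2⁻¹ * A i j) • skewUnit i j := by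
  ext a b
  have h : A b a = -A a b := by
    have := congrFun (congrFun hA a) b
    simpa using this
  simp only [Matrix.sum_apply, Matrix.smul_apply, skewUnit, Matrix.sub_apply, Matrix.single_apply,
    smul_eq_mul, mul_sub, Finset.sum_sub_distrib]
  simp only [ite_and, mul_ite, mul_one, mul_zero, Finset.sum_ite_irrel, Finset.sum_ite_eq',
    Finset.mem_univ, if_true, Finset.sum_const_zero]
  rw [h]
  ring

/-- The real orthogonal algebra is perfect: with a third index `k`, the generator at `i, j` is the
commutator of those at `i, k` and `k, j`. -/
lemma mem_of_commutator_mem (hn : 3 ≤ Fintype.card n) (N : Submodule ℝ (Matrix n n ℝ))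
    (hN : ∀ A B : Matrix n n ℝ, A.transpose = -A → B.transpose = -B → A * B - B * A ∈ N)
    {A : Matrix n n ℝ} (hA : A.transpose = -A) : A ∈ N := by
  rw [eq_sum_skewUnit hA]
  refine N.sum_mem fun i _ => N.sum_mem fun j _ => N.smul_mem _ ?_
  by_cases hij : i = j
  · subst hij
    rw [skewUnit, sub_self]
    exact N.zero_mem
  · have hlt : ({i, j} : Finset n).card < (Finset.univ : Finset n).card :=
      (Finset.card_le_two).trans_lt (by rw [Finset.card_univ]; omega)
    obtain ⟨k, -, hk⟩ := Finset.exists_mem_notMem_of_card_lt_card hlt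
    simp only [Finset.mem_insert, Finset.mem_singleton, not_or] at hk
    rw [← commutator_skewUnit (Ne.symm hk.1) (Ne.symm hk.2) hij]
    exact hN _ _ (transpose_skewUnit _ _) (transpose_skewUnit _ _)

end SkewMatrices

/-! ### The complexification of an orthogonal Lie algebra -/

section Complexification

variable {n : Type*} {D : Type*} [LieRing D] [LieAlgebra ℝ D]

/-- The inclusion of the real matrices in the complex matrices. -/
def matrixOfReal : Matrix n n ℝ →ₗ[ℝ] Matrix n n ℂ := (Algebra.linearMap ℝ ℂ).mapMatrix

lemma matrixOfReal_apply (A : Matrix n n ℝ) (i j : n) : matrixOfReal A i j = (A i j : ℂ) := rfl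

lemma matrixOfReal_mul [Fintype n] (A B : Matrix n n ℝ) :
    matrixOfReal (A * B) = matrixOfReal A * matrixOfReal B := by
  ext i j
  simp [matrixOfReal_apply, Matrix.mul_apply]

/-- The complexification of a real matrix representation. -/
def complexRep (F : D →ₗ[ℝ] Matrix n n ℝ) : ℂ ⊗[ℝ] D →ₗ[ℂ] Matrix n n ℂ :=
  LinearMap.liftBaseChange ℂ (matrixOfReal ∘ₗ F)

lemma complexRep_tmul (F : D →ₗ[ℝ] Matrix n n ℝ) (c : ℂ) (x : D) :
    complexRep F (c ⊗ₜ x) = c • matrixOfReal (F x) := by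
  rw [complexRep, LinearMap.liftBaseChange_tmul]
  rfl

lemma complexRep_re_add_im (F : D →ₗ[ℝ] Matrix n n ℝ) (x y : D) (i j : n) :
    complexRep F ((1 : ℂ) ⊗ₜ x + Complex.I ⊗ₜ y) i j = ⟨F x i j, F y i j⟩ := by
  rw [map_add, complexRep_tmul, complexRep_tmul, one_smul, Matrix.add_apply, Matrix.smul_apply,
    matrixOfReal_apply, matrixOfReal_apply]
  apply Complex.ext <;> simp

lemma complexRep_lie [Fintype n] {F : D →ₗ[ℝ] Matrix n n ℝ} (hF : ∀ x y, F ⁅x, y⁆ = F x * F y - F y * F x)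
    (z w : ℂ ⊗[ℝ] D) : complexRep F ⁅z, w⁆ =
      complexRep F z * complexRep F w - complexRep F w * complexRep F z := by
  induction z using TensorProduct.induction_on with
  | zero => simp
  | add z z' h h' =>
    rw [add_lie, map_add, h, h', map_add]
    noncomm_ring
  | tmul c x =>
    induction w using TensorProduct.induction_on with
    | zero => rw [complex_lie_zero]; simp
    | add w w' h h' =>
      rw [complex_lie_add, map_add, h, h', map_add]
      noncomm_ring
    | tmul d y =>
      rw [LieAlgebra.ExtendScalars.bracket_tmul, complexRep_tmul, complexRep_tmul,
        complexRep_tmul, hF, map_sub, matrixOfReal_mul, matrixOfReal_mul, smul_mul_smul_comm,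
        smul_mul_smul_comm, mul_comm d c, smul_sub]

/-- Real and imaginary parts of a complex skew matrix are real skew matrices, so a bijection onto
the real orthogonal algebra extends to one onto the complex orthogonal algebra. -/
lemma nonempty_complexification_equiv_so [Fintype n] [DecidableEq n]
    {F : D →ₗ[ℝ] Matrix n n ℝ}
    (hF : ∀ x y, F ⁅x, y⁆ = F x * F y - F y * F x) (hinj : Function.Injective F)
    (hskew : ∀ x, (F x).transpose = -F x)
    (hsurj : ∀ A : Matrix n n ℝ, A.transpose = -A → ∃ x, F x = A) :
    Nonempty (ℂ ⊗[ℝ] D ≃ₗ⁅ℂ⁆ LieAlgebra.Orthogonal.so n ℂ) := by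
  have hs : ∀ x i j, F x j i = -F x i j := fun x i j => congrFun (congrFun (hskew x) i) j
  have hmem : ∀ z, complexRep F z ∈ LieAlgebra.Orthogonal.so n ℂ := by
    intro z
    obtain ⟨x, y, rfl⟩ := exists_re_add_im z
    rw [LieAlgebra.Orthogonal.mem_so]
    ext i j
    rw [Matrix.transpose_apply, Matrix.neg_apply, complexRep_re_add_im, complexRep_re_add_im]
    apply Complex.ext
    · exact hs x i j
    · exact hs y i j
  let f : ℂ ⊗[ℝ] D →ₗ⁅ℂ⁆ LieAlgebra.Orthogonal.so n ℂ :=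
    { toFun := fun z => ⟨complexRep F z, hmem z⟩
      map_add' := fun z w => Subtype.ext (map_add (complexRep F) z w)
      map_smul' := fun c z => Subtype.ext (map_smul (complexRep F) c z)
      map_lie' := fun {z w} => Subtype.ext (complexRep_lie hF z w) }
  have hf : ∀ z, (f z : Matrix n n ℂ) = complexRep F z := fun _ => rfl
  refine ⟨LieEquiv.ofBijective f ⟨?_, ?_⟩⟩
  · refine (injective_iff_map_eq_zero f).2 fun z hz => ?_
    obtain ⟨x, y, rfl⟩ := exists_re_add_im z
    have h : ∀ i j, F x i j = 0 ∧ F y i j = 0 := by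
      intro i j
      have h1 : complexRep F ((1 : ℂ) ⊗ₜ x + Complex.I ⊗ₜ y) i j = 0 := by
        rw [← hf, hz]
        rfl
      rw [complexRep_re_add_im] at h1
      exact ⟨congrArg Complex.re h1, congrArg Complex.im h1⟩
    rw [re_add_im_eq_zero]
    constructor
    · exact hinj (by rw [map_zero]; ext i j; exact (h i j).1)
    · exact hinj (by rw [map_zero]; ext i j; exact (h i j).2)
  · rintro ⟨A, hA⟩
    rw [LieAlgebra.Orthogonal.mem_so] at hA
    have h : ∀ i j, A j i = -A i j := fun i j => congrFun (congrFun hA i) j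
    obtain ⟨x, hx⟩ := hsurj (A.map Complex.re) (by ext i j; simp [h i j])
    obtain ⟨y, hy⟩ := hsurj (A.map Complex.im) (by ext i j; simp [h i j])
    refine ⟨(1 : ℂ) ⊗ₜ x + Complex.I ⊗ₜ y, Subtype.ext ?_⟩
    rw [hf]
    ext i j
    rw [complexRep_re_add_im]
    apply Complex.ext
    · exact congrFun (congrFun hx i) j
    · exact congrFun (congrFun hy i) j

end Complexification

/-- The complex orthogonal Lie algebra of even degree is of type `D`. -/
def soEquivTypeD (l : Type*) [Fintype l] [DecidableEq l] :
    LieAlgebra.Orthogonal.so (l ⊕ l) ℂ ≃ₗ⁅ℂ⁆ LieAlgebra.Orthogonal.typeD l ℂ :=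
  letI : Invertible (2 : ℂ) := invertibleOfNonzero two_ne_zero
  ((LieAlgebra.Orthogonal.typeDEquivSo' l ℂ).trans
    (LieAlgebra.Orthogonal.soIndefiniteEquiv l l ℂ Complex.I_mul_I)).symm

/-! ### The action of `t` on `𝕆 ⊕ ℂ` -/

/-- The endomorphism of `𝕆 ⊕ ℂ` given by an element of `g`; on `t` this is a representation. -/
def tRep : G614 →ₗ[ℝ] Module.End ℝ (Octonion × ℂ) :=
  LinearMap.mk₂ ℝ (fun X v =>
    (X.tri.1 1 v.1 + (2 * v.2.re) • (pairEquiv.symm (X.iota 1)).1 +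
      (2 * v.2.im) • (pairEquiv.symm (X.iota 1)).2,
    X.tri'.1 1 v.2 - ((pO.q (pairEquiv.symm (X.iota 1)).1 v.1 : ℝ) +
      (pO.q (pairEquiv.symm (X.iota 1)).2 v.1 : ℝ) * Complex.I)))
    (fun X X' v => by
      refine Prod.ext ?_ ?_
      · simp
        abel
      · simp
        ring)
    (fun c X v => by
      refine Prod.ext ?_ ?_
      · simp
        module
      · simp [pC_tri_apply]
        ring)
    (fun X v v' => by
      refine Prod.ext ?_ ?_
      · simp
        module
      · simp
        ring)
    (fun c X v => by
      refine Prod.ext ?_ ?_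
      · simp
        module
      · simp [pC_tri_apply]
        ring)

lemma tRep_mkG (d : pO.tri) (d' : pC.tri) (a₀ b₀ a b a₂ b₂ x : Octonion) (z : ℂ) :
    tRep (mkG d d' a₀ b₀ a b a₂ b₂) (x, z) =
      (d.1 1 x + (2 * z.re) • a + (2 * z.im) • b,
        rot 1 d' * Complex.I * z - ((pO.q a x : ℝ) + (pO.q b x : ℝ) * Complex.I)) := by
  have e : pairEquiv.symm ((mkG d d' a₀ b₀ a b a₂ b₂).iota 1) = (a, b) := by
    rw [LinearEquiv.symm_apply_eq]
    rfl
  change (_ , _) = _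
  rw [e, pC_tri_apply]
  rfl

lemma exists_mkG_of_mem_tSub {X : G614} (hX : X ∈ tSub) :
    ∃ d d' a b, X = mkG d d' 0 0 a b 0 0 := by
  obtain ⟨d, d', a₀, b₀, a, b, a₂, b₂, rfl⟩ := exists_mkG X
  have h0 : a₀ = 0 ∧ b₀ = 0 := pair_eq_zero.1 hX.1
  have h2 : a₂ = 0 ∧ b₂ = 0 := pair_eq_zero.1 hX.2
  exact ⟨d, d', a, b, by rw [h0.1, h0.2, h2.1, h2.2]⟩

lemma mkG_mem_tSub (d : pO.tri) (d' : pC.tri) (a b : Octonion) : mkG d d' 0 0 a b 0 0 ∈ tSub :=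
  ⟨pair_eq_zero.2 ⟨rfl, rfl⟩, pair_eq_zero.2 ⟨rfl, rfl⟩⟩

/-- The triality parts act on `𝕆` and `ℂ` through the components with index `1`, which also govern
`ι₁`; the `ι₁` part exchanges the two summands. Two such exchanges commute to `2σ` on `𝕆` and a
rotation of `ℂ`, which are the first components of `2 θ(t)` and of a multiple of `θ(kC)`. -/
lemma tRep_lie {X Y : G614} (hX : X ∈ tSub) (hY : Y ∈ tSub) : tRep ⁅X, Y⁆ = tRep X * tRep Y - tRep Y * tRep X := by
  obtain ⟨d, d', a, b, rfl⟩ := exists_mkG_of_mem_tSub hX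
  obtain ⟨e, e', c, f, rfl⟩ := exists_mkG_of_mem_tSub hY
  have hcoe : ∀ d e : pO.tri, (d + e).1 = d.1 + e.1 := fun _ _ => rfl
  have hcoe' : ∀ (c : ℝ) (e : pO.tri), (c • e).1 = c • e.1 := fun _ _ => rfl
  have hcoe'' : ∀ d e : pO.tri, (d - e).1 = d.1 - e.1 := fun _ _ => rfl
  refine LinearMap.ext fun ⟨x, z⟩ => ?_
  rw [LinearMap.sub_apply, Module.End.mul_apply,
    Module.End.mul_apply, lie_mkG]
  simp only [tRep_mkG]
  refine Prod.ext ?_ ?_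
  · simp [hcoe, hcoe', hcoe'', t_zero_apply]
    module
  · simp [pO.tri_skew, kC]
    apply Complex.ext
    · simp
      linear_combination (2 * z.im) * pO.q_symm b c + (2 * z.re) * pO.q_symm a c
    · simp
      linear_combination (2 * z.re) * pO.q_symm a f + (2 * z.im) * pO.q_symm b f

end RealForms
end

noncomputable section

namespace RealForms

open SymmetricCompositionAlgebra MagicAlgebra

/-! ### The matrices of the elements of `t` -/

/-- The invariant form on `𝕆 ⊕ ℂ`. -/
def sumForm : (Octonion × ℂ) →ₗ[ℝ] (Octonion × ℂ) →ₗ[ℝ] ℝ :=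
  pO.q.compl₁₂ (LinearMap.fst ℝ Octonion ℂ) (LinearMap.fst ℝ Octonion ℂ) +
    pC.q.compl₁₂ (LinearMap.snd ℝ Octonion ℂ) (LinearMap.snd ℝ Octonion ℂ)

lemma sumForm_apply (v w : Octonion × ℂ) : sumForm v w = pO.q v.1 w.1 + pC.q v.2 w.2 := rfl

/-- An enumeration of the basis of `𝕆 ⊕ ℂ`. -/
def sumIndex : Fin 8 ⊕ Fin 2 ≃ Fin 5 ⊕ Fin 5 :=
  (finSumFinEquiv : Fin 8 ⊕ Fin 2 ≃ Fin (8 + 2)).trans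
    (finSumFinEquiv : Fin 5 ⊕ Fin 5 ≃ Fin (5 + 5)).symm

/-- The standard basis of `𝕆 ⊕ ℂ`. -/
def sumBasis : Module.Basis (Fin 8 ⊕ Fin 2) ℝ (Octonion × ℂ) := octB.prod Complex.basisOneI

lemma sumBasis_inl (i : Fin 8) : sumBasis (Sum.inl i) = (octBasis i, 0) := by
  simp [sumBasis]

lemma sumBasis_inr (i : Fin 2) : sumBasis (Sum.inr i) = (0, complexBasis i) := by
  rw [← complexB_apply]
  simp [sumBasis]

lemma sumForm_sumBasis (i j : Fin 8 ⊕ Fin 2) :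
    sumForm (sumBasis i) (sumBasis j) = if i = j then 2 else 0 := by
  rcases i with i | i <;> rcases j with j | j <;>
    simp [sumBasis_inl, sumBasis_inr, sumForm_apply, pO_q_basis, pC_q_basis]

lemma sumForm_repr (i : Fin 8 ⊕ Fin 2) (v : Octonion × ℂ) :
    sumForm (sumBasis i) v = 2 * sumBasis.repr v i := by
  conv_lhs => rw [← sumBasis.sum_repr v, map_sum]
  rw [Finset.sum_eq_single i]
  · rw [map_smul, sumForm_sumBasis, if_pos rfl, smul_eq_mul, mul_comm]
  · intro j _ hj
    rw [map_smul, sumForm_sumBasis, if_neg hj.symm, smul_zero]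
  · simp

/-- The matrix of an element of `t` on `𝕆 ⊕ ℂ`. -/
def tMat : G614 →ₗ[ℝ] Matrix (Fin 5 ⊕ Fin 5) (Fin 5 ⊕ Fin 5) ℝ :=
  (LinearMap.toMatrix (sumBasis.reindex sumIndex) (sumBasis.reindex sumIndex)).toLinearMap ∘ₗ tRep

lemma tMat_apply (X : G614) (i j : Fin 8 ⊕ Fin 2) : 2 * tMat X (sumIndex i) (sumIndex j) =
    sumForm (sumBasis i) (tRep X (sumBasis j)) := by
  rw [sumForm_repr]
  simp [tMat, LinearMap.toMatrix_apply]

lemma tMat_lie {X Y : G614} (hX : X ∈ tSub) (hY : Y ∈ tSub) :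
    tMat ⁅X, Y⁆ = tMat X * tMat Y - tMat Y * tMat X := by
  change LinearMap.toMatrix _ _ (tRep ⁅X, Y⁆) = LinearMap.toMatrix _ _ (tRep X) *
    LinearMap.toMatrix _ _ (tRep Y) - LinearMap.toMatrix _ _ (tRep Y) *
    LinearMap.toMatrix _ _ (tRep X)
  rw [tRep_lie hX hY, map_sub, LinearMap.toMatrix_mul, LinearMap.toMatrix_mul]

lemma sumForm_tRep {X : G614} (hX : X ∈ tSub) (v w : Octonion × ℂ) :
    sumForm v (tRep X w) = -sumForm w (tRep X v) := by
  obtain ⟨d, d', a, b, rfl⟩ := exists_mkG_of_mem_tSub hX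
  obtain ⟨x, z⟩ := v
  obtain ⟨y, u⟩ := w
  have h := pO.tri_skew d 1 y x
  rw [pO.q_symm] at h
  rw [sumForm_apply, sumForm_apply, tRep_mkG, tRep_mkG, pC_q, pC_q]
  simp
  rw [pO.q_symm x a, pO.q_symm x b, pO.q_symm y a, pO.q_symm y b]
  linear_combination h

lemma matrix_ext_of_sumIndex {A B : Matrix (Fin 5 ⊕ Fin 5) (Fin 5 ⊕ Fin 5) ℝ}
    (h : ∀ i j, 2 * A (sumIndex i) (sumIndex j) = 2 * B (sumIndex i) (sumIndex j)) : A = B := by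
  ext i j
  obtain ⟨i, rfl⟩ := sumIndex.surjective i
  obtain ⟨j, rfl⟩ := sumIndex.surjective j
  exact mul_left_cancel₀ two_ne_zero (h i j)

lemma transpose_tMat {X : G614} (hX : X ∈ tSub) : (tMat X).transpose = -tMat X := by
  refine matrix_ext_of_sumIndex fun i j => ?_
  rw [Matrix.transpose_apply, Matrix.neg_apply, mul_neg, tMat_apply, tMat_apply, sumForm_tRep hX]

/-- Applying `theta` turns the zeroth component, which can be any skew map, into the first. -/
lemma exists_tri_one (M : Matrix (Fin 8) (Fin 8) ℝ) (hM : ∀ i j, M i j = -M j i) :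
    ∃ d : pO.tri, ∀ i j, pO.q (octBasis i) (d.1 1 (octBasis j)) = 2 * M i j := by
  obtain ⟨d, hd⟩ := exists_tri_of_skew octB_orthonormal M hM
  refine ⟨pO.theta d, fun i j => ?_⟩
  rw [theta_apply_one, ← octB_apply, ← octB_apply, hd]

/-- The block on `𝕆` is realised by `tri(p𝕆)`, the block on `ℂ` by a rotation, and the two columns
of the mixed block by the two octonions of an element of `ι₁`; skewness supplies the last block. -/
lemma exists_tMat_eq {A : Matrix (Fin 5 ⊕ Fin 5) (Fin 5 ⊕ Fin 5) ℝ} (hA : A.transpose = -A) :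
    ∃ X ∈ tSub, tMat X = A := by
  have hs : ∀ i j, A j i = -A i j := fun i j => congrFun (congrFun hA i) j
  obtain ⟨d, hd⟩ := exists_tri_one
    (fun i j => A (sumIndex (Sum.inl i)) (sumIndex (Sum.inl j))) fun i j => hs _ _
  -- The factor `1/2` appears because `q(e_i, ·)` is twice the `i`-th coordinate.
  let col : Fin 2 → Octonion := fun k =>
    octB.equivFun.symm fun i => 2⁻¹ * A (sumIndex (Sum.inl i)) (sumIndex (Sum.inr k))
  have hcol : ∀ i k, pO.q (octBasis i) (col k) = A (sumIndex (Sum.inl i)) (sumIndex (Sum.inr k)) := by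
    intro i k
    have h := sumForm_repr (Sum.inl i) (col k, 0)
    rw [sumBasis_inl, sumForm_apply] at h
    simp only [map_zero, LinearMap.zero_apply, add_zero] at h
    have h1 : octB.repr (col k) i = 2⁻¹ * A (sumIndex (Sum.inl i)) (sumIndex (Sum.inr k)) :=
      congrFun (octB.equivFun.apply_symm_apply _) i
    have h2 : sumBasis.repr (col k, 0) (Sum.inl i) = octB.repr (col k) i := by simp [sumBasis]
    rw [h, h2, h1]
    ring
  -- One entry determines a skew `2 × 2` block. The second rotation does not act on `𝕆 ⊕ ℂ`, so `0`
  -- is chosen for it below.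
  set r := A (sumIndex (Sum.inr 1)) (sumIndex (Sum.inr 0)) with hr
  have hX := mkG_mem_tSub d (rotTri r 0) (col 0) (col 1)
  refine ⟨_, hX, matrix_ext_of_sumIndex fun i j => ?_⟩
  have hlr : ∀ i k, 2 * tMat (mkG d (rotTri r 0) 0 0 (col 0) (col 1) 0 0) (sumIndex (Sum.inl i))
      (sumIndex (Sum.inr k)) = 2 * A (sumIndex (Sum.inl i)) (sumIndex (Sum.inr k)) := by
    intro i k
    rw [tMat_apply, sumBasis_inl, sumBasis_inr, sumForm_apply, tRep_mkG]
    simp only [map_zero, LinearMap.zero_apply, add_zero, zero_add, map_add, map_smul, hcol,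
      smul_eq_mul]
    fin_cases k <;> simp [complexBasis]
  rcases i with i | i <;> rcases j with j | j
  · rw [tMat_apply, sumBasis_inl, sumBasis_inl, sumForm_apply, tRep_mkG]
    simp [hd]
  · exact hlr i j
  · have h1 : ∀ a b, tMat (mkG d (rotTri r 0) 0 0 (col 0) (col 1) 0 0) a b =
        -tMat (mkG d (rotTri r 0) 0 0 (col 0) (col 1) 0 0) b a := fun a b =>
      congrFun (congrFun (transpose_tMat hX) b) a
    rw [h1, hs (sumIndex (Sum.inl j)), mul_neg, mul_neg, hlr]
  · have h1 := hs (sumIndex (Sum.inr 0)) (sumIndex (Sum.inr 0))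
    have h2 := hs (sumIndex (Sum.inr 1)) (sumIndex (Sum.inr 1))
    have h3 := hs (sumIndex (Sum.inr 1)) (sumIndex (Sum.inr 0))
    rw [tMat_apply, sumBasis_inr, sumBasis_inr, sumForm_apply, tRep_mkG, pC_q]
    fin_cases i <;> fin_cases j <;> simp [complexBasis] <;> linarith

/-! ### The structure of `t` -/

/-- A generator of the centre of `t`. -/
def tCenter : G614 := mkG 0 (rotTri 0 1) 0 0 0 0 0 0

lemma tCenter_mem : tCenter ∈ tSub := mkG_mem_tSub _ _ _ _

lemma tCenter_ne_zero : tCenter ≠ 0 := by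
  intro h
  rw [tCenter, ← mkG_zero, mkG_inj] at h
  have := congrArg (rot 2) h.2.1
  simp at this

/-- `tri(pℂ)` acts on `ι₁` through the first rotation, which vanishes for this element, and it is
abelian and commutes with `tri(p𝕆)`. -/
lemma lie_tCenter {X : G614} (hX : X ∈ tSub) : ⁅X, tCenter⁆ = 0 := by
  obtain ⟨d, d', a, b, rfl⟩ := exists_mkG_of_mem_tSub hX
  rw [tCenter, lie_mkG, ← mkG_zero, mkG_inj]
  simp [triLie_zero_right]

/-- The kernel of the action: `d₁ = 0` forces `d = 0` by triality, nondegeneracy of `q` removes the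
`ι₁` part, and of `tri(pℂ)` only the second rotation remains. -/
lemma exists_smul_tCenter {X : G614} (hX : X ∈ tSub) (h : tMat X = 0) :
    ∃ c : ℝ, c • tCenter = X := by
  have h0 : tRep X = 0 := by
    have : LinearMap.toMatrix (sumBasis.reindex sumIndex) (sumBasis.reindex sumIndex)
        (tRep X) = 0 := h
    simpa using this
  obtain ⟨d, d', a, b, rfl⟩ := exists_mkG_of_mem_tSub hX
  have hv : ∀ x z, tRep (mkG d d' 0 0 a b 0 0) (x, z) = 0 := fun x z => by rw [h0]; rfl
  have hx : ∀ x, d.1 1 x = 0 ∧ pO.q a x = 0 ∧ pO.q b x = 0 := by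
    intro x
    have h1 := hv x 0
    rw [tRep_mkG, Prod.mk_eq_zero] at h1
    obtain ⟨h1, h2⟩ := h1
    have h3 := congrArg Complex.re h2
    have h4 := congrArg Complex.im h2
    simp at h1 h3 h4
    exact ⟨h1, h3, h4⟩
  have hr : rot 1 d' = 0 := by
    have h1 := hv 0 1
    rw [tRep_mkG, Prod.mk_eq_zero] at h1
    have h3 := congrArg Complex.im h1.2
    simpa using h3
  have ha : a = 0 := pO.nondegenerate a fun y => (hx y).2.1
  have hb : b = 0 := pO.nondegenerate b fun y => (hx y).2.2
  have hd : pO.theta (pO.theta d) = 0 :=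
    pO_tri_eq_zero _ (LinearMap.ext fun x => (hx x).1)
  have hd' : d = 0 := by
    have hi : ∀ i z, (pO.theta (pO.theta d)).1 i z = 0 := fun i z => by rw [hd]; rfl
    exact pO.tri_ext (hi 2) (hi 0) (hi 1)
  refine ⟨rot 2 d', ?_⟩
  rw [tCenter, mkG_smul, mkG_inj]
  refine ⟨by simp [hd'], pC_tri_ext ?_ ?_, ?_, ?_, ?_, ?_, ?_, ?_⟩ <;> simp [hr, ha, hb]

end RealForms
end

/-! ### The splitting of `t` into its centre and its derived algebra. -/

noncomputable section

namespace RealForms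

open SymmetricCompositionAlgebra MagicAlgebra

lemma lie_mem_derivedSeries_one (x y : tSub) : ⁅x, y⁆ ∈ LieAlgebra.derivedSeries ℝ tSub 1 := by
  rw [LieAlgebra.derivedSeries_def, LieAlgebra.derivedSeriesOfIdeal_succ,
    LieAlgebra.derivedSeriesOfIdeal_zero]
  exact LieSubmodule.lie_mem_lie (LieSubmodule.mem_top x) (LieSubmodule.mem_top y)

/-- By invariance `κ([u, v], x) = κ(u, [v, x]) = 0` for central `x`. The Killing form is that of
`g`, since the one of `t` would degenerate on the centre. -/
lemma killingForm_center_derivedSeries {x d : tSub} (hx : x ∈ LieAlgebra.center ℝ tSub)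
    (hd : d ∈ LieAlgebra.derivedSeries ℝ tSub 1) :
    killingForm ℝ G614 (d : G614) (x : G614) = 0 := by
  have h : d ∈ Submodule.span ℝ {z | ∃ x y : tSub, ⁅x, y⁆ = z} := by
    rw [← LieAlgebra.coe_derivedSeries_one_eq (R := ℝ)]
    exact hd
  clear hd
  induction h using Submodule.span_induction with
  | mem z hz =>
    obtain ⟨u, v, rfl⟩ := hz
    have h1 : ⁅v, x⁆ = 0 := hx v
    have h2 : ⁅(v : G614), (x : G614)⁆ = 0 := congrArg Subtype.val h1
    rw [LieSubalgebra.coe_bracket, killingForm, LieModule.traceForm_apply_lie_apply, h2, map_zero]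
  | zero => simp
  | add z w _ _ h1 h2 =>
    change killingForm ℝ G614 ((z : G614) + (w : G614)) (x : G614) = 0
    rw [map_add, LinearMap.add_apply, h1, h2, add_zero]
  | smul c z _ h1 =>
    change killingForm ℝ G614 (c • (z : G614)) (x : G614) = 0
    rw [map_smul, LinearMap.smul_apply, h1, smul_zero]

/-- Such an element would be orthogonal to itself, against definiteness on `t`. -/
lemma eq_zero_of_mem_center_of_mem_derivedSeries {x : tSub} (hx : x ∈ LieAlgebra.center ℝ tSub)
    (hd : x ∈ LieAlgebra.derivedSeries ℝ tSub 1) : x = 0 := by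
  by_contra h
  have h1 := killingForm_tSub x x.2 (fun h0 => h (Subtype.ext h0))
  rw [killingForm_center_derivedSeries hx hd] at h1
  exact lt_irrefl _ h1

/-- The central generator as an element of `t`. -/
def tCenter' : tSub := ⟨tCenter, tCenter_mem⟩

lemma smul_tCenter_mem_center (c : ℝ) : c • tCenter' ∈ LieAlgebra.center ℝ tSub :=
  (LieAlgebra.center ℝ tSub).smul_mem c fun x => Subtype.ext (lie_tCenter x.2)

lemma exists_eq_smul_of_tMat_eq_zero {x : tSub} (h : tMat x = 0) : ∃ c : ℝ, c • tCenter' = x := by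
  obtain ⟨c, hc⟩ := exists_smul_tCenter x.2 h
  exact ⟨c, Subtype.ext hc⟩

/-- The matrix representation of `t`. -/
def tMatRestrict : tSub →ₗ[ℝ] Matrix (Fin 5 ⊕ Fin 5) (Fin 5 ⊕ Fin 5) ℝ :=
  tMat ∘ₗ tSub.toSubmodule.subtype

lemma tMatRestrict_apply (x : tSub) : tMatRestrict x = tMat x := rfl

/-- The image of the derived algebra contains all commutators of skew matrices, hence all skew
matrices. -/
lemma exists_derivedSeries_tMat_eq {A : Matrix (Fin 5 ⊕ Fin 5) (Fin 5 ⊕ Fin 5) ℝ}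
    (hA : A.transpose = -A) :
    ∃ x : LieAlgebra.derivedSeries ℝ tSub 1, tMat ((x : tSub) : G614) = A := by
  have h := mem_of_commutator_mem (by simp)
    ((LieAlgebra.derivedSeries ℝ tSub 1).toSubmodule.map tMatRestrict)
    (fun A B hA hB => ?_) hA
  · obtain ⟨x, hx, rfl⟩ := h
    exact ⟨⟨x, hx⟩, (tMatRestrict_apply x).symm⟩
  · obtain ⟨X, hX, rfl⟩ := exists_tMat_eq hA
    obtain ⟨Y, hY, rfl⟩ := exists_tMat_eq hB
    have h : tMat X * tMat Y - tMat Y * tMat X =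
        tMatRestrict ⁅(⟨X, hX⟩ : tSub), (⟨Y, hY⟩ : tSub)⁆ := by
      rw [tMatRestrict_apply, LieSubalgebra.coe_bracket, tMat_lie hX hY]
    rw [h]
    exact Submodule.mem_map_of_mem (lie_mem_derivedSeries_one _ _)

/-- An element of the derived algebra with the same matrix differs from `x` by an element of the
kernel, which is the central line. -/
lemma exists_derivedSeries_add_smul (x : tSub) : ∃ d ∈ LieAlgebra.derivedSeries ℝ tSub 1,
    ∃ c : ℝ, c • tCenter' + d = x := by
  obtain ⟨d, hd⟩ := exists_derivedSeries_tMat_eq (transpose_tMat x.2)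
  have h : tMat ((x - (d : tSub) : tSub) : G614) = 0 := by
    change tMat ((x : G614) - ((d : tSub) : G614)) = 0
    rw [map_sub, hd, sub_self]
  obtain ⟨c, hc⟩ := exists_eq_smul_of_tMat_eq_zero h
  exact ⟨d, d.2, c, by rw [hc, sub_add_cancel]⟩

lemma isCompl_center_derivedSeries : IsCompl (LieAlgebra.center ℝ tSub)
    (LieAlgebra.derivedSeries ℝ tSub 1) := by
  rw [← LieSubmodule.isCompl_toSubmodule, isCompl_iff, Submodule.disjoint_def,
    Submodule.codisjoint_iff_exists_add_eq]
  refine ⟨fun x h1 h2 => eq_zero_of_mem_center_of_mem_derivedSeries h1 h2, fun x => ?_⟩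
  obtain ⟨d, hd, c, h⟩ := exists_derivedSeries_add_smul x
  exact ⟨_, d, smul_tCenter_mem_center c, hd, h⟩

lemma finrank_center_tSub : Module.finrank ℝ (LieAlgebra.center ℝ tSub) = 1 := by
  have h1 : tCenter' ∈ LieAlgebra.center ℝ tSub := by
    simpa using smul_tCenter_mem_center 1
  refine finrank_eq_one (⟨tCenter', h1⟩ : LieAlgebra.center ℝ tSub) ?_ ?_
  · intro h
    exact tCenter_ne_zero (congrArg (fun z => (z.1 : G614)) h)
  · rintro ⟨x, hx⟩
    obtain ⟨d, hd, c, rfl⟩ := exists_derivedSeries_add_smul x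
    have h2 : d ∈ LieAlgebra.center ℝ tSub := by
      have := sub_mem hx (smul_tCenter_mem_center c)
      rwa [add_sub_cancel_left] at this
    have h3 := eq_zero_of_mem_center_of_mem_derivedSeries h2 hd
    exact ⟨c, Subtype.ext (h3 ▸ (add_zero (c • tCenter')).symm : c • tCenter' = c • tCenter' + d)⟩

/-- The kernel of the matrix representation is central, so it meets the derived algebra trivially;
the derived algebra is thus isomorphic to the real `so(10)`. -/
lemma nonempty_complexification_derivedSeries_equiv_typeD :
    Nonempty (ℂ ⊗[ℝ] (LieAlgebra.derivedSeries ℝ tSub 1) ≃ₗ⁅ℂ⁆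
      LieAlgebra.Orthogonal.typeD (Fin 5) ℂ) := by
  let F : LieAlgebra.derivedSeries ℝ tSub 1 →ₗ[ℝ] Matrix (Fin 5 ⊕ Fin 5) (Fin 5 ⊕ Fin 5) ℝ :=
    tMatRestrict ∘ₗ (LieAlgebra.derivedSeries ℝ tSub 1).toSubmodule.subtype
  have hinj : Function.Injective F := by
    refine (injective_iff_map_eq_zero F).2 fun x hx => ?_
    obtain ⟨c, hc⟩ := exists_eq_smul_of_tMat_eq_zero (x := x.1) hx
    refine Subtype.ext (eq_zero_of_mem_center_of_mem_derivedSeries ?_ x.2)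
    rw [← hc]
    exact smul_tCenter_mem_center c
  obtain ⟨e⟩ := nonempty_complexification_equiv_so (F := F)
    (fun x y => tMat_lie x.1.2 y.1.2) hinj (fun x => transpose_tMat x.1.2)
    (fun A hA => exists_derivedSeries_tMat_eq hA)
  exact ⟨e.trans (soEquivTypeD (Fin 5))⟩

end RealForms
end

/-! ### The restrictions of `β₁` and `β₂`, and the assembled theorem. -/

noncomputable section

namespace RealForms

lemma simpleSum_first_four : simpleSum ![1, 1, 1, 1, 0, 0] 4 = 1 ∧
    simpleSum ![1, 1, 1, 1, 0, 0] 5 = 1 := by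
  decide

lemma neg_simpleVec_one : (-simpleVec 1) 4 = -2 ∧ (-simpleVec 1) 5 = 0 := by
  decide

lemma neg_simpleRoots_one : -simpleRoots hBasis.coord 1 = fnc (-simpleVec 1) := by
  rw [← fnc_simpleVec, map_neg]

end RealForms
end

theorem mainTheorem2 :
    -- `g = t ⊕ p` is a Cartan decomposition; the Killing form has signature `-14`
    RealForms.IsCartanDecomposition RealForms.tSub RealForms.pSub ∧
    (∀ x ∈ RealForms.tSub, x ≠ 0 → killingForm ℝ RealForms.G614 x x < 0) ∧
    (∀ x ∈ RealForms.pSub, x ≠ 0 → 0 < killingForm ℝ RealForms.G614 x x) ∧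
    Module.finrank ℝ RealForms.tSub = 46 ∧ Module.finrank ℝ RealForms.pSub = 32 ∧
    RealForms.killingSignature RealForms.G614 = -14 ∧
    -- `t` is of type `D₅ + Z` with a one-dimensional centre `Z`
    (IsCompl (LieAlgebra.center ℝ RealForms.tSub)
        (LieAlgebra.derivedSeries ℝ RealForms.tSub 1) ∧
      Module.finrank ℝ (LieAlgebra.center ℝ RealForms.tSub) = 1 ∧
      Nonempty (ℂ ⊗[ℝ] (LieAlgebra.derivedSeries ℝ RealForms.tSub 1) ≃ₗ⁅ℂ⁆
        LieAlgebra.Orthogonal.typeD (Fin 5) ℂ)) ∧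
    -- `a` is a two-dimensional maximal abelian subspace of `p`
    Module.finrank ℝ RealForms.aSub = 2 ∧
    RealForms.IsMaximalAbelianIn RealForms.aSub RealForms.pSub ∧
    -- `h ⊇ a` is a maximal abelian subalgebra of `g`, and `h ∩ t` is as described
    RealForms.hSub.toSubmodule = Submodule.span ℝ (Set.range RealForms.hGen) ∧
    RealForms.IsMaximalAbelianIn RealForms.hSub.toSubmodule ⊤ ∧
    RealForms.hSub.toSubmodule ⊓ RealForms.tSub.toSubmodule =
      Submodule.span ℝ {RealForms.tE 2 3, RealForms.tE 4 5, RealForms.tE 6 7,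
        RealForms.ofTri' RealForms.zC} ∧
    RealForms.aSub ⊔ (RealForms.hSub.toSubmodule ⊓ RealForms.tSub.toSubmodule) =
      RealForms.hSub.toSubmodule ∧
    -- `g^ℂ` is simple and `h^ℂ` is a Cartan subalgebra; coordinates on `h^ℂ` and on `a`
    LieAlgebra.IsSimple ℂ (ℂ ⊗[ℝ] RealForms.G614) ∧
    ∃ (_ : LieAlgebra.IsKilling ℂ (ℂ ⊗[ℝ] RealForms.G614))
      (_ : (RealForms.complexify RealForms.hSub).IsCartanSubalgebra)
      (η : Module.Basis (Fin 6) ℂ (RealForms.complexify RealForms.hSub))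
      (κ : Module.Basis (Fin 2) ℝ RealForms.aSub),
      (∀ j, (η j : ℂ ⊗[ℝ] RealForms.G614) = 1 ⊗ₜ[ℝ] RealForms.hGen j) ∧
      (κ 0 : RealForms.G614) = RealForms.hGen 4 ∧ (κ 1 : RealForms.G614) = RealForms.hGen 5 ∧
      -- the roots, the simple roots and the Satake diagram
      Set.range (LieAlgebra.IsKilling.rootSystem (RealForms.complexify RealForms.hSub)).root =
        RealForms.rootList η.coord ∧
      RealForms.IsSatakeDiagram RealForms.aSub_le_hSub (RealForms.simpleRoots η.coord)
        RealForms.satakeEIII ∧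
      -- the restricted roots
      RealForms.restrictedRoots RealForms.aSub =
        {l | l = κ.coord 0 ∨ l = -κ.coord 0 ∨ l = κ.coord 1 ∨ l = -κ.coord 1 ∨
          ∃ s ∈ ({1, -1} : Set ℝ), ∃ t ∈ ({1, -1} : Set ℝ),
            l = s • κ.coord 0 + t • κ.coord 1 ∨
            l = (1 / 2 : ℝ) • (s • κ.coord 0 + t • κ.coord 1)} ∧
      RealForms.IsTypeBC 2 (RealForms.restrictedRoots RealForms.aSub) ∧
      (∃ β₁ β₂ : Module.Dual ℝ RealForms.aSub,
        (∀ x, RealForms.restrictToReal RealForms.aSub_le_hSub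
          (RealForms.simpleRoots η.coord 0 + RealForms.simpleRoots η.coord 1 +
            RealForms.simpleRoots η.coord 2 + RealForms.simpleRoots η.coord 3) x = (β₁ x : ℂ)) ∧
        (∀ x, RealForms.restrictToReal RealForms.aSub_le_hSub
          (-RealForms.simpleRoots η.coord 1) x = (β₂ x : ℂ)) ∧
        β₁ = (1 / 2 : ℝ) • (κ.coord 0 + κ.coord 1) ∧ β₂ = -κ.coord 0 ∧
        RealForms.restrictedRoots RealForms.aSub =
          {l | ∃ r ∈ ({β₁, β₂, β₁ + β₂, 2 • β₁ + β₂, 2 • β₁, 2 • β₁ + 2 • β₂} :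
            Set (Module.Dual ℝ RealForms.aSub)), l = r ∨ l = -r}) ∧
      -- the multiplicities
      (∀ s ∈ ({1, -1} : Set ℝ), ∀ t ∈ ({1, -1} : Set ℝ),
        RealForms.multiplicity RealForms.aSub
          ((1 / 2 : ℝ) • (s • κ.coord 0 + t • κ.coord 1)) = 8 ∧
        RealForms.multiplicity RealForms.aSub (s • κ.coord 0 + t • κ.coord 1) = 1 ∧
        RealForms.multiplicity RealForms.aSub (s • κ.coord 0) = 6 ∧
        RealForms.multiplicity RealForms.aSub (s • κ.coord 1) = 6) ∧
      -- the maximal root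
      RealForms.maximalRoot η.coord = η.coord 4 + η.coord 5 ∧
      RealForms.maximalRoot η.coord ∈ RealForms.rootList η.coord ∧
      (∀ r ∈ RealForms.rootList η.coord, RealForms.maximalRoot η.coord - r ∈
        AddSubmonoid.closure (Set.range (RealForms.simpleRoots η.coord))) ∧
      (∃ l : Module.Dual ℝ RealForms.aSub,
        (∀ x, RealForms.restrictToReal RealForms.aSub_le_hSub
          (RealForms.maximalRoot η.coord) x = (l x : ℂ)) ∧
        RealForms.multiplicity RealForms.aSub l = 1) := by
  refine ⟨RealForms.isCartanDecomposition_G614, RealForms.killingForm_tSub,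
    RealForms.killingForm_pSub, RealForms.finrank_tSub, RealForms.finrank_pSub,
    RealForms.killingSignature_G614,
    ⟨RealForms.isCompl_center_derivedSeries, RealForms.finrank_center_tSub,
      RealForms.nonempty_complexification_derivedSeries_equiv_typeD⟩,
    RealForms.finrank_aSub, RealForms.isMaximalAbelianIn_aSub, RealForms.hSub_toSubmodule,
    RealForms.isMaximalAbelianIn_hSub, RealForms.hSub_inf_tSub,
    RealForms.aSub_sup_hSub_inf_tSub, RealForms.isSimple_G614, RealForms.isKilling_G614,
    RealForms.isCartanSubalgebra_hSub, RealForms.hBasis, RealForms.aBasis,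
    RealForms.hBasis_apply, RealForms.aBasis_zero, RealForms.aBasis_one,
    RealForms.range_root_eq_rootList, RealForms.isSatakeDiagram_simpleRoots,
    RealForms.restrictedRoots_eq, RealForms.isTypeBC_restrictedRoots,
    -- The arguments of `aFnc` count halves: these are `½(w₅ + w₆)` and `-w₅`, and `aFnc (2, 2)`
    -- below is `w₅ + w₆`.
    ⟨RealForms.aFnc (1, 1), RealForms.aFnc (-2, 0), fun x => ?_, fun x => ?_, ?_, ?_,
      RealForms.restrictedRoots_eq_of_base rfl rfl⟩,
    fun s hs t ht => RealForms.multiplicities hs ht, RealForms.maximalRoot_eq,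
    RealForms.maximalRoot_mem, fun r hr => RealForms.maximalRoot_sub_mem hr,
    ⟨RealForms.aFnc (2, 2), fun x => ?_, RealForms.multiplicity_eq_one (by decide)⟩⟩
  · rw [RealForms.simpleRoots_sum_eq, RealForms.restrictToReal_fnc,
      RealForms.simpleSum_first_four.1, RealForms.simpleSum_first_four.2]
  · rw [RealForms.neg_simpleRoots_one, RealForms.restrictToReal_fnc,
      RealForms.neg_simpleVec_one.1, RealForms.neg_simpleVec_one.2]
  · rw [RealForms.coord_zero_eq, RealForms.coord_one_eq, RealForms.aFnc_add]
    simp only [RealForms.aFnc]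
    push_cast
    module
  · rw [RealForms.coord_zero_eq, RealForms.aFnc_neg]
    rfl
  · rw [RealForms.maximalRoot_eq_fnc, RealForms.restrictToReal_fnc,
      RealForms.simpleSum_maximal]
    rfl
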